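/- **Setting.** Let $L\ge 2$. The Heisenberg algebra has generators $a_i(m),Q_i$ ($m\in\mathbf Z$, $1\le i\le L$) with $[a_i(m),a_j(n)]=\frac1mA_{i,j}(m)\delta_{m+n,0}$ ($m,n\ne0$), $[a_i(0),Q_j]=A_{i,j}(0)$, other commutators $0$, where $A_{i,j}(m)\in\mathbf C$, $A_{i,j}(0)\in\mathbf R$, $A_{i,i}(m)=1$ ($m\neq 0$), $A_{i,j}(m)=A_{j,i}(-m)$ ($i\ne j$), $\det(A_{i,j}(m))_{i,j=1}^L\neq0$ for all $m\in\mathbf Z$. It acts on the direct sum over all momenta $k\in\mathbf C^L$ of the Fock spaces on which $a_i(0)=k_i$; $e^{Q_j}$ shifts $k$ by $(A_{i,j}(0))_i$. Normal ordering puts $a_i(m)$, $m<0$, and $Q_j$ to the left of $a_i(m)$, $m\ge0$. Put $$T_1(z)=\sum_{i=1}^{L+1}g_i\Lambda_i(z),\quad \Lambda_i(z)=e^{\sum_j\lambda_{i,j}(0)a_j(0)}:\exp\Big(\sum_{j}\sum_{m\ne0}\lambda_{i,j}(m)a_j(m)z^{-m}\Big):,$$ $$S_j(w)=w^{\frac12A_{j,j}(0)}e^{Q_j}w^{a_j(0)}:\exp\Big(\sum_{m\ne0}s_j(m)a_j(m)w^{-m}\Big):,\quad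 \widetilde S_j(w)=e^{-Q_j}S_j(w)\quad(1\le j\le L).$$ For vertex operators write $V(z)W(w)=\varphi_{V,W}(z,w):V(z)W(w):$ with $\varphi_{V,W}\in\mathbf C[[w/z]]$. Fix a function $\log$ on $\mathbf C\setminus\{0\}$ with $e^{\log u}=u$, and put $q_{j,j}^c=e^{c\log q_{j,j}}$, $q_{j+1,j}^c=q_{j,j}^c\,e^{c\log(q_{j+1,j}/q_{j,j})}$ for $c\in\mathbf C$. For $\delta(z)=\sum_{m\in\mathbf Z}z^m$ and a current $B(z)=\sum_{c\in\mathbf C}B_cz^c$, $B(z)\delta(qw/z)$ means $B(qw)\delta(qw/z)$. Let $p_{i,j},q_{i,j}\in\mathbf C\setminus\{0\}$. **Conditions.** (1) Mutual locality: for $1\le i\le L+1$, $1\le j\le L$, $\varphi_{\Lambda_i,S_j}(z,w)$ and $\varphi_{S_j,\Lambda_i}(w,z)$ converge, for $|z|\gg|w|$ and $|w|\gg|z|$ respectively, to $\dfrac{w-z/p_{i,j}}{w-z/q_{i,j}}$. (2) Commutativity: $[T_1(z),S_j(w)]=B_j(z)\big(\delta(\tfrac{q_{j,j}w}z)-\delta(\tfrac{q_{j+1,j}w}z)\big)$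 for $1\le j\le L$. (3) Symmetry: $\varphi_{\widetilde S_k,\widetilde S_l}(w,z)=\varphi_{\widetilde S_l,\widetilde S_k}(w,z)$ for all $k,l$, and $\varphi_{\widetilde S_k,\widetilde S_l}=1$ for $|k-l|\ge2$. (4) For each $j$ the numbers $q_{i,j}$ ($1\le i\le L+1$) are distinct; $|q_{j+1,j}/q_{j,j}|\neq1$ ($1\le j\le L$); $-1<A_{k,k+1}(0)<0$ ($1\le k\le L-1$). (5) All $g_i\neq0$, and $p_{i,j}\ne q_{i,j}$ for at least one pair $(i,j)$. **Notation.** Let $J=\{j: A_{j,j}(0)=1\}$, assumed nonempty, and $K=|J|$. Extend $(A_{i,j}(0))_{i,j=1}^L$ to a symmetric matrix indexed by $0,\dots,L$, indices read modulo $L+1$: $A_{0,1}(0)=A_{1,2}(0)$ if $1\notin J$ and $-1-A_{1,2}(0)$ if $1\in J$; $A_{0,L}(0)=A_{L,L-1}(0)$ if $L\notin J$ and $-1-A_{L,L-1}(0)$ if $L\in J$; $A_{0,0}(0)=-2A_{0,L}(0)$ for $K$ even and $1$ for $K$ odd; $A_{0,i}(0)=0$ for $i\ne0,1,L$. Let $\widehat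 J=J$ for $K$ even and $J\cup\{L+1\}$ for $K$ odd; $\widehat I(d)=\{1\le j\le L+1: A_{j-1,j}(0)=d\}$. For $r>1$ set $D(k,l)=\sum_{j=k+1}^{l+1}d_j$ for $k\le l$ and $D(k,l)=0$ for $k>l$, where $d_j=r-1$ if $j\in\widehat I(-\frac1r)$, $d_j=1$ otherwise. Given $x\ne0$ with a chosen value of $\log x$, put $x^a=e^{a\log x}$, $[a]_x=\frac{x^a-x^{-a}}{x-x^{-1}}$. **Explicit parameters** with data $r,\log x,g$. All $A_{i,j}(0)$ are real. In each brace below, the first line applies if the index named is in $\widehat I(-\frac1r)$, the second if it is in $\widehat I(\frac{1-r}r)$. * For $1\le i\le L+1$: $A_{i,i}(0)=1$ if $i\in\widehat J$; if $i\notin\widehat J$, $A_{i,i}(0)=\frac2r$ for $i\in\widehat I(-\frac1r)$ and $\frac{2(r-1)}r$ for $i\in\widehat I(\frac{1-r}r)$. For $1\le j\le L+1$: $A_{j-1,j}(0)=A_{j,j-1}(0)\in\{-\frac1r,\frac{1-r}r\}$, and $A_{j,j+1}(0)=A_{j-1,j}(0)$ if $j\notin\widehat J$, $A_{j,j+1}(0)=-1-A_{j-1,j}(0)$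 if $j\in\widehat J$. $A_{k,l}(0)=A_{l,k}(0)=0$ if $|k-l|\ge2$, $1\le k,l\le L$, or $k=0$, $l\ne0,1,L$. * $q_{j,j}=x^{D(1,j-1)}$, $q_{j+1,j}=x^{2r+D(1,j-1)}$ ($1\le j\le L$); $p_{1,1}=\begin{cases}x^2\\x^{2r-2}\end{cases}$ (index $1$); $p_{j,j}=x^{D(1,j-2)}\begin{cases}x^{r+1}\\x^{2r-1}\end{cases}$ (index $j$, $2\le j\le L$); $p_{j,j-1}=x^{D(1,j-2)}\begin{cases}x^{2r-2}\\x^2\end{cases}$ (index $j$, $2\le j\le L+1$); $p_{k,l}=q_{k,l}$ for $k\ne l,l+1$. * For $m>0$, $1\le j\le L$: $s_j(m)=1$; $s_j(-m)=-1$ if $j\in\widehat J$, and if $j\notin\widehat J$, $s_j(-m)=\begin{cases}-\frac{[m]_x[2(r-1)m]_x}{[rm]_x[(r-1)m]_x}\\-\frac{[(r-1)m]_x[2m]_x}{[rm]_x[m]_x}\end{cases}$ (index $j$). * For $m\ne0$: $A_{j,j}(m)=1$; $A_{k,l}(m)=0$ for $|k-l|\ge2$; for $2\le j\le L$, $A_{j-1,j}(m)=c\cdot\frac1{s_j(-m)}$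 if $m>0$ and $c\cdot\frac1{s_{j-1}(m)}$ if $m<0$, where $c=\begin{cases}[m]_x/[rm]_x\\ [(r-1)m]_x/[rm]_x\end{cases}$ (index $j$); $A_{j-1,j}(-m)=A_{j,j-1}(m)$ and $A_{j,j-1}(-m)=A_{j-1,j}(m)$ for $m>0$. * $\lambda_{i,j}(0)=\dfrac{2r\log x}{D(0,L)}\times D(0,j-1)$ if $j\le i-1$, and $\dfrac{2r\log x}{D(0,L)}\times(-D(j,L))$ if $i\le j\le L$. * For $m\ne0$: $\dfrac{\lambda_{i,j}(m)}{s_j(m)}=\dfrac{[rm]_x(x-x^{-1})}{[D(0,L)m]_x}\times\big(-x^{(r+D(1,L))m}[D(0,j-1)m]_x\big)$ if $j\le i-1$, and the same factor times $x^{(r-D(0,0))m}[D(j,L)m]_x$ if $i\le j\le L$. * $g_i=g\begin{cases}[r-1]_x\\1\end{cases}$ (index $i$, $1\le i\le L+1$). **Freedom.** Parameters are *explicit up to freedom* if they become explicit parameters after a composition of the following changes (all conditions (1)–(3) are stable under them): (a) $\lambda_{i,j}(m)\mapsto t^m\lambda_{i,j}(m)$ $(m\neq0)$, $p_{i,j}\mapsto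 tp_{i,j}$, $q_{i,j}\mapsto tq_{i,j}$, with $t\ne0$ (variable of the $\Lambda_i$); (b) for $m\ne0$, $s_j(m)\mapsto\alpha_j(m)s_j(m)$, $\lambda_{i,j}(m)\mapsto\lambda_{i,j}(m)\alpha_j(m)$, $A_{i,j}(m)\mapsto\alpha_i(m)^{-1}A_{i,j}(m)\alpha_j(m)$, with $\alpha_j(m)\ne0$, $\alpha_j(-m)=\alpha_j(m)^{-1}$ (free fields); (c) $s_j(m)\mapsto\epsilon_j^ms_j(m)$, $p_{i,j}\mapsto\epsilon_jp_{i,j}$, $q_{i,j}\mapsto\epsilon_jq_{i,j}$ with $\epsilon_j\in\{1,-1\}$ (sign of the variable of $S_j$); (d) $\lambda_{i,j}(0)\mapsto\lambda_{i,j}(0)+\nu_j$ for all $i,j$, with $\sum_k\nu_kA_{k,j}(0)\in2\pi\sqrt{-1}\,\mathbf Z$ for all $j$ (the factor $e^{\sum_j\nu_ja_j(0)}$, which commutes with all $a_i(m)$ and $e^{Q_j}$). **Theorem.** (i) Assume (1)–(5). Let $\beta=A_{1,2}(0)$, let $r=\frac1{1+\beta}$ if $|\widehat I(\beta)|>|\widehat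 I(-1-\beta)|$ and $r=-\frac1\beta$ otherwise, and define $x$ by $\log x=\frac1{2r}\log\frac{q_{2,1}}{q_{1,1}}$, so that $x^{2r}=q_{2,1}/q_{1,1}$. Then $r>1$, $|x|\ne0,1$, and for some $g\ne0$ the parameters are explicit up to freedom with data $r,\log x,g$. Moreover $$B_j(z)=g_j\Big(\frac{q_{j,j}}{p_{j,j}}-1\Big):\Lambda_j(z)S_j(q_{j,j}^{-1}z):\qquad(1\le j\le L).$$ (ii) Conversely, let $r>1$, let $x$ with $|x|\ne0,1$ and its chosen $\log x$ satisfy $\log(x^{2r})=2r\log x$, let $g\in\mathbf C$, let $J$ be nonempty and all $q_{i,j}\neq0$. If the parameters are explicit up to freedom with data $r,\log x,g$, then (1), (2) with the $B_j(z)$ displayed above, and (3) hold. -/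

import Mathlib

noncomputable section

namespace DeformedW

/-! ### The Heisenberg algebra and its Fock space -/

/-- Parameters of the construction, with `A m i j` for `A_{i,j}(m)`, `lam i j m` for
`λ_{i,j}(m)`, `s j m` for `s_j(m)` (the value `s j 0` is never used). Indices start at `0`:
`Λ_i`, `1 ≤ i ≤ L+1`, has index `i - 1 : Fin (L + 1)`, and `S_j`, `1 ≤ j ≤ L`, has index
`j - 1 : Fin L`. For `j : Fin L`, the index pairs `(j,j)` and `(j+1,j)` are
`(j.castSucc, j)` and `(j.succ, j)`. -/
structure Params (L : ℕ) where
  A : ℤ → Matrix (Fin L) (Fin L) ℂ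
  lam : Fin (L + 1) → Fin L → ℤ → ℂ
  s : Fin L → ℤ → ℂ
  g : Fin (L + 1) → ℂ
  p : Fin (L + 1) → Fin L → ℂ
  q : Fin (L + 1) → Fin L → ℂ

/-- The conditions on the structure constants of the Heisenberg algebra. -/
def IsHeisenberg {L : ℕ} (A : ℤ → Matrix (Fin L) (Fin L) ℂ) : Prop :=
  (∀ m : ℤ, m ≠ 0 → ∀ i, A m i i = 1) ∧
  (∀ (m : ℤ) (i j : Fin L), i ≠ j → A m i j = A (-m) j i) ∧
  (∀ m : ℤ, (A m).det ≠ 0)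

/-- Fock space of the oscillators `a_i(m)`, `m ≠ 0`: the variable `X (i, n)` is `a_i(-n)`
applied to the vacuum. -/
abbrev Osc (L : ℕ) : Type := MvPolynomial (Fin L × ℕ+) ℂ

/-- The Fock space: the direct sum, over all momenta `k ∈ ℂ^L`, of the Fock spaces on which
`a_i(0)` acts by the scalar `k i`. -/
abbrev Fock (L : ℕ) : Type := (Fin L → ℂ) →₀ Osc L

/-- The operator `a_i(m)` on the Fock space: `a_i(-n)` multiplies by `X (i, n)`, and
`a_i(n) = (1/n) ∑ j, A_{i,j}(n) ∂/∂X (j, n)`, for `n > 0`. -/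
def boson {L : ℕ} (A : ℤ → Matrix (Fin L) (Fin L) ℂ) (i : Fin L) : ℤ → Module.End ℂ (Fock L)
  | .ofNat 0 => Finsupp.lsum ℂ fun k : Fin L → ℂ => k i • Finsupp.lsingle k
  | .ofNat (n + 1) => Finsupp.mapRange.linearMap
      (((n : ℂ) + 1)⁻¹ • ∑ j, A ((n : ℤ) + 1) i j •
        (MvPolynomial.pderiv (R := ℂ) (j, n.succPNat)).toLinearMap)
  | .negSucc n => Finsupp.mapRange.linearMap
      (LinearMap.mulLeft ℂ (MvPolynomial.X (i, n.succPNat) : Osc L))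

/-- The operator `exp (∑ j, n_j Q_j)`; since `[a_i(0), Q_j] = A_{i,j}(0)`, it shifts the
momentum by `A(0) n`. -/
def expQ {L : ℕ} (A : ℤ → Matrix (Fin L) (Fin L) ℂ) (n : Fin L → ℤ) : Module.End ℂ (Fock L) :=
  Finsupp.lmapDomain (Osc L) ℂ fun k i => k i + ∑ j, A 0 i j * (n j : ℂ)

/-- The exponential of a formal power series without constant term, over a possibly
noncommutative algebra. -/
def expSeries {R : Type*} [Ring R] [Algebra ℂ R] (f : PowerSeries R) : PowerSeries R :=
  PowerSeries.mk fun n =>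
    ∑ k ∈ Finset.range (n + 1), ((k.factorial : ℂ)⁻¹) • PowerSeries.coeff n (f ^ k)

/-! ### Vertex operators and their normal ordered products -/

/-- The vertex operator
`z^pre e^{∑ charge_j Q_j} e^{∑ mom_j a_j(0)} z^{∑ pow_j a_j(0)}
  :exp (∑ j, ∑ m ≠ 0, coef_j(m) a_j(m) z^{-m}):`. -/
structure VertexOp (L : ℕ) where
  pre : ℂ
  charge : Fin L → ℤ
  mom : Fin L → ℂ
  pow : Fin L → ℂ
  coef : Fin L → ℤ → ℂ

namespace VertexOp

variable {L : ℕ} (A : ℤ → Matrix (Fin L) (Fin L) ℂ)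

/-- `exp (∑ j, ∑ m > 0, coef_j(-m) a_j(-m) z^m)` as a power series in `z`. -/
def creation (V : VertexOp L) : PowerSeries (Module.End ℂ (Fock L)) :=
  expSeries (PowerSeries.mk fun m : ℕ =>
    if m = 0 then 0 else ∑ j, V.coef j (-(m : ℤ)) • boson A j (-(m : ℤ)))

/-- `exp (∑ j, ∑ m > 0, coef_j(m) a_j(m) z^{-m})` as a power series in `z⁻¹`. -/
def annihilation (V : VertexOp L) : PowerSeries (Module.End ℂ (Fock L)) :=
  expSeries (PowerSeries.mk fun m : ℕ =>
    if m = 0 then 0 else ∑ j, V.coef j (m : ℤ) • boson A j (m : ℤ))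

open Classical in
/-- The coefficient of `z^e` in `z^pre e^{∑ mom_j a_j(0)} z^{∑ pow_j a_j(0)}`. -/
def zeroMode (V : VertexOp L) (e : ℂ) : Module.End ℂ (Fock L) :=
  Finsupp.lsum ℂ fun k : Fin L → ℂ =>
    if V.pre + ∑ j, V.pow j * k j = e
    then Complex.exp (∑ j, V.mom j * k j) • Finsupp.lsingle k else 0

/-- The coefficient of `z^c` in `V(z)`, applied to the vector `v`. The sum is finite. -/
def mode (V : VertexOp L) (c : ℂ) (v : Fock L) : Fock L :=
  ∑ᶠ k : ℕ × ℕ,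
    PowerSeries.coeff k.1 (V.creation A)
      (expQ A V.charge
        (V.zeroMode (c - k.1 + k.2)
          (PowerSeries.coeff k.2 (V.annihilation A) v)))

/-- The coefficient of `z^a w^b` in the normal ordered product `:V(z)W(w):`, applied to the
vector `v`: creation operators and the `Q_j` stand to the left, the `a_j(0)` and annihilation
operators to the right. The sum is finite. -/
def normalMode (V W : VertexOp L) (a b : ℂ) (v : Fock L) : Fock L :=
  ∑ᶠ k : (ℕ × ℕ) × (ℕ × ℕ),
    PowerSeries.coeff k.1.1 (V.creation A)
      (PowerSeries.coeff k.2.1 (W.creation A)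
        (expQ A (V.charge + W.charge)
          (V.zeroMode (a - k.1.1 + k.1.2)
            (W.zeroMode (b - k.2.1 + k.2.2)
              (PowerSeries.coeff k.1.2 (V.annihilation A)
                (PowerSeries.coeff k.2.2 (W.annihilation A) v))))))

/-- `V(z)W(w) = φ(w/z) :V(z)W(w):` for the formal power series `φ ∈ ℂ[[w/z]]`, that is,
`φ_{V,W}(z,w) = φ(w/z)`. The equation is read off at every `z^a w^b`; the sum is finite. -/
def HasOPE (V W : VertexOp L) (φ : PowerSeries ℂ) : Prop :=
  ∀ (a b : ℂ) (v : Fock L),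
    V.mode A a (W.mode A b v) =
      ∑ᶠ n : ℕ, PowerSeries.coeff n φ • normalMode A V W (a + n) (b - n) v

end VertexOp

/-- The formal power series `φ(w/z)` converges, for `|z| ≫ |w|`, to the function `F(z,w)`. -/
def ConvergesTo (φ : PowerSeries ℂ) (F : ℂ → ℂ → ℂ) : Prop :=
  ∃ R : ℝ, 0 < R ∧ ∀ z w : ℂ, z ≠ 0 → ‖w‖ < R * ‖z‖ →
    HasSum (fun n : ℕ => PowerSeries.coeff n φ * (w / z) ^ n) (F z w)

namespace Params

variable {L : ℕ} (P : Params L)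

/-- The vertex operator `Λ_i(z)`. -/
def Lam (i : Fin (L + 1)) : VertexOp L where
  pre := 0
  charge := 0
  mom := fun j => P.lam i j 0
  pow := 0
  coef := P.lam i

/-- The screening current `S_j(w)`. -/
def S (j : Fin L) : VertexOp L where
  pre := P.A 0 j j / 2
  charge := Pi.single j 1
  mom := 0
  pow := Pi.single j 1
  coef := fun i m => if i = j then P.s j m else 0

/-- `e^{-Q_j} S_j(w)`. -/
def Stilde (j : Fin L) : VertexOp L := { P.S j with charge := 0 }

/-- The coefficient of `z^c` in the basic current `T_1(z) = ∑ g_i Λ_i(z)`. -/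
def T (c : ℂ) (v : Fock L) : Fock L := ∑ i, P.g i • (P.Lam i).mode P.A c v

/-! ### The three conditions -/

/-- Mutual locality of `Λ_i(z)` and `S_j(w)`, with at most one pole and one zero. -/
def MutualLocality : Prop :=
  ∀ (i : Fin (L + 1)) (j : Fin L), ∃ φ ψ : PowerSeries ℂ,
    (P.Lam i).HasOPE P.A (P.S j) φ ∧ (P.S j).HasOPE P.A (P.Lam i) ψ ∧
    ConvergesTo φ (fun z w => (w - z / P.p i j) / (w - z / P.q i j)) ∧
    ConvergesTo ψ (fun w z => (w - z / P.p i j) / (w - z / P.q i j))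

/-- The coefficient of `z^n w^b` in `B(z) δ(q w / z) = B(q w) δ(q w / z)`, where
`B(z) = ∑ c, B_c z^c` (`c ∈ ℂ`) and `q^c = e^{c ℓ}`, so `ℓ` is a logarithm of `q`. -/
def deltaCoeff (B : ℂ → Fock L → Fock L) (ℓ : ℂ) (n : ℤ) (b : ℂ) (v : Fock L) : Fock L :=
  Complex.exp (b * ℓ) • B (b + n) v

/-- `[T_1(z), S_j(w)] = B_j(z) (δ(q_{j,j} w/z) - δ(q_{j+1,j} w/z))`. Here `lg` is the logarithm
in the powers `q_{j,j}^c = e^{c lg q_{j,j}}` and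
`q_{j+1,j}^c = q_{j,j}^c e^{c lg (q_{j+1,j} / q_{j,j})}`. -/
def Commutativity (lg : ℂ → ℂ) (B : Fin L → ℂ → Fock L → Fock L) : Prop :=
  ∀ (j : Fin L) (n : ℤ) (b : ℂ) (v : Fock L),
    P.T n ((P.S j).mode P.A b v) - (P.S j).mode P.A b (P.T n v) =
      deltaCoeff (B j) (lg (P.q j.castSucc j)) n b v -
      deltaCoeff (B j)
        (lg (P.q j.castSucc j) + lg (P.q j.succ j / P.q j.castSucc j)) n b v

/-- The coefficient of `z^c` in
`g_j (q_{j,j} / p_{j,j} - 1) :Λ_j(z) S_j(q_{j,j}⁻¹ z):`. -/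
def current (lg : ℂ → ℂ) (j : Fin L) (c : ℂ) (v : Fock L) : Fock L :=
  (P.g j.castSucc * (P.q j.castSucc j / P.p j.castSucc j - 1)) •
    ∑ᶠ a : ℂ, Complex.exp (-(c - a) * lg (P.q j.castSucc j)) •
      VertexOp.normalMode P.A (P.Lam j.castSucc) (P.S j) a (c - a) v

/-- The symmetry conditions on `φ_{S̃_k,S̃_l}`. -/
def Symmetry : Prop :=
  (∀ k l : Fin L, ∃ φ : PowerSeries ℂ,
    (P.Stilde k).HasOPE P.A (P.Stilde l) φ ∧ (P.Stilde l).HasOPE P.A (P.Stilde k) φ) ∧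
  (∀ k l : Fin L, 2 ≤ |(k : ℤ) - (l : ℤ)| → (P.Stilde k).HasOPE P.A (P.Stilde l) 1)

/-! ### Changes of parameters -/

/-- Scaling of the variable of the `Λ_i` by `t`. -/
def scaleVar (t : ℂ) : Params L :=
  { P with
    lam := fun i j m => t ^ m * P.lam i j m
    p := fun i j => t * P.p i j
    q := fun i j => t * P.q i j }

/-- Scaling of the free fields, `a_j(m) ↦ α_j(m)⁻¹ a_j(m)`. -/
def scaleBoson (α : Fin L → ℤ → ℂ) : Params L :=
  { P with
    A := fun m => Matrix.of fun i j => (α i m)⁻¹ * P.A m i j * α j m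
    lam := fun i j m => P.lam i j m * α j m
    s := fun j m => α j m * P.s j m }

/-- Scaling of the variable of `S_j` by the sign `ε_j`. -/
def scaleSign (ε : Fin L → ℤˣ) : Params L :=
  { P with
    s := fun j m => ((ε j : ℤ) : ℂ) ^ m * P.s j m
    p := fun i j => ((ε j : ℤ) : ℂ) * P.p i j
    q := fun i j => ((ε j : ℤ) : ℂ) * P.q i j }

/-- Multiplication of every `Λ_i(z)` by `e^{∑ ν_j a_j(0)}`. -/
def shiftZero (ν : Fin L → ℂ) : Params L :=
  { P with lam := fun i j m => if m = 0 then P.lam i j 0 + ν j else P.lam i j m }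

end Params

/-! ### The extended matrix `(A_{i,j}(0))`, `0 ≤ i, j ≤ L` -/

section Extended

open Classical

variable {L : ℕ} (hL : 2 ≤ L) (M : Matrix (Fin L) (Fin L) ℝ)

/-- `{j_1, …, j_K}`, the set of `j` with `A_{j,j}(0) = 1`. -/
def oddSet : Finset (Fin L) := Finset.univ.filter fun j => M j j = 1

/-- `A_{0,1}(0)`. -/
def extFirst : ℝ :=
  if (⟨0, by omega⟩ : Fin L) ∈ oddSet M then -1 - M ⟨0, by omega⟩ ⟨1, by omega⟩
  else M ⟨0, by omega⟩ ⟨1, by omega⟩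

/-- `A_{0,L}(0)`. -/
def extLast : ℝ :=
  if (⟨L - 1, by omega⟩ : Fin L) ∈ oddSet M then -1 - M ⟨L - 1, by omega⟩ ⟨L - 2, by omega⟩
  else M ⟨L - 1, by omega⟩ ⟨L - 2, by omega⟩

/-- `A_{0,0}(0)`. -/
def extCorner : ℝ := if Even (oddSet M).card then -2 * extLast hL M else 1

/-- `A_{0,j}(0)` for `1 ≤ j ≤ L`, where `j` has index `j - 1`. -/
def extRow (j : Fin L) : ℝ :=
  if (j : ℕ) = 0 then extFirst hL M else if (j : ℕ) = L - 1 then extLast hL M else 0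

/-- The extended symmetric matrix. Its index `0` is the added node, its index `j.succ` is the
node of index `j` of `M`; addition on `Fin (L + 1)` is modulo `L + 1`. -/
def extA : Matrix (Fin (L + 1)) (Fin (L + 1)) ℝ :=
  Matrix.of (Fin.cons (Fin.cons (extCorner hL M) (extRow hL M))
    (fun i => Fin.cons (extRow hL M i) (M i)))

/-- `edge t = A_{t,t+1}(0)`, so `A_{j-1,j}(0)`, `1 ≤ j ≤ L + 1`, is `edge (j - 1)`. -/
def edge (t : Fin (L + 1)) : ℝ := extA hL M t (t + 1)

/-- The extended set `Ĵ` of nodes (with node `L + 1` written `0`). -/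
def oddHat : Finset (Fin (L + 1)) :=
  if Even (oddSet M).card then (oddSet M).map (Fin.succEmb L)
  else insert 0 ((oddSet M).map (Fin.succEmb L))

/-- The number of `1 ≤ j ≤ L + 1` with `A_{j-1,j}(0) = d`. -/
def edgeCount (d : ℝ) : ℕ := (Finset.univ.filter fun t => edge hL M t = d).card

/-- The parameter `r`, with `β = A_{1,2}(0)`. -/
def rParam : ℝ :=
  let β := M ⟨0, by omega⟩ ⟨1, by omega⟩
  if edgeCount hL M (-1 - β) < edgeCount hL M β then 1 / (1 + β) else -1 / β

/-- `D(k,l;Φ)`: the sum over `k + 1 ≤ j ≤ l + 1` of `r - 1` where `A_{j-1,j}(0) = -1/r`, and of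
`1` otherwise, that is, where `A_{j-1,j}(0) = (1-r)/r`. It is `0` if `l < k`. -/
def D (r : ℝ) (k l : ℕ) : ℝ :=
  ∑ t ∈ Finset.univ.filter (fun t : Fin (L + 1) => k ≤ (t : ℕ) ∧ (t : ℕ) ≤ l),
    if edge hL M t = -1 / r then r - 1 else 1

/-- The form of the extended matrix. The third clause says that `A_{j,j+1}(0)` is
`-1 - A_{j-1,j}(0)` if `j ∈ Ĵ`, and `A_{j-1,j}(0)` otherwise. -/
def IsExtendedCartan (r : ℝ) : Prop :=
  (∀ i : Fin (L + 1), extA hL M i i =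
    if i ∈ oddHat M then 1 else if edge hL M (i - 1) = -1 / r then 2 / r else 2 * (r - 1) / r) ∧
  (∀ t : Fin (L + 1), (edge hL M t = -1 / r ∨ edge hL M t = (1 - r) / r) ∧
    extA hL M (t + 1) t = edge hL M t) ∧
  (∀ i : Fin (L + 1), edge hL M i =
    if i ∈ oddHat M then -1 - edge hL M (i - 1) else edge hL M (i - 1)) ∧
  (∀ k l : Fin L, 2 ≤ |(k : ℤ) - (l : ℤ)| → M k l = 0) ∧
  (∀ l : Fin L, (l : ℕ) ≠ 0 → (l : ℕ) ≠ L - 1 →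
    extA hL M 0 l.succ = 0 ∧ extA hL M l.succ 0 = 0)

end Extended

/-! ### The explicit parameters -/

/-- `x^a = e^{a log x}` for `η = log x`. -/
def xpow (η : ℂ) (a : ℝ) : ℂ := Complex.exp (a * η)

/-- `[a]_x = (x^a - x^{-a}) / (x - x⁻¹)` for `η = log x`. -/
def qint (η : ℂ) (a : ℝ) : ℂ := (xpow η a - xpow η (-a)) / (xpow η 1 - xpow η (-1))

namespace Params

open Classical

variable {L : ℕ} (P : Params L) (hL : 2 ≤ L)

/-- The real matrix `(A_{i,j}(0))`. -/
def A0 : Matrix (Fin L) (Fin L) ℝ := (P.A 0).map Complex.re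

/-- The parameters are given by the explicit formulas, with `η = log x` and the overall factor
`g₀` of the `g_i`. -/
structure IsExplicit (r : ℝ) (η g₀ : ℂ) : Prop where
  A_zero_real : ∀ i j, (P.A 0 i j).im = 0
  A_zero : IsExtendedCartan hL P.A0 r
  /-- `q_{j,j}` and `q_{j+1,j}` -/
  q_diag : ∀ j : Fin L, P.q j.castSucc j = xpow η (D hL P.A0 r 1 j)
  q_sub : ∀ j : Fin L, P.q j.succ j = xpow η (2 * r + D hL P.A0 r 1 j)
  /-- `p_{1,1}` -/
  p_first : ∀ j : Fin L, (j : ℕ) = 0 → P.p j.castSucc j =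
    if edge hL P.A0 j.castSucc = -1 / r then xpow η 2 else xpow η (2 * r - 2)
  /-- `p_{j,j}` for `2 ≤ j ≤ L` -/
  p_diag : ∀ j : Fin L, 1 ≤ (j : ℕ) → P.p j.castSucc j =
    xpow η (D hL P.A0 r 1 (j - 1)) *
      if edge hL P.A0 j.castSucc = -1 / r then xpow η (r + 1) else xpow η (2 * r - 1)
  /-- `p_{j,j-1}` for `2 ≤ j ≤ L + 1` -/
  p_sub : ∀ j : Fin L, P.p j.succ j =
    xpow η (D hL P.A0 r 1 j) *
      if edge hL P.A0 j.succ = -1 / r then xpow η (2 * r - 2) else xpow η 2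
  p_other : ∀ (k : Fin (L + 1)) (l : Fin L), k ≠ l.castSucc → k ≠ l.succ → P.p k l = P.q k l
  s_pos : ∀ (j : Fin L) (m : ℤ), 0 < m → P.s j m = 1
  s_neg : ∀ (j : Fin L) (m : ℤ), 0 < m → P.s j (-m) =
    if j ∈ oddSet P.A0 then -1
    else if edge hL P.A0 j.castSucc = -1 / r then
      -(qint η m * qint η (2 * (r - 1) * m) / (qint η (r * m) * qint η ((r - 1) * m)))
    else -(qint η ((r - 1) * m) * qint η (2 * m) / (qint η (r * m) * qint η m))
  A_diag : ∀ (j : Fin L) (m : ℤ), m ≠ 0 → P.A m j j = 1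
  A_far : ∀ (k l : Fin L) (m : ℤ), m ≠ 0 → 2 ≤ |(k : ℤ) - (l : ℤ)| → P.A m k l = 0
  /-- `A_{j-1,j}(m)` for `2 ≤ j ≤ L`, with `k = j - 1` and `l = j` -/
  A_next : ∀ (k l : Fin L) (m : ℤ), m ≠ 0 → (k : ℕ) + 1 = l → P.A m k l =
    (if edge hL P.A0 l.castSucc = -1 / r then qint η m else qint η ((r - 1) * m)) /
      qint η (r * m) * (if 0 < m then 1 / P.s l (-m) else 1 / P.s k m)
  A_symm : ∀ (k l : Fin L) (m : ℤ), 0 < m → (k : ℕ) + 1 = l →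
    P.A (-m) k l = P.A m l k ∧ P.A (-m) l k = P.A m k l
  lam_zero : ∀ (i : Fin (L + 1)) (j : Fin L), P.lam i j 0 =
    2 * r * η / D hL P.A0 r 0 L *
      if (j : ℕ) < i then (D hL P.A0 r 0 j : ℂ) else -(D hL P.A0 r (j + 1) L : ℂ)
  lam_ne_zero : ∀ (i : Fin (L + 1)) (j : Fin L) (m : ℤ), m ≠ 0 → P.lam i j m / P.s j m =
    qint η (r * m) * (xpow η 1 - xpow η (-1)) / qint η (D hL P.A0 r 0 L * m) *
      if (j : ℕ) < i then
        -(xpow η ((r + D hL P.A0 r 1 L) * m) * qint η (D hL P.A0 r 0 j * m))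
      else xpow η ((r - D hL P.A0 r 0 0) * m) * qint η (D hL P.A0 r (j + 1) L * m)
  g_eq : ∀ i : Fin (L + 1), P.g i =
    g₀ * if edge hL P.A0 i = -1 / r then qint η (r - 1) else 1

/-- The parameters are given by the explicit formulas up to scaling of the variable of the `Λ_i`,
scaling of the free fields, signs of the variables of the `S_j`, and a central factor `e^{∑ ν_j a_j(0)}`, `∑ k, ν_k A_{k,j}(0) ∈ 2πiℤ`. -/
def IsExplicitUpToFreedom (r : ℝ) (η g₀ : ℂ) : Prop :=
  ∃ (t : ℂ) (α : Fin L → ℤ → ℂ) (ε : Fin L → ℤˣ) (ν : Fin L → ℂ),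
    t ≠ 0 ∧
    (∀ j m, α j m ≠ 0 ∧ α j (-m) = (α j m)⁻¹) ∧ (∀ j, α j 0 = 1) ∧
    (∀ j, ∃ n : ℤ, ∑ k, ν k * P.A 0 k j = 2 * Real.pi * Complex.I * n) ∧
    ((((P.scaleVar t).scaleBoson α).scaleSign ε).shiftZero ν).IsExplicit hL r η g₀

end Params

end DeformedW

end

open DeformedW

/-! The three conditions are equivalent to equations between the parameters, and these equations are
rigid.

Reduction to equations. On a momentum sector a vertex operator is multiplication by an exponential
of creation variables composed with an exponential of commuting derivations. The latter is
multiplicative (`ann_mul`) and rescales a creation exponential by a scalar series (`ann_cre`). So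
the contraction of two vertex operators is the exponential of the contracted exponents
(`hasOPE_ope`), and it is unique (`HasOPE.unique`). Since (1 - pu)/(1 - qu) = exp ∑ (q^m - p^m) u^m
/ m, mutual locality becomes, for each m ≠ 0, the linear system ∑_k λ_{i,k}(m) A_{k,j}(m) s_j(-m) =
q_{i,j}^m - p_{i,j}^m, together with an exponentiated version for m = 0 (`mutualLocality_iff`).
Symmetry says that σ_{k,l}(m) = s_k(m) A_{k,l}(m) s_l(-m) is symmetric and tridiagonal
(`symmetry_iff`). The two expansions of the rational function differ by a delta function at z =
q_{i,j} w (`commutator_eq`). Distinct poles can be compared one at a time, so commutativity kills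
all poles except i = j, j+1 and makes the two remaining residues opposite
(`matchEq_of_commutativity`). As a vertex operator is determined by its modes (`eq_of_mode_eq`),
this says that rows j and j+1 of λ differ only in column j, by a known amount (`MatchEq`).

Part (i). Subtracting the locality systems of rows j and j+1 expresses row j of A(0) and of σ(m)
through zeros and poles (`column_zero`, `column_ne_zero`). Because σ is even in m, comparing m = 1
with m = -1 gives multiplicative relations such as p_{j,j} q_{j,j} = q_{j-1,j-1} q_{j,j-1}
(`mul_eq_mul_of_even`), and m = 1, 2 force all ratios q_{j+1,j}/q_{j,j} to agree
(`exp_eq_exp_of_edge`). At a node either p_{j,j} = p_{j+1,j} and A_{j,j}(0) = 1, or p_{j,j}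
p_{j+1,j} = q_{j,j} q_{j+1,j}. Accordingly the edge value A_{j-1,j}(0) is reflected to -1 -
A_{j-1,j}(0) or kept (`node_cases`, `node_right`). Thus only the two values -1/r and (1-r)/r occur.
Coding them by weights r - 1 and 1, every zero and pole is a power of x governed by partial sums of
weights (`ChainForm`), up to a common scale and signs (`exists_sign`). Invertibility of A(m) then
determines λ (`LocalSolution.lamForm`).

Part (ii). The explicit λ is a discrete Green function of the tridiagonal matrix σ. Its two branches
come from shifted partial sums in the kernel of σ, one vanishing at each end, and the jump between
them produces exactly the required sources (`oscPhi_mul_edgeSig_add`). The changes of parameters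
preserve all the equations (`localityEq_change`, `symmetryEq_change`, `matchEq_change`). -/

noncomputable section
namespace DeformedW

/-! ### Exponentials of power series with commuting coefficients -/

section ExpSeries

open PowerSeries Finset

variable {R : Type*} [Ring R] [Algebra ℂ R]

/-- The Euler operator `u d/du`, coefficientwise. -/
def euler (f : PowerSeries R) : PowerSeries R := PowerSeries.mk fun n => (n : ℂ) • coeff n f

lemma coeff_euler (f : PowerSeries R) (n : ℕ) : coeff n (euler f) = (n : ℂ) • coeff n f := by
  simp [euler]

lemma euler_mul (f g : PowerSeries R) : euler (f * g) = euler f * g + f * euler g := by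
  ext n
  simp only [coeff_euler, map_add, coeff_mul, smul_sum, ← sum_add_distrib]
  refine sum_congr rfl fun p hp => ?_
  rw [← mem_antidiagonal.1 hp]
  push_cast
  rw [add_smul, smul_mul_assoc, mul_smul_comm]

lemma commute_euler {f : PowerSeries R}
    (hf : ∀ m n, Commute (coeff m f) (coeff n f)) : Commute f (euler f) := by
  ext n
  simp only [coeff_mul, coeff_euler]
  rw [← Nat.sum_antidiagonal_swap]
  refine sum_congr rfl fun p _ => ?_
  simp only [Prod.fst_swap, Prod.snd_swap, mul_smul_comm, smul_mul_assoc]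
  rw [(hf _ _).eq]

lemma euler_pow {f : PowerSeries R} (hf : Commute f (euler f)) (k : ℕ) :
    euler (f ^ (k + 1)) = (k + 1) • (euler f * f ^ k) := by
  induction k with
  | zero => simp
  | succ k ih =>
    rw [pow_succ' f (k + 1), euler_mul, ih, mul_smul_comm, ← mul_assoc, hf.eq, mul_assoc,
      ← pow_succ', succ_nsmul' _ (k + 1)]

lemma coeff_pow_eq_zero {R : Type*} [Ring R] {f : PowerSeries R} (h0 : coeff 0 f = 0)
    {n k : ℕ} (h : n < k) : coeff n (f ^ k) = 0 := by
  induction k generalizing n with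
  | zero => omega
  | succ k ih =>
    rw [pow_succ', coeff_mul]
    refine sum_eq_zero fun p hp => ?_
    rcases Nat.eq_zero_or_pos p.1 with h1 | h1
    · rw [h1, h0, zero_mul]
    · rw [ih (by have := mem_antidiagonal.1 hp; omega), mul_zero]

/-- Powers beyond the n-th start above degree n, so the truncation order is free. This flexibility
is what permits index shifts in the sum. -/
lemma coeff_expSeries {f : PowerSeries R} (h0 : coeff 0 f = 0) {n N : ℕ} (h : n < N) :
    coeff n (expSeries f) = ∑ k ∈ range N, ((k.factorial : ℂ)⁻¹) • coeff n (f ^ k) := by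
  rw [expSeries, coeff_mk]
  refine sum_subset (range_subset_range.2 h) fun k _ hk => ?_
  rw [coeff_pow_eq_zero h0 (by simpa using hk), smul_zero]

@[simp] lemma coeff_zero_expSeries (f : PowerSeries R) : coeff 0 (expSeries f) = 1 := by
  simp [expSeries]

/-- The differential equation of the exponential, coefficientwise. -/
lemma expSeries_rec {f : PowerSeries R} (h0 : coeff 0 f = 0)
    (hf : ∀ m n, Commute (coeff m f) (coeff n f)) (n : ℕ) :
    (n : ℂ) • coeff n (expSeries f) =
      ∑ p ∈ antidiagonal n, (p.1 : ℂ) • (coeff p.1 f * coeff p.2 (expSeries f)) := by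
  have hc := commute_euler hf
  have h1 : (n : ℂ) • coeff n (expSeries f) =
      ∑ k ∈ range (n + 1), ((k.factorial : ℂ)⁻¹) • coeff n (euler f * f ^ k) := by
    -- Truncating at `n + 2` leaves exactly `n + 1` terms once the zeroth power is split off and the
    -- index shifted.
    rw [coeff_expSeries h0 (show n < n + 2 by omega), sum_range_succ', smul_add, smul_sum]
    have : (n : ℂ) • ((Nat.factorial 0 : ℂ)⁻¹) • coeff n (f ^ 0) = 0 := by
      rcases Nat.eq_zero_or_pos n with h | h
      · simp [h]
      · simp [coeff_one, h.ne']
    rw [this, add_zero]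
    refine sum_congr rfl fun k _ => ?_
    rw [smul_comm, ← coeff_euler, euler_pow hc, map_nsmul, ← Nat.cast_smul_eq_nsmul ℂ, smul_smul,
      Nat.factorial_succ]
    congr 1
    have : (k.factorial : ℂ) ≠ 0 := by exact_mod_cast k.factorial_ne_zero
    have : ((k + 1 : ℕ) : ℂ) ≠ 0 := by exact_mod_cast k.succ_ne_zero
    push_cast at this ⊢
    field_simp
  rw [h1]
  simp only [coeff_mul, smul_sum]
  rw [sum_comm]
  refine sum_congr rfl fun p hp => ?_
  rw [coeff_expSeries h0 (show p.2 < n + 1 by have := mem_antidiagonal.1 hp; omega), mul_sum,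
    smul_sum]
  refine sum_congr rfl fun k _ => ?_
  rw [coeff_euler, mul_smul_comm, smul_mul_assoc, smul_comm]

lemma expSeries_rec_comm {R : Type*} [CommRing R] [Algebra ℂ R] {f : PowerSeries R}
    (h0 : coeff 0 f = 0) (n : ℕ) :
    (n : ℂ) • coeff n (expSeries f) =
      ∑ p ∈ antidiagonal n, (p.1 : ℂ) • (coeff p.1 f * coeff p.2 (expSeries f)) :=
  expSeries_rec h0 (fun _ _ => Commute.all _ _) n

/-- A sequence with `n E_n = ∑_{a+b=n} a D_a E_b` is determined by its first term. -/
lemma euler_rec_unique {M : Type*} [AddCommGroup M] [Module ℂ M] (D : ℕ → M → M)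
    {E F : ℕ → M} (h0 : E 0 = F 0)
    (hE : ∀ n : ℕ, (n : ℂ) • E n = ∑ p ∈ antidiagonal n, (p.1 : ℂ) • D p.1 (E p.2))
    (hF : ∀ n : ℕ, (n : ℂ) • F n = ∑ p ∈ antidiagonal n, (p.1 : ℂ) • D p.1 (F p.2)) (n : ℕ) :
    E n = F n := by
  induction n using Nat.strong_induction_on with
  | _ n ih =>
    rcases Nat.eq_zero_or_pos n with h | h
    · rw [h, h0]
    · have hn : (n : ℂ) ≠ 0 := by exact_mod_cast h.ne'
      have : (n : ℂ) • E n = (n : ℂ) • F n := by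
        rw [hE, hF]
        refine sum_congr rfl fun p hp => ?_
        have hp' := mem_antidiagonal.1 hp
        -- The term with first index 0 carries the factor 0, so only values at indices below n
        -- enter.
        rcases Nat.eq_zero_or_pos p.1 with h1 | h1
        · simp [h1]
        · rw [ih p.2 (by omega)]
      exact (smul_right_injective M hn) this

/-- The exponential is determined by the exponent and conversely. -/
lemma expSeries_injective {R : Type*} [CommRing R] [Algebra ℂ R] {f g : PowerSeries R}
    (hf : coeff 0 f = 0) (hg : coeff 0 g = 0) (h : expSeries f = expSeries g) : f = g := by
  ext n
  induction n using Nat.strong_induction_on with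
  | _ n ih =>
    rcases Nat.eq_zero_or_pos n with h1 | h1
    · rw [h1, hf, hg]
    · have hn : (n : ℂ) ≠ 0 := by exact_mod_cast h1.ne'
      have e1 := expSeries_rec_comm hf n
      have e2 := expSeries_rec_comm hg n
      rw [h, e2] at e1
      obtain ⟨n, rfl⟩ := Nat.exists_eq_succ_of_ne_zero h1.ne'
      -- The end term isolated here is the top coefficient of the exponent times the constant term 1
      -- of the exponential; all other terms agree by induction.
      rw [Nat.succ_eq_add_one, Nat.sum_antidiagonal_succ', Nat.sum_antidiagonal_succ'] at e1
      have e3 : ∀ p ∈ antidiagonal n, (p.1 : ℂ) • (coeff p.1 g * coeff (p.2 + 1) (expSeries g)) =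
          (p.1 : ℂ) • (coeff p.1 f * coeff (p.2 + 1) (expSeries g)) := by
        intro p hp
        have := mem_antidiagonal.1 hp
        rw [ih p.1 (by omega)]
      rw [sum_congr rfl e3] at e1
      rw [add_left_inj] at e1
      simpa using (smul_right_injective R hn e1).symm

/-- Ring homomorphisms commute with the exponential. -/
lemma expSeries_map {R S : Type*} [Ring R] [Algebra ℂ R] [Ring S] [Algebra ℂ S] (ρ : R →ₐ[ℂ] S)
    (f : PowerSeries R) (n : ℕ) :
    coeff n (expSeries (PowerSeries.map (ρ : R →+* S) f)) = ρ (coeff n (expSeries f)) := by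
  simp [expSeries, ← map_pow, coeff_map]

/-- The exponential of `∑ (q^m - p^m) u^m / m`. -/
lemma coeff_expSeries_geom (p q : ℂ) (n : ℕ) :
    coeff n (expSeries (PowerSeries.mk fun m : ℕ => if m = 0 then 0 else (q ^ m - p ^ m) / m)) =
      if n = 0 then 1 else q ^ (n - 1) * (q - p) := by
  set f : PowerSeries ℂ := PowerSeries.mk fun m : ℕ => if m = 0 then 0 else (q ^ m - p ^ m) / m
  set φ : ℕ → ℂ := fun n => if n = 0 then 1 else q ^ (n - 1) * (q - p) with hφ
  refine euler_rec_unique (fun m x => coeff m f * x) (E := fun n => coeff n (expSeries f))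
    (F := φ) (by simp [hφ]) (fun n => expSeries_rec_comm (by simp [f]) n) (fun n => ?_) n
  have key : ∀ n, ∑ x ∈ antidiagonal n, (q ^ x.1 - p ^ x.1) * φ x.2 = n * φ n := by
    intro n
    induction n with
    | zero => simp
    | succ n ih =>
      rw [Nat.sum_antidiagonal_succ']
      rcases Nat.eq_zero_or_pos n with rfl | hn
      · simp [hφ]
      -- From index 1 on, φ is geometric of ratio q, so shifting it multiplies the convolution by q.
      -- Only the end term, where φ(1) = q - p instead of q φ(0), has to be corrected.
      have hs : ∀ n, ∑ x ∈ antidiagonal n, (q ^ x.1 - p ^ x.1) * φ (x.2 + 1) =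
          q * (∑ x ∈ antidiagonal n, (q ^ x.1 - p ^ x.1) * φ x.2 - (q ^ n - p ^ n)) +
            (q ^ n - p ^ n) * (q - p) := by
        intro n
        rcases n with _ | n
        · simp [hφ]
        rw [Nat.sum_antidiagonal_succ', Nat.sum_antidiagonal_succ']
        have : ∀ x ∈ antidiagonal n, (q ^ x.1 - p ^ x.1) * φ (x.2 + 1 + 1) =
            q * ((q ^ x.1 - p ^ x.1) * φ (x.2 + 1)) := by
          intro x _
          simp only [hφ]
          simp only [Nat.add_eq_zero_iff, one_ne_zero, and_false, if_false, Nat.add_sub_cancel]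
          ring
        rw [sum_congr rfl this, ← mul_sum]
        simp [hφ, add_comm]
      rw [hs, ih]
      obtain ⟨n, rfl⟩ := Nat.exists_eq_succ_of_ne_zero hn.ne'
      simp [hφ]
      ring
  rw [smul_eq_mul, ← key]
  refine sum_congr rfl fun x _ => ?_
  rcases Nat.eq_zero_or_pos x.1 with h | h
  · simp [h]
  · have : (x.1 : ℂ) ≠ 0 := by exact_mod_cast h.ne'
    simp only [f, coeff_mk, h.ne', if_false, smul_eq_mul]
    field_simp

end ExpSeries

end DeformedW

namespace DeformedW

/-! ### Additivity and scaling of the exponential -/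

section ExpSeriesAdd

open PowerSeries Finset

variable {R : Type*} [Ring R] [Algebra ℂ R]

lemma euler_expSeries {f : PowerSeries R} (h0 : coeff 0 f = 0)
    (hf : ∀ m n, Commute (coeff m f) (coeff n f)) :
    euler (expSeries f) = euler f * expSeries f := by
  ext n
  rw [coeff_euler, expSeries_rec h0 hf, coeff_mul]
  simp [coeff_euler]

lemma commute_coeff_pow {R : Type*} [Ring R] {f : PowerSeries R} {x : R}
    (hx : ∀ m, Commute x (coeff m f)) (k n : ℕ) : Commute x (coeff n (f ^ k)) := by
  induction k generalizing n with
  | zero => rw [pow_zero, coeff_one]; split_ifs <;> simp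
  | succ k ih =>
    rw [pow_succ, coeff_mul]
    exact Commute.sum_right _ _ _ fun p _ => (ih _).mul_right (hx _)

lemma commute_coeff_expSeries {f : PowerSeries R} {x : R} (hx : ∀ m, Commute x (coeff m f))
    (n : ℕ) : Commute x (coeff n (expSeries f)) := by
  rw [expSeries, coeff_mk]
  exact Commute.sum_right _ _ _ fun k _ => (commute_coeff_pow hx k n).smul_right _

/-- Both sides solve the Euler equation with exponent `f + g` and have the same constant term, so
`euler_rec_unique` identifies them. -/
lemma expSeries_add {f g : PowerSeries R} (hf0 : coeff 0 f = 0) (hg0 : coeff 0 g = 0)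
    (hf : ∀ m n, Commute (coeff m f) (coeff n f)) (hg : ∀ m n, Commute (coeff m g) (coeff n g))
    (hfg : ∀ m n, Commute (coeff m f) (coeff n g)) :
    expSeries (f + g) = expSeries f * expSeries g := by
  have hc : Commute (expSeries f) (euler g) := by
    ext n
    simp only [coeff_mul, coeff_euler]
    rw [← Nat.sum_antidiagonal_swap]
    refine sum_congr rfl fun p _ => ?_
    simp only [Prod.fst_swap, Prod.snd_swap, mul_smul_comm, smul_mul_assoc]
    rw [(commute_coeff_expSeries (fun m => (hfg m _).symm) _).symm.eq]
  have he : euler (expSeries f * expSeries g) = euler (f + g) * (expSeries f * expSeries g) := by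
    rw [euler_mul, euler_expSeries hf0 hf, euler_expSeries hg0 hg, ← mul_assoc, hc.eq]
    have : euler (f + g) = euler f + euler g := by
      ext n; simp [coeff_euler]
    rw [this, add_mul]
    simp only [mul_assoc]
  ext n
  refine euler_rec_unique (fun m x => coeff m (f + g) * x)
    (E := fun n => coeff n (expSeries (f + g)))
    (F := fun n => coeff n (expSeries f * expSeries g)) (by simp [coeff_mul])
    (fun n => expSeries_rec (by rw [map_add, hf0, hg0, add_zero]) (fun m n => ?_) n) (fun n => ?_) n
  · simp only [map_add]
    exact ((hf m n).add_right (hfg m n)).add_left ((hfg n m).symm.add_right (hg m n))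
  · rw [← coeff_euler, he, coeff_mul]
    simp only [coeff_euler, smul_mul_assoc]

lemma coeff_pow_scale (t : ℂ) {f g : PowerSeries R} (h : ∀ n, coeff n g = t ^ n • coeff n f)
    (k n : ℕ) : coeff n (g ^ k) = t ^ n • coeff n (f ^ k) := by
  induction k generalizing n with
  | zero =>
    rw [pow_zero, pow_zero, coeff_one]; split_ifs with h <;> simp [h]
  | succ k ih =>
    rw [pow_succ, pow_succ, coeff_mul, coeff_mul, smul_sum]
    refine sum_congr rfl fun p hp => ?_
    rw [ih, h, smul_mul_smul_comm, ← pow_add, mem_antidiagonal.1 hp]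

lemma coeff_expSeries_scale (t : ℂ) {f g : PowerSeries R}
    (h : ∀ n, coeff n g = t ^ n • coeff n f) (n : ℕ) :
    coeff n (expSeries g) = t ^ n • coeff n (expSeries f) := by
  simp only [expSeries, coeff_mk, smul_sum]
  refine sum_congr rfl fun k _ => ?_
  rw [coeff_pow_scale t h, smul_comm]

end ExpSeriesAdd

/-! ### Creation polynomials and annihilation operators on the oscillator space -/

open PowerSeries Finset

variable {L : ℕ}

/-- The exponent `∑ c_j(-m) a_j(-m) u^m` as a power series of polynomials. -/
def creExp (c : Fin L → ℤ → ℂ) : PowerSeries (Osc L) :=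
  PowerSeries.mk fun m : ℕ =>
    if m = 0 then 0 else ∑ j, c j (-(m : ℤ)) • MvPolynomial.X (j, m.toPNat')

/-- Coefficients of `exp (∑ c_j(-m) a_j(-m) u^m)`. -/
def cre (c : Fin L → ℤ → ℂ) (n : ℕ) : Osc L := coeff n (expSeries (creExp c))

/-- The constant `[∑_j c_j(m) a_j(m), a_l(-m)]`. -/
def tau (A : ℤ → Matrix (Fin L) (Fin L) ℂ) (c : Fin L → ℤ → ℂ) (m : ℕ) (l : Fin L) : ℂ :=
  (m : ℂ)⁻¹ * ∑ j, c j m * A m j l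

/-- The derivation `∑_j c_j(m) a_j(m)`, `m > 0`. -/
def annD (A : ℤ → Matrix (Fin L) (Fin L) ℂ) (c : Fin L → ℤ → ℂ) (m : ℕ) :
    Derivation ℂ (Osc L) (Osc L) :=
  if m = 0 then 0 else ∑ l, tau A c m l • MvPolynomial.pderiv (l, m.toPNat')

def annExp (A : ℤ → Matrix (Fin L) (Fin L) ℂ) (c : Fin L → ℤ → ℂ) :
    PowerSeries (Module.End ℂ (Osc L)) :=
  PowerSeries.mk fun m : ℕ => (annD A c m : Osc L →ₗ[ℂ] Osc L)

/-- Coefficients of `exp (∑ c_j(m) a_j(m) u^m)`, `m > 0`. -/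
def ann (A : ℤ → Matrix (Fin L) (Fin L) ℂ) (c : Fin L → ℤ → ℂ) (n : ℕ) :
    Module.End ℂ (Osc L) := coeff n (expSeries (annExp A c))

variable (A : ℤ → Matrix (Fin L) (Fin L) ℂ) (c d : Fin L → ℤ → ℂ)

lemma annD_X (m : ℕ) (l : Fin L) (k : ℕ+) :
    annD A c m (MvPolynomial.X (l, k)) =
      if m = k then MvPolynomial.C (tau A c m l) else 0 := by
  unfold annD
  rcases Nat.eq_zero_or_pos m with h | h
  · simp [h, k.ne_zero.symm]
  · rw [if_neg h.ne']
    have e : ∀ x : Fin L, (Pi.single (x, m.toPNat') 1 : Fin L × ℕ+ → Osc L) (l, k) =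
        if x = l ∧ m = k then 1 else 0 := by
      intro x
      have : ((x, m.toPNat') = (l, k)) ↔ (x = l ∧ m = k) := by
        rw [Prod.mk.injEq, ← PNat.coe_inj]; simp [Nat.toPNat'_coe, h]
      simp only [Pi.single_apply, eq_comm (a := (l, k)), this]
    have hs : ∀ D : Fin L → Derivation ℂ (Osc L) (Osc L), ∀ f, (∑ l, D l) f = ∑ l, D l f :=
      fun D f => by
        have := map_sum (Derivation.coeFnAddMonoidHom (R := ℂ) (A := Osc L) (M := Osc L)) D univ
        exact (congrFun this f).trans (Finset.sum_apply _ _ _)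
    rw [hs]
    simp only [Derivation.smul_apply, MvPolynomial.pderiv_X, e]
    by_cases hk : m = k <;> simp [hk, MvPolynomial.smul_eq_C_mul]

/-- The commutator is again a derivation, and it kills the variables because each factor sends them
to constants. -/
lemma annD_comm (m n : ℕ) (f : Osc L) :
    annD A c m (annD A d n f) = annD A d n (annD A c m f) := by
  have : ⁅annD A c m, annD A d n⁆ = 0 := by
    refine MvPolynomial.derivation_ext fun i => ?_
    rw [Derivation.commutator_apply, annD_X, annD_X]
    split_ifs <;> simp
  have h := congrArg (fun D => D f) this
  rw [Derivation.commutator_apply] at h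
  exact sub_eq_zero.1 h

lemma coeff_zero_creExp : coeff 0 (creExp c) = 0 := by simp [creExp]

lemma coeff_zero_annExp : coeff 0 (annExp A c) = 0 := by simp [annExp, annD]

lemma commute_annExp (m n : ℕ) : Commute (coeff m (annExp A c)) (coeff n (annExp A d)) := by
  refine LinearMap.ext fun f => ?_
  simpa [annExp] using annD_comm A c d m n f

@[simp] lemma cre_zero : cre c 0 = 1 := by simp [cre]

@[simp] lemma ann_zero : ann A c 0 = 1 := by simp [ann]

lemma ann_rec (n : ℕ) (f : Osc L) : (n : ℂ) • ann A c n f =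
    ∑ p ∈ antidiagonal n, (p.1 : ℂ) • annD A c p.1 (ann A c p.2 f) := by
  have := congrArg (fun T : Module.End ℂ (Osc L) => T f)
    (expSeries_rec (coeff_zero_annExp A c) (commute_annExp A c c) n)
  simpa [ann, annExp, LinearMap.sum_apply] using this

lemma ann_eq_of_rec (f : Osc L) (F : ℕ → Osc L) (h0 : F 0 = f)
    (hF : ∀ n : ℕ, (n : ℂ) • F n = ∑ p ∈ antidiagonal n, (p.1 : ℂ) • annD A c p.1 (F p.2))
    (n : ℕ) : ann A c n f = F n :=
  euler_rec_unique (fun m x => annD A c m x) (E := fun n => ann A c n f) (by simp [h0])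
    (fun n => ann_rec A c n f) hF n

lemma sum_antidiagonal_assoc {M : Type*} [AddCommMonoid M] (F : ℕ → ℕ → ℕ → M) (n : ℕ) :
    ∑ p ∈ antidiagonal n, ∑ r ∈ antidiagonal p.2, F p.1 r.1 r.2 =
      ∑ p ∈ antidiagonal n, ∑ r ∈ antidiagonal p.1, F r.1 r.2 p.2 := by
  rw [sum_sigma', sum_sigma']
  refine sum_bij' (fun x _ => ⟨(x.1.1 + x.2.1, x.2.2), (x.1.1, x.2.1)⟩)
    (fun x _ => ⟨(x.2.1, x.2.2 + x.1.2), (x.2.2, x.1.2)⟩) ?_ ?_ ?_ ?_ ?_ <;>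
  · rintro ⟨⟨a, b⟩, ⟨x, y⟩⟩ h
    simp only [mem_sigma, HasAntidiagonal.mem_antidiagonal] at h
    obtain ⟨rfl, rfl⟩ := h
    try simp only [mem_sigma, HasAntidiagonal.mem_antidiagonal]
    first | done | rfl | exact ⟨by omega, trivial⟩

lemma sum_antidiagonal_left_comm {M : Type*} [AddCommMonoid M] (F : ℕ → ℕ → ℕ → M) (n : ℕ) :
    ∑ p ∈ antidiagonal n, ∑ r ∈ antidiagonal p.2, F p.1 r.1 r.2 =
      ∑ p ∈ antidiagonal n, ∑ r ∈ antidiagonal p.2, F r.1 p.1 r.2 := by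
  rw [sum_sigma', sum_sigma']
  refine sum_bij' (fun x _ => ⟨(x.2.1, x.1.1 + x.2.2), (x.1.1, x.2.2)⟩)
    (fun x _ => ⟨(x.2.1, x.1.1 + x.2.2), (x.1.1, x.2.2)⟩) ?_ ?_ ?_ ?_ ?_ <;>
  · rintro ⟨⟨a, b⟩, ⟨x, y⟩⟩ h
    simp only [mem_sigma, HasAntidiagonal.mem_antidiagonal] at h
    obtain ⟨rfl, rfl⟩ := h
    try simp only [mem_sigma, HasAntidiagonal.mem_antidiagonal]
    first | done | rfl | exact ⟨by omega, trivial⟩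

/-- The exponential of a derivation is a ring homomorphism: by the Leibniz rule the convolution of
the two images satisfies the recursion that characterizes `ann`. -/
lemma ann_mul (n : ℕ) (f g : Osc L) :
    ann A c n (f * g) = ∑ p ∈ antidiagonal n, ann A c p.1 f * ann A c p.2 g := by
  refine ann_eq_of_rec A c _ (fun n => ∑ p ∈ antidiagonal n, ann A c p.1 f * ann A c p.2 g)
    (by simp) (fun n => ?_) n
  have h1 : (n : ℂ) • ∑ p ∈ antidiagonal n, ann A c p.1 f * ann A c p.2 g =
      ∑ p ∈ antidiagonal n, ((p.1 : ℂ) • ann A c p.1 f) * ann A c p.2 g +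
      ∑ p ∈ antidiagonal n, ann A c p.1 f * ((p.2 : ℂ) • ann A c p.2 g) := by
    rw [smul_sum, ← sum_add_distrib]
    refine sum_congr rfl fun p hp => ?_
    rw [← mem_antidiagonal.1 hp]
    push_cast
    rw [add_smul, smul_mul_assoc, mul_smul_comm]
  rw [h1, add_comm]
  simp only [ann_rec, mul_sum, sum_mul, map_sum, Derivation.leibniz, smul_sum, smul_add,
    sum_add_distrib, smul_eq_mul]
  congr 1
  · rw [sum_antidiagonal_left_comm fun a b d => (a : ℂ) • (ann A c b f * annD A c a (ann A c d g))]
    simp only [mul_smul_comm]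
  · rw [sum_antidiagonal_assoc fun a b d => (a : ℂ) • (ann A c d g * annD A c a (ann A c b f))]
    refine sum_congr rfl fun p _ => sum_congr rfl fun r _ => ?_
    rw [smul_mul_assoc, mul_comm]

lemma ann_C (n : ℕ) (a : ℂ) :
    ann A c n (MvPolynomial.C a) = if n = 0 then MvPolynomial.C a else 0 := by
  refine ann_eq_of_rec A c _ (fun n => if n = 0 then MvPolynomial.C a else 0)
    (by simp) (fun n => ?_) n
  rw [sum_eq_zero]
  · split_ifs with h <;> simp [h]
  · intro p _
    split_ifs <;> simp

lemma ann_X (n : ℕ) (l : Fin L) (k : ℕ+) :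
    ann A c n (MvPolynomial.X (l, k)) = if n = 0 then MvPolynomial.X (l, k) else
      if n = k then MvPolynomial.C (tau A c n l) else 0 := by
  refine ann_eq_of_rec A c _ (fun n => if n = 0 then MvPolynomial.X (l, k) else
      if n = k then MvPolynomial.C (tau A c n l) else 0)
    (by simp) (fun n => ?_) n
  rw [sum_eq_single (n, 0)]
  · rcases Nat.eq_zero_or_pos n with h | h
    · simp [h]
    · simp [h.ne', annD_X]
  · intro p hp hne
    have : p.2 ≠ 0 := by
      rintro h
      have := mem_antidiagonal.1 hp
      exact hne (Prod.ext (by simp; omega) h)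
    simp only [this, if_false]
    split_ifs <;> simp
  · simp

/-- Local nilpotency. It is the source of finiteness of all the sums over modes below. -/
lemma exists_ann_eq_zero (f : Osc L) : ∃ N, ∀ n, N ≤ n → ann A c n f = 0 := by
  induction f using MvPolynomial.induction_on with
  | C a => exact ⟨1, fun n hn => by rw [ann_C, if_neg (by omega)]⟩
  | add f g hf hg =>
    obtain ⟨N, hN⟩ := hf
    obtain ⟨M, hM⟩ := hg
    exact ⟨N + M, fun n hn => by rw [map_add, hN n (by omega), hM n (by omega), add_zero]⟩
  | mul_X f i hf =>
    obtain ⟨N, hN⟩ := hf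
    refine ⟨N + i.2 + 1, fun n hn => ?_⟩
    rw [ann_mul]
    refine sum_eq_zero fun p hp => ?_
    have := mem_antidiagonal.1 hp
    by_cases h : N ≤ p.1
    · rw [hN _ h, zero_mul]
    · rw [ann_X, if_neg (by omega), if_neg (by omega), mul_zero]

/-- `m⁻¹ ∑ c_j(m) A_{jl}(m) d_l(-m)`, the commutator of the exponents in degree `m`. -/
def contract (m : ℕ) : ℂ := ∑ l, tau A c m l * d l (-(m : ℤ))

/-- The exponent of the contraction of two vertex operators. -/
def contractExp : PowerSeries ℂ :=
  PowerSeries.mk fun m => if m = 0 then 0 else contract A c d m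

lemma annD_creExp (i m : ℕ) : annD A c i (coeff m (creExp d)) =
    if i = m ∧ i ≠ 0 then MvPolynomial.C (contract A c d i) else 0 := by
  rcases Nat.eq_zero_or_pos m with h | h
  · rw [h, coeff_zero_creExp, map_zero, if_neg (by tauto)]
  · simp only [creExp, coeff_mk, h.ne', if_false, map_sum, Derivation.map_smul, annD_X,
      Nat.toPNat'_coe, h, if_true]
    by_cases him : i = m
    · subst him
      simp only [h.ne', ne_eq, not_false_eq_true, and_self, if_true, contract, map_sum,
        MvPolynomial.smul_eq_C_mul, map_mul, mul_comm]
    · simp [him]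

lemma cre_rec (n : ℕ) : (n : ℂ) • cre c n =
    ∑ p ∈ antidiagonal n, (p.1 : ℂ) • (coeff p.1 (creExp c) * cre c p.2) :=
  expSeries_rec_comm (coeff_zero_creExp c) n

/-- A derivation sending the exponent to a scalar in degree i multiplies the exponential by that
scalar times u^i. The proof is by induction through the Euler recursion. -/
lemma annD_cre (i n : ℕ) (hi : i ≠ 0) : annD A c i (cre d n) =
    if i ≤ n then contract A c d i • cre d (n - i) else 0 := by
  induction n using Nat.strong_induction_on with
  | _ n ih =>
    rcases Nat.eq_zero_or_pos n with h | h
    · simp [h, hi]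
    have hn : (n : ℂ) ≠ 0 := by exact_mod_cast h.ne'
    refine smul_right_injective _ hn ?_
    beta_reduce
    rw [← Derivation.map_smul, cre_rec]
    simp only [map_sum, Derivation.map_smul, Derivation.leibniz, smul_eq_mul, smul_add,
      sum_add_distrib, annD_creExp]
    -- The Leibniz rule gives two pieces: differentiating the exponent contributes the factor i, the
    -- induction hypothesis contributes n - i, and together they make n.
    have e1 : ∑ p ∈ antidiagonal n, (p.1 : ℂ) • (cre d p.2 *
        if i = p.1 ∧ i ≠ 0 then MvPolynomial.C (contract A c d i) else 0) =
        if i ≤ n then (i : ℂ) • contract A c d i • cre d (n - i) else 0 := by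
      split_ifs with hin
      · rw [sum_eq_single (i, n - i)]
        · simp [hi, MvPolynomial.smul_eq_C_mul, mul_comm, mul_left_comm]
        · intro p hp hne
          have := mem_antidiagonal.1 hp
          rw [if_neg, mul_zero, smul_zero]
          rintro ⟨rfl, -⟩
          exact hne (Prod.ext rfl (by simp; omega))
        · intro h; exact absurd (HasAntidiagonal.mem_antidiagonal.2 (by simp; omega)) h
      · refine sum_eq_zero fun p hp => ?_
        have := mem_antidiagonal.1 hp
        rw [if_neg (by omega), mul_zero, smul_zero]
    have e2 : ∑ p ∈ antidiagonal n, (p.1 : ℂ) •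
        (coeff p.1 (creExp d) * annD A c i (cre d p.2)) =
        if i ≤ n then ((n - i : ℕ) : ℂ) • contract A c d i • cre d (n - i) else 0 := by
      have e3 : ∀ p ∈ antidiagonal n, (p.1 : ℂ) •
          (coeff p.1 (creExp d) * annD A c i (cre d p.2)) =
          if i ≤ p.2 then contract A c d i • ((p.1 : ℂ) •
            (coeff p.1 (creExp d) * cre d (p.2 - i))) else 0 := by
        intro p hp
        have := mem_antidiagonal.1 hp
        rcases Nat.eq_zero_or_pos p.1 with h1 | h1
        · simp [h1]
        rw [ih p.2 (by omega)]
        split_ifs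
        · rw [mul_smul_comm, smul_comm]
        · rw [mul_zero, smul_zero]
      rw [sum_congr rfl e3]
      split_ifs with hin
      · rw [smul_comm, cre_rec, smul_sum]
        obtain ⟨k, rfl⟩ := Nat.exists_eq_add_of_le hin
        rw [← sum_filter, Nat.add_sub_cancel_left]
        refine sum_bij' (fun p _ => (p.1, p.2 - i)) (fun p _ => (p.1, p.2 + i)) ?_ ?_ ?_ ?_ ?_
        · rintro ⟨a, b⟩ h
          simp only [mem_filter, HasAntidiagonal.mem_antidiagonal] at h ⊢
          omega
        · rintro ⟨a, b⟩ h
          simp only [mem_filter, HasAntidiagonal.mem_antidiagonal] at h ⊢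
          omega
        · rintro ⟨a, b⟩ h
          simp only [mem_filter, HasAntidiagonal.mem_antidiagonal] at h
          simp; omega
        · rintro ⟨a, b⟩ h
          simp
        · rintro ⟨a, b⟩ h
          rfl
      · refine sum_eq_zero fun p hp => ?_
        have := mem_antidiagonal.1 hp
        rw [if_neg (by omega)]
    rw [add_comm]
    rw [e1, e2]
    split_ifs with hin
    · rw [← add_smul]
      congr 1
      push_cast [Nat.cast_sub hin]
      ring
    · simp

/-- This is the origin of the contraction: moving an annihilation exponential past a creation
exponential costs the scalar series with exponent `contractExp`. -/
lemma ann_cre (n l : ℕ) : ann A c n (cre d l) =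
    if n ≤ l then coeff n (expSeries (contractExp A c d)) • cre d (l - n) else 0 := by
  refine ann_eq_of_rec A c _ (fun n => if n ≤ l then
    coeff n (expSeries (contractExp A c d)) • cre d (l - n) else 0) (by simp) (fun n => ?_) n
  have e : ∀ p ∈ antidiagonal n, (p.1 : ℂ) • annD A c p.1 (if p.2 ≤ l then
      coeff p.2 (expSeries (contractExp A c d)) • cre d (l - p.2) else 0) =
      if n ≤ l then ((p.1 : ℂ) • (coeff p.1 (contractExp A c d) *
        coeff p.2 (expSeries (contractExp A c d)))) • cre d (l - n) else 0 := by
    intro p hp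
    have hp := mem_antidiagonal.1 hp
    rcases Nat.eq_zero_or_pos p.1 with h1 | h1
    · simp [h1]
    by_cases h2 : p.2 ≤ l
    · rw [if_pos h2, Derivation.map_smul, annD_cre _ _ _ _ _ h1.ne']
      by_cases hn : n ≤ l
      · rw [if_pos hn, if_pos (by omega), show l - p.2 - p.1 = l - n by omega]
        simp only [contractExp, coeff_mk, h1.ne', if_false, smul_smul, smul_eq_mul]
        congr 1
        ring
      · rw [if_neg hn, if_neg (by omega), smul_zero, smul_zero]
    · rw [if_neg h2, map_zero, smul_zero, if_neg (by omega)]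
  rw [sum_congr rfl e]
  split_ifs with hn
  · rw [← sum_smul, ← expSeries_rec_comm (by simp [contractExp]), smul_assoc]
  · simp

lemma ann_cre_mul (n l : ℕ) (f : Osc L) : ann A c n (cre d l * f) =
    ∑ i ∈ range (n + 1), if i ≤ l then
      coeff i (expSeries (contractExp A c d)) • (cre d (l - i) * ann A c (n - i) f) else 0 := by
  rw [ann_mul, Nat.sum_antidiagonal_eq_sum_range_succ fun a b => ann A c a (cre d l) * ann A c b f]
  refine sum_congr rfl fun i _ => ?_
  rw [ann_cre]
  split_ifs <;> simp

/-- The exponents `c_j(m) + t^m d_j(m)`, for `t = e^ℓ`. -/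
def twist (ℓ : ℂ) (c d : Fin L → ℤ → ℂ) : Fin L → ℤ → ℂ :=
  fun j m => c j m + Complex.exp (m * ℓ) * d j m

/-- The exponent is a sum, so the exponential factors. Creation modes have index -m, hence the
factor e^{-ℓ} per degree, opposite to the one in `ann_twist`. -/
lemma cre_twist (ℓ : ℂ) (n : ℕ) : cre (twist ℓ c d) n =
    ∑ p ∈ antidiagonal n, Complex.exp (-(p.2 * ℓ)) • (cre c p.1 * cre d p.2) := by
  have h1 : creExp (twist ℓ c d) = creExp c + creExp fun j m => Complex.exp (m * ℓ) * d j m := by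
    ext1 m
    simp only [creExp, twist, coeff_mk, map_add]
    split_ifs
    · simp
    · simp [add_smul, sum_add_distrib]
  have h2 : ∀ n, coeff n (creExp fun j m => Complex.exp (m * ℓ) * d j m) =
      (Complex.exp (-ℓ)) ^ n • coeff n (creExp d) := by
    intro m
    simp only [creExp, coeff_mk]
    split_ifs
    · simp
    · rw [smul_sum]
      refine sum_congr rfl fun j _ => ?_
      rw [smul_smul, ← Complex.exp_nat_mul]
      congr 3
      push_cast; ring
  rw [cre, h1, expSeries_add (coeff_zero_creExp _) (coeff_zero_creExp _)
    (fun _ _ => Commute.all _ _) (fun _ _ => Commute.all _ _) (fun _ _ => Commute.all _ _),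
    coeff_mul]
  refine sum_congr rfl fun p _ => ?_
  rw [coeff_expSeries_scale _ h2, mul_smul_comm, ← Complex.exp_nat_mul, mul_neg]
  rfl

lemma ann_twist (ℓ : ℂ) (n : ℕ) (f : Osc L) : ann A (twist ℓ c d) n f =
    ∑ p ∈ antidiagonal n, Complex.exp (p.2 * ℓ) • ann A c p.1 (ann A d p.2 f) := by
  have h1 : annExp A (twist ℓ c d) =
      annExp A c + annExp A fun j m => Complex.exp (m * ℓ) * d j m := by
    ext1 m
    simp only [annExp, coeff_mk, map_add, annD]
    split_ifs
    · simp
    · rw [← Derivation.coe_add_linearMap, ← sum_add_distrib]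
      simp only [tau, twist, add_mul, sum_add_distrib, mul_add, add_smul]
  have h2 : ∀ n, coeff n (annExp A fun j m => Complex.exp (m * ℓ) * d j m) =
      (Complex.exp ℓ) ^ n • coeff n (annExp A d) := by
    intro m
    simp only [annExp, coeff_mk, annD]
    split_ifs
    · simp
    · rw [← Derivation.coe_smul_linearMap, smul_sum]
      congr 1
      refine sum_congr rfl fun j _ => ?_
      rw [smul_smul, ← Complex.exp_nat_mul, tau, tau, mul_left_comm, mul_sum]
      simp only [Int.cast_natCast, mul_assoc, mul_sum]
  rw [ann, h1, expSeries_add (coeff_zero_annExp _ _) (coeff_zero_annExp _ _)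
    (commute_annExp _ _ _) (commute_annExp _ _ _) (commute_annExp _ _ _), coeff_mul,
    LinearMap.sum_apply]
  refine sum_congr rfl fun p _ => ?_
  rw [coeff_expSeries_scale _ h2, mul_smul_comm, ← Complex.exp_nat_mul]
  rfl

end DeformedW

namespace DeformedW

/-! ### Vertex operators on the Fock space -/

open PowerSeries Finset

variable {L : ℕ} (A : ℤ → Matrix (Fin L) (Fin L) ℂ)

/-- Operators on the oscillator space act on every momentum sector of the Fock space. -/
def sectorwise : Module.End ℂ (Osc L) →ₐ[ℂ] Module.End ℂ (Fock L) :=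
  AlgHom.ofLinearMap
    { toFun := fun T => Finsupp.mapRange.linearMap T
      map_add' := fun S T => by ext; simp
      map_smul' := fun a T => by ext; simp }
    (by ext; simp) (fun S T => by ext; simp)

@[simp] lemma sectorwise_single (T : Module.End ℂ (Osc L)) (k : Fin L → ℂ) (f : Osc L) :
    sectorwise T (Finsupp.single k f) = Finsupp.single k (T f) := by
  simp [sectorwise]

lemma boson_neg (j : Fin L) {m : ℕ} (hm : m ≠ 0) : boson A j (-(m : ℤ)) =
    sectorwise (Algebra.lmul ℂ (Osc L) (MvPolynomial.X (j, m.toPNat'))) := by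
  obtain ⟨n, rfl⟩ := Nat.exists_eq_succ_of_ne_zero hm
  rfl

lemma boson_pos (j : Fin L) {m : ℕ} (hm : m ≠ 0) : boson A j (m : ℤ) =
    sectorwise ((m : ℂ)⁻¹ • ∑ l, A m j l •
        (MvPolynomial.pderiv (R := ℂ) (l, m.toPNat')).toLinearMap) := by
  obtain ⟨n, rfl⟩ := Nat.exists_eq_succ_of_ne_zero hm
  have : boson A j ((n + 1 : ℕ) : ℤ) = Finsupp.mapRange.linearMap
      (((n : ℂ) + 1)⁻¹ • ∑ j', A ((n : ℤ) + 1) j j' •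
        (MvPolynomial.pderiv (R := ℂ) (j', n.succPNat)).toLinearMap) := rfl
  rw [Nat.succ_eq_add_one, this]
  simp only [sectorwise]
  push_cast
  rfl

namespace VertexOp

variable (V W : VertexOp L)

lemma coeff_creation (n : ℕ) : coeff n (V.creation A) =
    sectorwise (Algebra.lmul ℂ (Osc L) (cre V.coef n)) := by
  have := expSeries_map (R := Osc L) (S := Module.End ℂ (Fock L))
    ((sectorwise (L := L)).comp (Algebra.lmul ℂ (Osc L))) (creExp V.coef) n
  rw [AlgHom.comp_apply] at this
  rw [cre, ← this, creation]
  congr 2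
  ext1 m
  simp only [coeff_mk, coeff_map, creExp]
  split_ifs with h
  · simp
  · simp [boson_neg A _ h]

lemma coeff_annihilation (n : ℕ) : coeff n (V.annihilation A) =
    sectorwise (ann A V.coef n) := by
  have := expSeries_map (R := Module.End ℂ (Osc L)) (S := Module.End ℂ (Fock L))
    (sectorwise (L := L)) (annExp A V.coef) n
  rw [ann, ← this, annihilation]
  congr 2
  ext1 m
  simp only [coeff_mk, coeff_map, annExp, annD]
  split_ifs with h
  · simp
  · simp only [boson_pos A _ h, RingHom.coe_coe, ← map_smul, ← map_sum]
    congr 1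
    refine LinearMap.ext fun f => ?_
    have hs : ∀ D : Fin L → Derivation ℂ (Osc L) (Osc L), ∀ f, (∑ l, D l) f = ∑ l, D l f :=
      fun D f => by
        have := map_sum (Derivation.coeFnAddMonoidHom (R := ℂ) (A := Osc L) (M := Osc L)) D univ
        exact (congrFun this f).trans (Finset.sum_apply _ _ _)
    simp only [LinearMap.sum_apply, LinearMap.smul_apply, Derivation.coeFn_coe, hs,
      Derivation.smul_apply, smul_sum, smul_smul, tau, mul_sum, sum_smul]
    rw [sum_comm]
    refine sum_congr rfl fun l _ => sum_congr rfl fun j _ => ?_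
    congr 1
    ring

/-- The momentum after the action of `e^{∑ n_j Q_j}`. -/
def shiftMom (n : Fin L → ℤ) (k : Fin L → ℂ) : Fin L → ℂ := fun i => k i + ∑ j, A 0 i j * (n j : ℂ)

/-- The exponent of `z` in `z^pre z^{∑ pow_j a_j(0)}` at momentum `k`. -/
def wt (k : Fin L → ℂ) : ℂ := V.pre + ∑ j, V.pow j * k j

/-- The scalar by which `e^{∑ mom_j a_j(0)}` acts at momentum `k`. -/
def momExp (k : Fin L → ℂ) : ℂ := Complex.exp (∑ j, V.mom j * k j)

lemma momExp_ne_zero (k : Fin L → ℂ) : V.momExp k ≠ 0 := Complex.exp_ne_zero _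

lemma expQ_single (n : Fin L → ℤ) (k : Fin L → ℂ) (f : Osc L) :
    expQ A n (Finsupp.single k f) = Finsupp.single (shiftMom A n k) f := by
  simp [expQ, Finsupp.lmapDomain_apply, Finsupp.mapDomain_single]
  rfl

lemma zeroMode_single (e : ℂ) (k : Fin L → ℂ) (f : Osc L) :
    V.zeroMode e (Finsupp.single k f) =
      if V.wt k = e then V.momExp k • Finsupp.single k f else 0 := by
  rw [zeroMode, Finsupp.lsum_single]
  by_cases h : V.wt k = e
  · rw [if_pos h, if_pos (show V.pre + ∑ j, V.pow j * k j = e from h), momExp]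
    simp
  · rw [if_neg h, if_neg (show ¬ V.pre + ∑ j, V.pow j * k j = e from h)]
    simp

/-- The summands of a mode of a vertex operator. -/
def modeTerm (c : ℂ) (x : ℕ × ℕ) : Module.End ℂ (Fock L) :=
  coeff x.1 (V.creation A) * (expQ A V.charge *
    (V.zeroMode (c - x.1 + x.2) * coeff x.2 (V.annihilation A)))

lemma mode_eq (c : ℂ) (v : Fock L) : V.mode A c v = ∑ᶠ x, V.modeTerm A c x v := rfl

lemma modeTerm_single (c : ℂ) (x : ℕ × ℕ) (k : Fin L → ℂ) (f : Osc L) :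
    V.modeTerm A c x (Finsupp.single k f) = Finsupp.single (shiftMom A V.charge k)
      (if V.wt k + x.1 = c + x.2 then V.momExp k • (cre V.coef x.1 * ann A V.coef x.2 f)
        else 0) := by
  have : V.wt k = c - x.1 + x.2 ↔ V.wt k + x.1 = c + x.2 := by
    constructor <;> intro h <;> linear_combination h
  simp only [modeTerm, Module.End.mul_apply, coeff_annihilation, coeff_creation,
    sectorwise_single, zeroMode_single, this]
  split_ifs
  · rw [map_smul, expQ_single, map_smul, sectorwise_single, Finsupp.smul_single]
    rfl
  · simp

/-- Exponents of z are complex, and a fixed exponent only pins down the difference of the creation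
and annihilation degrees. With the annihilation degree bounded by local nilpotency, this bounds the
creation degree as well. -/
lemma exists_bound (u v : ℂ) : ∃ B : ℕ, ∀ m n : ℕ, u + m = v + n → m ≤ n + B := by
  obtain ⟨B, hB⟩ := exists_nat_ge ‖v - u‖
  refine ⟨B, fun m n h => ?_⟩
  have h1 : (m : ℂ) = (v - u) + n := by linear_combination h
  have h2 : (m : ℝ) ≤ ‖v - u‖ + n := by
    calc (m : ℝ) = ‖(m : ℂ)‖ := by simp
      _ ≤ ‖v - u‖ + ‖(n : ℂ)‖ := by rw [h1]; exact norm_add_le _ _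
      _ = _ := by simp
  have : (m : ℝ) ≤ n + B := by linarith
  exact_mod_cast this

lemma polyTerm_finite (u c : ℂ) (a : ℂ) (C D : Fin L → ℤ → ℂ) (f : Osc L) :
    (Function.support fun x : ℕ × ℕ => if u + x.1 = c + x.2 then
      a • (cre C x.1 * ann A D x.2 f) else 0).Finite := by
  obtain ⟨N, hN⟩ := exists_ann_eq_zero A D f
  obtain ⟨B, hB⟩ := exists_bound u c
  refine (Set.finite_Iic (N + B, N)).subset fun x hx => ?_
  rw [Function.mem_support] at hx
  split_ifs at hx with h
  · have h1 : x.2 < N := by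
      by_contra hc
      exact hx (by rw [hN _ (not_lt.1 hc), mul_zero, smul_zero])
    have h2 := hB _ _ h
    exact ⟨by simp; omega, by simp; omega⟩
  · exact absurd rfl hx

lemma modeTerm_finite (c : ℂ) (v : Fock L) :
    (Function.support fun x => V.modeTerm A c x v).Finite := by
  induction v using Finsupp.induction_linear with
  | zero => simp
  | add f g hf hg =>
    simp only [map_add]
    exact (hf.union hg).subset (Function.support_add _ _)
  | single k f =>
    simp only [modeTerm_single]
    refine (polyTerm_finite A (V.wt k) c (V.momExp k) V.coef V.coef f).subset fun x hx => ?_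
    rw [Function.mem_support] at hx ⊢
    exact fun h => hx (by rw [h, Finsupp.single_zero])

lemma mode_add (c : ℂ) (v w : Fock L) : V.mode A c (v + w) = V.mode A c v + V.mode A c w := by
  simp only [mode_eq, map_add]
  exact finsum_add_distrib (V.modeTerm_finite A c v) (V.modeTerm_finite A c w)

lemma mode_smul (c : ℂ) (a : ℂ) (v : Fock L) : V.mode A c (a • v) = a • V.mode A c v := by
  simp only [mode_eq, map_smul]
  rw [smul_finsum]

lemma mode_zero (c : ℂ) : V.mode A c 0 = 0 := by simp [mode_eq]

/-- The polynomial part of a mode. -/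
def polyMode (u c : ℂ) (C : Fin L → ℤ → ℂ) (f : Osc L) : Osc L :=
  ∑ᶠ x : ℕ × ℕ, if u + x.1 = c + x.2 then cre C x.1 * ann A C x.2 f else 0

lemma mode_single (c : ℂ) (k : Fin L → ℂ) (f : Osc L) :
    V.mode A c (Finsupp.single k f) = Finsupp.single (shiftMom A V.charge k)
      (V.momExp k • polyMode A (V.wt k) c V.coef f) := by
  simp only [mode_eq, modeTerm_single, polyMode]
  rw [← Finsupp.singleAddHom_apply, smul_finsum, AddMonoidHom.map_finsum]
  · simp [Finsupp.singleAddHom_apply]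
  · refine (polyTerm_finite A (V.wt k) c (V.momExp k) V.coef V.coef f).subset fun x hx => ?_
    simpa using hx

/-- The summands of a mode of a normal ordered product. -/
def normalTerm (a b : ℂ) (x : (ℕ × ℕ) × (ℕ × ℕ)) : Module.End ℂ (Fock L) :=
  coeff x.1.1 (V.creation A) * (coeff x.2.1 (W.creation A) * (expQ A (V.charge + W.charge) *
    (V.zeroMode (a - x.1.1 + x.1.2) * (W.zeroMode (b - x.2.1 + x.2.2) *
      (coeff x.1.2 (V.annihilation A) * coeff x.2.2 (W.annihilation A))))))

lemma normalMode_eq (a b : ℂ) (v : Fock L) :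
    normalMode A V W a b v = ∑ᶠ x, normalTerm A V W a b x v := rfl

/-- The polynomial part of a summand of a normal ordered product. -/
def polyNormalTerm (u a u' b : ℂ) (C D : Fin L → ℤ → ℂ) (f : Osc L)
    (x : (ℕ × ℕ) × (ℕ × ℕ)) : Osc L :=
  if u + x.1.1 = a + x.1.2 ∧ u' + x.2.1 = b + x.2.2 then
    cre C x.1.1 * (cre D x.2.1 * ann A C x.1.2 (ann A D x.2.2 f)) else 0

lemma normalTerm_single (a b : ℂ) (x : (ℕ × ℕ) × (ℕ × ℕ)) (k : Fin L → ℂ) (f : Osc L) :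
    normalTerm A V W a b x (Finsupp.single k f) =
      Finsupp.single (shiftMom A (V.charge + W.charge) k)
        ((V.momExp k * W.momExp k) •
          polyNormalTerm A (V.wt k) a (W.wt k) b V.coef W.coef f x) := by
  have h1 : V.wt k = a - x.1.1 + x.1.2 ↔ V.wt k + x.1.1 = a + x.1.2 := by
    constructor <;> intro h <;> linear_combination h
  have h2 : W.wt k = b - x.2.1 + x.2.2 ↔ W.wt k + x.2.1 = b + x.2.2 := by
    constructor <;> intro h <;> linear_combination h
  simp only [normalTerm, Module.End.mul_apply, coeff_annihilation, coeff_creation,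
    sectorwise_single, zeroMode_single, polyNormalTerm, h2]
  by_cases hW : W.wt k + x.2.1 = b + x.2.2
  · simp only [hW, if_true, map_smul, zeroMode_single, h1, and_true]
    by_cases hV : V.wt k + x.1.1 = a + x.1.2
    · simp only [hV, if_true, map_smul, expQ_single, sectorwise_single]
      rw [Finsupp.smul_single, Finsupp.smul_single, smul_smul, mul_comm]
      rfl
    · simp [hV]
  · simp [hW]

lemma exists_ann_ann_eq_zero (C D : Fin L → ℤ → ℂ) (f : Osc L) :
    ∃ N, ∀ m n, (N ≤ m ∨ N ≤ n) → ann A C m (ann A D n f) = 0 := by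
  obtain ⟨N, hN⟩ := exists_ann_eq_zero A D f
  choose M hM using fun n => exists_ann_eq_zero A C (ann A D n f)
  refine ⟨N + ∑ n ∈ range N, M n, fun m n h => ?_⟩
  by_cases hn : N ≤ n
  · rw [hN n hn, map_zero]
  · refine hM n m ?_
    have : M n ≤ ∑ n ∈ range N, M n :=
      single_le_sum (f := M) (fun _ _ => Nat.zero_le _) (mem_range.2 (not_le.1 hn))
    omega

lemma polyNormalTerm_finite (u a u' b : ℂ) (C D : Fin L → ℤ → ℂ) (f : Osc L) :
    (Function.support (polyNormalTerm A u a u' b C D f)).Finite := by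
  obtain ⟨N, hN⟩ := exists_ann_ann_eq_zero A C D f
  obtain ⟨B, hB⟩ := exists_bound u a
  obtain ⟨B', hB'⟩ := exists_bound u' b
  refine (Set.finite_Iic ((N + B, N), (N + B', N))).subset fun x hx => ?_
  rw [Function.mem_support, polyNormalTerm] at hx
  split_ifs at hx with h
  · have h1 : x.1.2 < N ∧ x.2.2 < N := by
      by_contra hc
      exact hx (by rw [hN _ _ (by omega), mul_zero, mul_zero])
    have h2 := hB _ _ h.1
    have h3 := hB' _ _ h.2
    exact ⟨⟨by simp; omega, by simp; omega⟩, ⟨by simp; omega, by simp; omega⟩⟩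
  · exact absurd rfl hx

lemma normalTerm_finite (a b : ℂ) (v : Fock L) :
    (Function.support fun x => normalTerm A V W a b x v).Finite := by
  induction v using Finsupp.induction_linear with
  | zero => simp
  | add f g hf hg =>
    simp only [map_add]
    exact (hf.union hg).subset (Function.support_add _ _)
  | single k f =>
    simp only [normalTerm_single]
    refine (polyNormalTerm_finite A (V.wt k) a (W.wt k) b V.coef W.coef f).subset fun x hx => ?_
    rw [Function.mem_support] at hx ⊢
    exact fun h => hx (by rw [h, smul_zero, Finsupp.single_zero])

lemma normalMode_add (a b : ℂ) (v w : Fock L) : normalMode A V W a b (v + w) =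
    normalMode A V W a b v + normalMode A V W a b w := by
  simp only [normalMode_eq, map_add]
  exact finsum_add_distrib (normalTerm_finite A V W a b v) (normalTerm_finite A V W a b w)

lemma normalMode_zero (a b : ℂ) : normalMode A V W a b 0 = 0 := by simp [normalMode_eq]

lemma normalMode_single (a b : ℂ) (k : Fin L → ℂ) (f : Osc L) :
    normalMode A V W a b (Finsupp.single k f) =
      Finsupp.single (shiftMom A (V.charge + W.charge) k)
        ((V.momExp k * W.momExp k) •
          ∑ᶠ x, polyNormalTerm A (V.wt k) a (W.wt k) b V.coef W.coef f x) := by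
  simp only [normalMode_eq, normalTerm_single]
  rw [← Finsupp.singleAddHom_apply, smul_finsum, AddMonoidHom.map_finsum]
  · simp [Finsupp.singleAddHom_apply]
  · refine (polyNormalTerm_finite A (V.wt k) a (W.wt k) b V.coef W.coef f).subset
      fun x hx => ?_
    rw [Function.mem_support] at hx ⊢
    exact fun h => hx (by rw [h, smul_zero])

end VertexOp

end DeformedW

namespace DeformedW

/-! ### Products of two vertex operators and their contraction -/

open PowerSeries Finset

lemma finsum_comp_of_support_subset_range {α β M : Type*} [AddCommMonoid M] (e : α → β)
    (he : Function.Injective e) (f : β → M) (h : Function.support f ⊆ Set.range e) :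
    ∑ᶠ x, f (e x) = ∑ᶠ y, f y := by
  rw [← finsum_mem_range he, finsum_mem_def, Set.indicator_eq_self.2 h]

lemma exists_ne_zero_of_finsum_ne_zero {α M : Type*} [AddCommMonoid M] {f : α → M}
    (h : ∑ᶠ x, f x ≠ 0) : ∃ x, f x ≠ 0 := by
  by_contra! hc
  exact h (finsum_eq_zero_of_forall_eq_zero hc)

lemma finite_support_smul {α M : Type*} [AddCommGroup M] [Module ℂ M] (φ : α → ℂ) {f : α → M}
    (hf : (Function.support f).Finite) : (Function.support fun x => φ x • f x).Finite :=
  hf.subset fun x hx h => hx (by simp [h])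

variable {L : ℕ} (A : ℤ → Matrix (Fin L) (Fin L) ℂ)

namespace VertexOp

lemma polyMode_smul (u c : ℂ) (C : Fin L → ℤ → ℂ) (a : ℂ) (f : Osc L) :
    polyMode A u c C (a • f) = a • polyMode A u c C f := by
  simp only [polyMode, map_smul, smul_finsum]
  refine finsum_congr fun x => ?_
  split_ifs <;> simp

/-- The normal ordering formula on the oscillator space. -/
lemma polyMode_polyMode (u a u' b : ℂ) (C D : Fin L → ℤ → ℂ) (f : Osc L) :
    polyMode A u a C (polyMode A u' b D f) =
      ∑ᶠ i : ℕ, coeff i (expSeries (contractExp A C D)) •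
        ∑ᶠ x, polyNormalTerm A u (a + i) u' (b - i) C D f x := by
  set φ : ℕ → ℂ := fun i => coeff i (expSeries (contractExp A C D)) with hφ
  -- The last index i is the total degree contracted between the annihilation part of the left
  -- factor and the creation part of the right one, so it is at most either of these degrees.
  let G : ((ℕ × ℕ) × (ℕ × ℕ)) × ℕ → Osc L := fun q =>
    if (u + q.1.1.1 = a + q.1.1.2 ∧ u' + q.1.2.1 = b + q.1.2.2) ∧
      (q.2 ≤ q.1.1.2 ∧ q.2 ≤ q.1.2.1) then
      φ q.2 • (cre C q.1.1.1 * (cre D (q.1.2.1 - q.2) *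
        ann A C (q.1.1.2 - q.2) (ann A D q.1.2.2 f))) else 0
  have hG : (Function.support G).Finite := by
    obtain ⟨N, hN⟩ := exists_ann_ann_eq_zero A C D f
    obtain ⟨B, hB⟩ := exists_bound u a
    obtain ⟨B', hB'⟩ := exists_bound u' b
    refine (Set.finite_Iic (((N + N + B' + B, N + N + B'), (N + B', N)), N + B')).subset
      fun q hq => ?_
    simp only [Function.mem_support, G] at hq
    split_ifs at hq with h
    · have h1 : q.1.1.2 - q.2 < N ∧ q.1.2.2 < N := by
        by_contra hc
        exact hq (by rw [hN _ _ (by omega), mul_zero, mul_zero, smul_zero])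
      have h2 := hB _ _ h.1.1
      have h3 := hB' _ _ h.1.2
      refine ⟨⟨⟨?_, ?_⟩, ⟨?_, ?_⟩⟩, ?_⟩ <;> simp <;> omega
    · exact absurd rfl hq
  have h1 : ∀ x : ℕ × ℕ, (if u + x.1 = a + x.2 then
      cre C x.1 * ann A C x.2 (polyMode A u' b D f) else 0) = ∑ᶠ y, ∑ᶠ i, G ((x, y), i) := by
    intro x
    split_ifs with hx
    · have hf : (Function.support fun y : ℕ × ℕ => if u' + y.1 = b + y.2 then
          cre D y.1 * ann A D y.2 f else 0).Finite := by
        simpa using polyTerm_finite A u' b 1 D D f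
      have := ((LinearMap.mulLeft ℂ (cre C x.1)) ∘ₗ ann A C x.2).toAddMonoidHom.map_finsum hf
      simp only [LinearMap.toAddMonoidHom_coe, LinearMap.comp_apply, LinearMap.mulLeft_apply]
        at this
      rw [polyMode, this]
      refine finsum_congr fun y => ?_
      by_cases hy : u' + y.1 = b + y.2
      · rw [if_pos hy, ann_cre_mul, finsum_eq_sum_of_support_subset (s := range (x.2 + 1)), mul_sum]
        · refine sum_congr rfl fun i hi => ?_
          have hi' := mem_range.1 hi
          simp only [G, hx, hy, true_and, show i ≤ x.2 by omega]
          split_ifs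
          · rw [mul_smul_comm]
          · rw [mul_zero]
        · intro i hi
          simp only [Function.mem_support, G] at hi
          split_ifs at hi with h
          · have := h.2.1
            simp at this ⊢; omega
          · exact absurd rfl hi
      · simp [hy, G]
    · simp [hx, G]
  have h2 : ∑ᶠ x, ∑ᶠ y, ∑ᶠ i, G ((x, y), i) = ∑ᶠ q, G q := by
    rw [finsum_curry G hG, finsum_curry (fun p => ∑ᶠ i, G (p, i))]
    refine (hG.image Prod.fst).subset fun p hp => ?_
    rw [Function.mem_support] at hp
    obtain ⟨i, hi⟩ := exists_ne_zero_of_finsum_ne_zero hp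
    exact ⟨(p, i), hi, rfl⟩
  -- Reindexing by the degrees that survive contraction. The degree i is added back to the
  -- annihilation index of the left factor and to the creation index of the right one, which shifts
  -- the exponents to a + i and b - i.
  let e : ℕ × ((ℕ × ℕ) × (ℕ × ℕ)) → ((ℕ × ℕ) × (ℕ × ℕ)) × ℕ :=
    fun z => (((z.2.1.1, z.2.1.2 + z.1), (z.2.2.1 + z.1, z.2.2.2)), z.1)
  have he : Function.Injective e := by
    rintro ⟨i, ⟨x1, x2⟩, ⟨y1, y2⟩⟩ ⟨i', ⟨x1', x2'⟩, ⟨y1', y2'⟩⟩ h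
    simp only [e, Prod.mk.injEq] at h ⊢
    omega
  have her : Function.support G ⊆ Set.range e := by
    rintro ⟨⟨⟨x1, x2⟩, ⟨y1, y2⟩⟩, i⟩ hq
    simp only [Function.mem_support, G] at hq
    split_ifs at hq with h
    · refine ⟨(i, ((x1, x2 - i), (y1 - i, y2))), ?_⟩
      have := h.2
      simp only [e, Prod.mk.injEq, true_and, and_true] at this ⊢
      omega
    · exact absurd rfl hq
  have hGe : ∀ z, G (e z) =
      φ z.1 • polyNormalTerm A u (a + z.1) u' (b - z.1) C D f z.2 := by
    rintro ⟨i, ⟨x1, x2⟩, ⟨y1, y2⟩⟩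
    have e1 : u + x1 = a + ((x2 + i : ℕ) : ℂ) ↔ u + x1 = a + i + x2 := by
      push_cast
      constructor <;> intro h <;> linear_combination h
    have e2 : u' + ((y1 + i : ℕ) : ℂ) = b + y2 ↔ u' + y1 = b - i + y2 := by
      push_cast
      constructor <;> intro h <;> linear_combination h
    simp only [G, e, e1, e2, polyNormalTerm, Nat.add_sub_cancel, Nat.le_add_left, and_self,
      and_true, smul_ite, smul_zero]
  have h3 : ∑ᶠ z, G (e z) = ∑ᶠ i, φ i •
      ∑ᶠ x, polyNormalTerm A u (a + i) u' (b - i) C D f x := by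
    rw [finsum_curry (fun z => G (e z)) (hG.preimage he.injOn)]
    refine finsum_congr fun i => ?_
    simp only [hGe]
    rw [smul_finsum]
  calc _ = ∑ᶠ x, ∑ᶠ y, ∑ᶠ i, G ((x, y), i) := finsum_congr h1
    _ = ∑ᶠ z, G (e z) := by rw [h2, finsum_comp_of_support_subset_range e he G her]
    _ = _ := h3

variable (V W : VertexOp L)

lemma polyNormal_shift_finite (u a u' b : ℂ) (C D : Fin L → ℤ → ℂ) (f : Osc L) :
    (Function.support fun n : ℕ =>
      ∑ᶠ x, polyNormalTerm A u (a + n) u' (b - n) C D f x).Finite := by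
  obtain ⟨N, hN⟩ := exists_ann_ann_eq_zero A C D f
  obtain ⟨B, hB⟩ := exists_bound u' b
  refine (Set.finite_Iic (N + B)).subset fun n hn => ?_
  rw [Function.mem_support] at hn
  obtain ⟨x, hx⟩ := exists_ne_zero_of_finsum_ne_zero hn
  rw [polyNormalTerm] at hx
  split_ifs at hx with h
  · have h1 : x.1.2 < N ∧ x.2.2 < N := by
      by_contra hc
      exact hx (by rw [hN _ _ (by omega), mul_zero, mul_zero])
    have h2 := hB (x.2.1 + n) x.2.2 (by push_cast; linear_combination h.2)
    simp only [Set.mem_Iic]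
    omega
  · exact absurd rfl hx

lemma normalMode_shift_finite (a b : ℂ) (v : Fock L) :
    (Function.support fun n : ℕ => normalMode A V W (a + n) (b - n) v).Finite := by
  induction v using Finsupp.induction_linear with
  | zero => simp [normalMode_zero]
  | add f g hf hg =>
    simp only [normalMode_add]
    exact (hf.union hg).subset (Function.support_add _ _)
  | single k f =>
    simp only [normalMode_single]
    refine (polyNormal_shift_finite A (V.wt k) a (W.wt k) b V.coef W.coef f).subset
      fun x hx => ?_
    rw [Function.mem_support] at hx ⊢
    exact fun h => hx (by rw [h, smul_zero, Finsupp.single_zero])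

/-- The scalar produced by moving `e^{∑ mom_j a_j(0)}` of `V` through the charge of `W`. -/
def opeConst : ℂ := Complex.exp (∑ j, V.mom j * ∑ i, A 0 j i * (W.charge i : ℂ))

/-- The contraction `φ_{V,W}`. -/
def ope : PowerSeries ℂ := opeConst A V W • expSeries (contractExp A V.coef W.coef)

lemma shiftMom_shiftMom (m n : Fin L → ℤ) (k : Fin L → ℂ) :
    shiftMom A m (shiftMom A n k) = shiftMom A (m + n) k := by
  ext i
  simp only [shiftMom, Pi.add_apply, Int.cast_add, mul_add, sum_add_distrib]
  ring

lemma momExp_shiftMom (k : Fin L → ℂ) :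
    V.momExp (shiftMom A W.charge k) = V.momExp k * opeConst A V W := by
  simp only [momExp, shiftMom, opeConst, mul_add, sum_add_distrib, Complex.exp_add]

/-- The hypothesis says that the power of z in V does not feel the charge of W. Otherwise the weight
of V would be shifted, and the product would carry an extra power of z outside ℂ[[w/z]]. -/
theorem hasOPE_ope (h : ∑ j, V.pow j * ∑ i, A 0 j i * (W.charge i : ℂ) = 0) :
    V.HasOPE A W (ope A V W) := by
  intro a b v
  induction v using Finsupp.induction_linear with
  | zero => simp [mode_zero, normalMode_zero]
  | add f g hf hg =>
    simp only [mode_add, normalMode_add, hf, hg, smul_add]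
    rw [finsum_add_distrib]
    · exact finite_support_smul _ (normalMode_shift_finite A V W a b f)
    · exact finite_support_smul _ (normalMode_shift_finite A V W a b g)
  | single k f =>
    have hwt : V.wt (shiftMom A W.charge k) = V.wt k := by
      simp only [wt, shiftMom, mul_add, sum_add_distrib, h, add_zero]
    obtain ⟨S, hS⟩ : ∃ S : ℕ → Osc L, ∀ n : ℕ, ∑ᶠ x, polyNormalTerm A (V.wt k) (a + n) (W.wt k)
      (b - n) V.coef W.coef f x = S n := ⟨_, fun _ => rfl⟩
    have hfin : (Function.support S).Finite := by
      have := polyNormal_shift_finite A (V.wt k) a (W.wt k) b V.coef W.coef f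
      simpa only [hS] using this
    simp only [mode_single, normalMode_single]
    rw [hwt, shiftMom_shiftMom, polyMode_smul, polyMode_polyMode, momExp_shiftMom]
    simp only [hS, smul_finsum, Finsupp.smul_single]
    rw [← Finsupp.singleAddHom_apply, AddMonoidHom.map_finsum]
    · refine finsum_congr fun n => ?_
      rw [Finsupp.singleAddHom_apply]
      congr 1
      rw [smul_smul, smul_smul, smul_smul, ope, map_smul, smul_eq_mul]
      congr 1
      ring
    · simp only [smul_smul]
      exact finite_support_smul _ hfin

end VertexOp

end DeformedW

namespace DeformedW

/-! ### Uniqueness of the contraction, and normal ordered products on the line w = e^{-ℓ} z -/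

open PowerSeries Finset

/-- Summation over the fibres of a map. -/
lemma finsum_fiber {α β M : Type*} [AddCommMonoid M] [DecidableEq β] (π : α → β) {K : α → M}
    (hK : (Function.support K).Finite) :
    ∑ᶠ b, ∑ᶠ a, (if π a = b then K a else 0) = ∑ᶠ a, K a := by
  have hfin : (Function.support fun z : β × α => if π z.2 = z.1 then K z.2 else 0).Finite := by
    refine (hK.image fun a => (π a, a)).subset fun z hz => ?_
    rw [Function.mem_support] at hz
    split_ifs at hz with h
    · exact ⟨z.2, hz, Prod.ext h rfl⟩
    · exact absurd rfl hz
  rw [← finsum_curry (fun z : β × α => if π z.2 = z.1 then K z.2 else 0) hfin]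
  rw [← finsum_comp_of_support_subset_range (fun a => (π a, a))
    (fun a b h => (Prod.mk.inj h).2)]
  · simp
  · intro z hz
    rw [Function.mem_support] at hz
    split_ifs at hz with h
    · exact ⟨z.2, Prod.ext h rfl⟩
    · exact absurd rfl hz

variable {L : ℕ} (A : ℤ → Matrix (Fin L) (Fin L) ℂ)

lemma ann_one (c : Fin L → ℤ → ℂ) (n : ℕ) : ann A c n 1 = if n = 0 then 1 else 0 := by
  simpa using ann_C A c n 1

namespace VertexOp

variable (V W : VertexOp L)

/-- On the vacuum the exponents can only rise. Since they are displaced by opposite amounts, both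
displacements must vanish, so a single coefficient of the contraction survives. -/
lemma finsum_polyNormalTerm_one (u u' : ℂ) (C D : Fin L → ℤ → ℂ) (n n' : ℕ) :
    ∑ᶠ x, polyNormalTerm A u (u - n + n') u' (u' + n - n') C D 1 x =
      if n' = n then 1 else 0 := by
  have h : ∀ x : (ℕ × ℕ) × (ℕ × ℕ), polyNormalTerm A u (u - n + n') u' (u' + n - n') C D 1 x =
      if x = ((0, 0), (0, 0)) ∧ n' = n then 1 else 0 := by
    rintro ⟨⟨x1, x2⟩, ⟨y1, y2⟩⟩
    have e : (u + x1 = u - n + n' + x2 ∧ u' + y1 = u' + n - n' + y2) ↔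
        (x1 + n = n' + x2 ∧ y1 + n' = n + y2) := by
      rw [← Nat.cast_inj (R := ℂ), ← Nat.cast_inj (R := ℂ)]
      push_cast
      constructor <;> rintro ⟨h1, h2⟩ <;>
        exact ⟨by linear_combination h1, by linear_combination h2⟩
    simp only [polyNormalTerm, e, ann_one, Prod.mk.injEq]
    by_cases hy : y2 = 0
    · by_cases hx : x2 = 0
      · by_cases h : x1 + n = n' ∧ y1 + n' = n
        · obtain ⟨h1, h2⟩ := h
          have : x1 = 0 ∧ y1 = 0 ∧ n' = n := by omega
          obtain ⟨rfl, rfl, rfl⟩ := this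
          simp [hx, hy]
        · rw [if_neg (by omega), if_neg (by omega)]
      · simp [hy, hx, ann_one]
    · simp [hy]
  simp only [h]
  split_ifs with hn
  · rw [finsum_eq_single _ ((0, 0), (0, 0))]
    · simp [hn]
    · intro x hx; simp [hx]
  · simp [hn]

/-- The n-th coefficient is read off from the vacuum, at the exponents displaced by -n and +n from
the lowest weights. -/
lemma HasOPE.unique {V W : VertexOp L} {φ ψ : PowerSeries ℂ} (h1 : V.HasOPE A W φ)
    (h2 : V.HasOPE A W ψ) : φ = ψ := by
  ext n
  have h := (h1 (V.wt 0 - n) (W.wt 0 + n) (Finsupp.single 0 1)).symm.trans (h2 _ _ _)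
  simp only [normalMode_single, finsum_polyNormalTerm_one] at h
  rw [finsum_eq_single _ n, finsum_eq_single _ n] at h
  · have hne : (Finsupp.single (shiftMom A (V.charge + W.charge) 0)
        ((V.momExp 0 * W.momExp 0) • (1 : Osc L))) ≠ 0 := by
      rw [Ne, Finsupp.single_eq_zero]
      simp [momExp_ne_zero]
    simpa using smul_left_injective ℂ hne (by simpa using h)
  · intro m hm; simp [hm]
  · intro m hm; simp [hm]

theorem hasOPE_iff (h : ∑ j, V.pow j * ∑ i, A 0 j i * (W.charge i : ℂ) = 0)
    (φ : PowerSeries ℂ) : V.HasOPE A W φ ↔ φ = ope A V W :=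
  ⟨fun hφ => hφ.unique A (hasOPE_ope A V W h), fun hφ => hφ ▸ hasOPE_ope A V W h⟩

/-- The vertex operator `:V(z) W(e^{-ℓ} z):`, up to the factor `e^{-ℓ W.pre}`. -/
def merge (ℓ : ℂ) : VertexOp L where
  pre := V.pre + W.pre
  charge := V.charge + W.charge
  mom := fun j => V.mom j + W.mom j - ℓ * W.pow j
  pow := V.pow + W.pow
  coef := twist ℓ V.coef W.coef

lemma wt_merge (ℓ : ℂ) (k : Fin L → ℂ) : (merge V W ℓ).wt k = V.wt k + W.wt k := by
  simp only [wt, merge, Pi.add_apply, add_mul, sum_add_distrib]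
  ring

/-- Putting w = e^{-ℓ} z in w^{∑ pow_j a_j(0)} leaves the exponential of -ℓ ∑ pow_j a_j(0), which is
absorbed in `mom`; the scalar prefactor w^{pre} leaves the constant standing in front. -/
lemma momExp_merge (ℓ : ℂ) (k : Fin L → ℂ) :
    Complex.exp (-(ℓ * W.pre)) * (merge V W ℓ).momExp k =
      V.momExp k * W.momExp k * Complex.exp (-(ℓ * W.wt k)) := by
  simp only [momExp, merge, wt, ← Complex.exp_add]
  congr 1
  simp only [sub_mul, add_mul, sum_sub_distrib, sum_add_distrib, mul_add, mul_sum, mul_assoc]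
  ring

/-- The summands of a mode of the merged operator, regrouped. -/
def mergeTerm (ℓ u u' c : ℂ) (C D : Fin L → ℤ → ℂ) (f : Osc L) (x : (ℕ × ℕ) × (ℕ × ℕ)) : Osc L :=
  if u + u' + ((x.1.1 + x.2.1 : ℕ) : ℂ) = c + ((x.1.2 + x.2.2 : ℕ) : ℂ) then
    Complex.exp (-(ℓ * (x.2.1 - x.2.2))) •
      (cre C x.1.1 * (cre D x.2.1 * ann A C x.1.2 (ann A D x.2.2 f))) else 0

lemma mergeTerm_finite (ℓ u u' c : ℂ) (C D : Fin L → ℤ → ℂ) (f : Osc L) :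
    (Function.support (mergeTerm A ℓ u u' c C D f)).Finite := by
  obtain ⟨N, hN⟩ := exists_ann_ann_eq_zero A C D f
  obtain ⟨B, hB⟩ := exists_bound (u + u') c
  refine (Set.finite_Iic ((N + N + B, N), (N + N + B, N))).subset fun x hx => ?_
  rw [Function.mem_support, mergeTerm] at hx
  split_ifs at hx with h
  · have h1 : x.1.2 < N ∧ x.2.2 < N := by
      by_contra hc
      exact hx (by rw [hN _ _ (by omega), mul_zero, mul_zero, smul_zero])
    have h2 := hB _ _ h
    exact ⟨⟨by simp; omega, by simp; omega⟩, ⟨by simp; omega, by simp; omega⟩⟩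
  · exact absurd rfl hx

lemma polyMode_twist (ℓ u u' c : ℂ) (C D : Fin L → ℤ → ℂ) (f : Osc L) :
    polyMode A (u + u') c (twist ℓ C D) f = ∑ᶠ x, mergeTerm A ℓ u u' c C D f x := by
  let e : (ℕ × ℕ) × (ℕ × ℕ) ≃ (ℕ × ℕ) × (ℕ × ℕ) := Equiv.prodProdProdComm ℕ ℕ ℕ ℕ
  rw [← finsum_comp_equiv e, ← finsum_fiber
    (fun z : (ℕ × ℕ) × (ℕ × ℕ) => (z.1.1 + z.1.2, z.2.1 + z.2.2))
    ((mergeTerm_finite A ℓ u u' c C D f).preimage e.injective.injOn), polyMode]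
  refine finsum_congr fun y => ?_
  rw [finsum_eq_sum_of_support_subset (s := antidiagonal y.1 ×ˢ antidiagonal y.2)]
  · split_ifs with h
    · rw [cre_twist, ann_twist, sum_mul_sum, sum_product]
      refine sum_congr rfl fun p hp => sum_congr rfl fun r hr => ?_
      have hp := HasAntidiagonal.mem_antidiagonal.1 hp
      have hr := HasAntidiagonal.mem_antidiagonal.1 hr
      rw [if_pos (by rw [hp, hr])]
      simp only [mergeTerm, e, Equiv.prodProdProdComm_apply]
      rw [if_pos (by rw [hp, hr, h]), smul_mul_smul_comm, ← Complex.exp_add, mul_assoc]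
      congr 2
      ring
    · refine (sum_eq_zero fun z hz => ?_).symm
      simp only [mem_product, HasAntidiagonal.mem_antidiagonal] at hz
      simp only [mergeTerm, e, Equiv.prodProdProdComm_apply, hz, h, if_false, ite_self]
  · intro z hz
    rw [Function.mem_support] at hz
    split_ifs at hz with h
    · simp [← h]
    · exact absurd rfl hz

/-- The exponent c - a of w equals u' plus the creation degree minus the annihilation degree of the
second operator. Thus the factor e^{-(c-a)ℓ} splits into a constant and the factor inside
`mergeTerm`. -/
lemma normal_fiber (ℓ u u' c a : ℂ) (C D : Fin L → ℤ → ℂ) (f : Osc L) :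
    Complex.exp (-(c - a) * ℓ) • ∑ᶠ x, polyNormalTerm A u a u' (c - a) C D f x =
      ∑ᶠ x : (ℕ × ℕ) × (ℕ × ℕ), if u + x.1.1 - x.1.2 = a then
        Complex.exp (-(ℓ * u')) • mergeTerm A ℓ u u' c C D f x else 0 := by
  rw [smul_finsum]
  refine finsum_congr fun x => ?_
  by_cases ha : u + x.1.1 - x.1.2 = a
  · rw [if_pos ha]
    subst ha
    have e : (u + x.1.1 = u + x.1.1 - x.1.2 + x.1.2 ∧
        u' + x.2.1 = c - (u + x.1.1 - x.1.2) + x.2.2) ↔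
        u + u' + ((x.1.1 + x.2.1 : ℕ) : ℂ) = c + ((x.1.2 + x.2.2 : ℕ) : ℂ) := by
      push_cast
      constructor
      · rintro ⟨-, h⟩; linear_combination h
      · intro h; exact ⟨by ring, by linear_combination h⟩
    simp only [polyNormalTerm, mergeTerm, e]
    split_ifs with h
    · rw [smul_smul, ← Complex.exp_add]
      congr 2
      push_cast at h
      linear_combination ℓ * h
    · simp
  · rw [if_neg ha, polyNormalTerm, if_neg, smul_zero]
    rintro ⟨h, -⟩
    exact ha (by linear_combination h)

lemma normalMode_fiber_finite (c : ℂ) (v : Fock L) :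
    (Function.support fun a : ℂ => normalMode A V W a (c - a) v).Finite := by
  induction v using Finsupp.induction_linear with
  | zero => simp [normalMode_zero]
  | add f g hf hg =>
    simp only [normalMode_add]
    exact (hf.union hg).subset (Function.support_add _ _)
  | single k f =>
    simp only [normalMode_single]
    refine ((mergeTerm_finite A 0 (V.wt k) (W.wt k) c V.coef W.coef f).image
      fun x => V.wt k + x.1.1 - x.1.2).subset fun a ha => ?_
    rw [Function.mem_support] at ha
    have h := normal_fiber A 0 (V.wt k) (W.wt k) c a V.coef W.coef f
    rw [mul_zero, Complex.exp_zero, one_smul] at h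
    rw [h] at ha
    obtain ⟨x, hx⟩ := exists_ne_zero_of_finsum_ne_zero fun h0 => ha (by rw [h0]; simp)
    split_ifs at hx with h
    · refine ⟨x, fun h0 => hx (by rw [h0, smul_zero]), h⟩
    · exact absurd rfl hx

/-- Grouping the terms of the merged operator by the exponent that comes from V gives the sum over
a. This turns the currents and the residues at the poles into modes of a single vertex operator. -/
theorem finsum_normalMode_eq_merge (ℓ c : ℂ) (v : Fock L) :
    ∑ᶠ a : ℂ, Complex.exp (-(c - a) * ℓ) • normalMode A V W a (c - a) v =
      Complex.exp (-(ℓ * W.pre)) • (merge V W ℓ).mode A c v := by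
  induction v using Finsupp.induction_linear with
  | zero => simp [mode_zero, normalMode_zero]
  | add f g hf hg =>
    simp only [mode_add, normalMode_add, smul_add, ← hf, ← hg]
    exact finsum_add_distrib (finite_support_smul _ (normalMode_fiber_finite A V W c f))
      (finite_support_smul _ (normalMode_fiber_finite A V W c g))
  | single k f =>
    simp only [mode_single, normalMode_single, Finsupp.smul_single, wt_merge]
    rw [smul_smul, momExp_merge, ← smul_smul]
    rw [show (merge V W ℓ).coef = twist ℓ V.coef W.coef from rfl, polyMode_twist,
      show (merge V W ℓ).charge = V.charge + W.charge from rfl]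
    rw [smul_finsum, ← finsum_fiber (fun x : (ℕ × ℕ) × (ℕ × ℕ) => V.wt k + x.1.1 - x.1.2)
      (finite_support_smul _ (mergeTerm_finite A ℓ (V.wt k) (W.wt k) c V.coef W.coef f))]
    simp only [← normal_fiber]
    rw [smul_finsum, ← Finsupp.singleAddHom_apply, AddMonoidHom.map_finsum]
    · refine finsum_congr fun a => ?_
      rw [Finsupp.singleAddHom_apply, smul_comm]
    · refine finite_support_smul _ (finite_support_smul _ ?_)
      refine (normalMode_fiber_finite A V W c (Finsupp.single k f)).subset fun a ha => ?_
      rw [Function.mem_support] at ha ⊢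
      rw [normalMode_single, Ne, Finsupp.single_eq_zero]
      exact smul_ne_zero (mul_ne_zero (momExp_ne_zero _ _) (momExp_ne_zero _ _)) ha

/-! ### Vertex operators are determined by their modes -/

lemma polyMode_vacuum (u : ℂ) (C : Fin L → ℤ → ℂ) (n : ℕ) :
    polyMode A u (u + n) C 1 = cre C n := by
  rw [polyMode, finsum_eq_single _ (n, 0)]
  · simp
  · rintro ⟨a, b⟩ hx
    rw [ann_one]
    split_ifs with h1 h2
    · have h2' : b = 0 := h2
      subst h2'
      have : a = n := by simpa using h1
      exact absurd (by rw [this]) hx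
    · simp
    · rfl

lemma polyMode_X (u : ℂ) (C : Fin L → ℤ → ℂ) (l : Fin L) (n : ℕ) (hn : n ≠ 0) :
    polyMode A u (u - n) C (MvPolynomial.X (l, n.toPNat')) =
      MvPolynomial.C (tau A C n l) := by
  have hn' : ((n.toPNat' : ℕ+) : ℕ) = n := by simp [Nat.toPNat'_coe, Nat.pos_of_ne_zero hn]
  rw [polyMode, finsum_eq_single _ (0, n)]
  · rw [ann_X, if_pos (by push_cast; ring), if_neg hn, if_pos hn'.symm]
    simp
  · rintro ⟨a, b⟩ hx
    rw [ann_X, hn']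
    by_cases h1 : u + (a : ℂ) = u - n + b
    · have : a + n = b := by
        rw [← Nat.cast_inj (R := ℂ)]
        push_cast
        linear_combination h1
      have hb : b ≠ 0 := by omega
      have hbn : b ≠ n := by
        rintro rfl
        exact hx (by rw [Prod.mk.injEq]; omega)
      simp [hb, hbn]
    · rw [if_neg h1]

lemma cre_injective {C D : Fin L → ℤ → ℂ} (h : ∀ n, cre C n = cre D n) (j : Fin L) {m : ℕ}
    (hm : m ≠ 0) : C j (-(m : ℤ)) = D j (-(m : ℤ)) := by
  have h1 : creExp C = creExp D :=
    expSeries_injective (coeff_zero_creExp C) (coeff_zero_creExp D) (by ext1 n; exact h n)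
  have h2 := congrArg (MvPolynomial.coeff (Finsupp.single (j, m.toPNat') 1))
    (congrArg (coeff m) h1)
  simpa [creExp, hm, MvPolynomial.coeff_sum, MvPolynomial.coeff_X, Finsupp.single_left_inj]
    using h2

lemma eq_zero_of_mode_eq_zero {s : ℂ} (h : ∀ c v, s • V.mode A c v = 0) : s = 0 := by
  have := h (V.wt 0 + (0 : ℕ)) (Finsupp.single 0 1)
  rw [mode_single, polyMode_vacuum, cre_zero, Finsupp.smul_single, Finsupp.single_eq_zero,
    smul_smul, smul_eq_zero] at this
  simpa [momExp_ne_zero] using this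

/-- Lowest modes on the vacuum compare scalars and momenta; creation coefficients are seen on the
vacuum, annihilation coefficients on single oscillators. -/
theorem eq_of_mode_eq {V W : VertexOp L} (hA : ∀ m : ℤ, 0 < m → (A m).det ≠ 0)
    (hpre : V.pre = W.pre) (hch : V.charge = W.charge) (hpow : V.pow = W.pow) {s t : ℂ}
    (hs : s ≠ 0) (h : ∀ c v, s • V.mode A c v = t • W.mode A c v) :
    s = t ∧ V.mom = W.mom ∧ ∀ j m, m ≠ 0 → V.coef j m = W.coef j m := by
  have hwt : ∀ k, V.wt k = W.wt k := fun k => by simp only [wt, hpre, hpow]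
  have h1 : ∀ k f c, (s * V.momExp k) • polyMode A (V.wt k) c V.coef f =
      (t * W.momExp k) • polyMode A (V.wt k) c W.coef f := by
    intro k f c
    have := h c (Finsupp.single k f)
    rw [mode_single, mode_single, hch, Finsupp.smul_single, Finsupp.smul_single, smul_smul,
      smul_smul, ← hwt] at this
    exact Finsupp.single_injective _ this
  have h2 : ∀ k, s * V.momExp k = t * W.momExp k := by
    intro k
    have := h1 k 1 (V.wt k + (0 : ℕ))
    rw [polyMode_vacuum, polyMode_vacuum, cre_zero, cre_zero] at this
    exact smul_left_injective ℂ one_ne_zero this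
  have hst : s = t := by simpa [momExp] using h2 0
  have h3 : ∀ k f c, polyMode A (V.wt k) c V.coef f = polyMode A (V.wt k) c W.coef f := by
    intro k f c
    have := h1 k f c
    rw [← h2] at this
    exact smul_right_injective _ (mul_ne_zero hs (momExp_ne_zero _ _)) this
  refine ⟨hst, ?_, ?_⟩
  · ext j
    by_contra hne
    -- At this momentum the two zero mode exponentials would differ by the factor e, which is not 1.
    have h4 := h2 (Pi.single j (V.mom j - W.mom j)⁻¹)
    rw [← hst] at h4
    have h5 := mul_left_cancel₀ hs h4
    simp only [momExp, Pi.single_apply, mul_ite, mul_zero, sum_ite_eq', mem_univ, if_true] at h5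
    have h6 : Complex.exp 1 = 1 := by
      have h8 := congrArg (fun x => x / Complex.exp (W.mom j * (V.mom j - W.mom j)⁻¹)) h5
      simp only [div_self (Complex.exp_ne_zero _)] at h8
      rwa [← Complex.exp_sub, ← sub_mul, mul_inv_cancel₀ (sub_ne_zero.2 hne)] at h8
    have h7 : Real.exp 1 = 1 := by
      rw [← Complex.ofReal_inj, Complex.ofReal_exp, Complex.ofReal_one, h6]
    simp at h7
  · intro j m hm
    rcases lt_or_gt_of_ne hm with hm' | hm'
    · obtain ⟨n, rfl⟩ := Int.exists_eq_neg_ofNat hm'.le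
      refine cre_injective (fun n => ?_) j (by simpa using hm)
      rw [← polyMode_vacuum A (V.wt 0), h3, polyMode_vacuum]
    · obtain ⟨n, rfl⟩ := Int.eq_ofNat_of_zero_le hm'.le
      have hn : n ≠ 0 := by simpa using hm
      have h4 : ∀ l, tau A V.coef n l = tau A W.coef n l := by
        intro l
        have := h3 0 (MvPolynomial.X (l, n.toPNat')) (V.wt 0 - n)
        rw [polyMode_X _ _ _ _ _ hn, polyMode_X _ _ _ _ _ hn] at this
        exact MvPolynomial.C_injective _ _ this
      -- Annihilation coefficients are visible only after multiplication by A(n), so its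
      -- invertibility is needed to recover them.
      have h5 : Matrix.vecMul (fun j => V.coef j n - W.coef j n) (A n) = 0 := by
        ext l
        have := h4 l
        simp only [tau] at this
        have := mul_left_cancel₀ (inv_ne_zero (Nat.cast_ne_zero.2 hn)) this
        simp only [Matrix.vecMul, dotProduct, sub_mul, sum_sub_distrib, Pi.zero_apply]
        rw [this, sub_self]
      have h6 := Matrix.eq_zero_of_vecMul_eq_zero (hA _ hm') h5
      exact sub_eq_zero.1 (congrFun h6 j)

end VertexOp

end DeformedW

namespace DeformedW

open PowerSeries Finset

/-! ### Convergence of contractions to rational functions -/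

/-- At z = 1 both series are Taylor expansions at 0 of the same function of w. -/
lemma ConvergesTo.unique {φ ψ : PowerSeries ℂ} {F : ℂ → ℂ → ℂ} (hφ : ConvergesTo φ F)
    (hψ : ConvergesTo ψ F) : φ = ψ := by
  obtain ⟨R, hR, h1⟩ := hφ
  obtain ⟨R', hR', h2⟩ := hψ
  have key : ∀ (χ : PowerSeries ℂ) (r : ℝ), 0 < r → (∀ z w : ℂ, z ≠ 0 → ‖w‖ < r * ‖z‖ →
      HasSum (fun n : ℕ => coeff n χ * (w / z) ^ n) (F z w)) →
      HasFPowerSeriesAt (F 1) (FormalMultilinearSeries.ofScalars ℂ fun n => coeff n χ) 0 := by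
    intro χ r hr h
    rw [hasFPowerSeriesAt_iff]
    filter_upwards [Metric.ball_mem_nhds (0 : ℂ) hr] with w hw
    have := h 1 w one_ne_zero (by simpa using hw)
    simpa [mul_comm] using this
  have := (key φ R hR h1).eq_formalMultilinearSeries (key ψ R' hR' h2)
  ext n
  have := congrArg (fun p : FormalMultilinearSeries ℂ ℂ ℂ => p.coeff n) this
  simpa using this

/-- The series `exp (∑ (q^m - p^m) u^m / m) = (1 - p u) / (1 - q u)`. -/
def geomExp (p q : ℂ) : PowerSeries ℂ :=
  PowerSeries.mk fun m : ℕ => if m = 0 then 0 else (q ^ m - p ^ m) / m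

lemma convergesTo_geomExp (κ p q : ℂ) (hq : q ≠ 0) (F : ℂ → ℂ → ℂ)
    (hF : ∀ z w, z ≠ 0 → 1 - q * (w / z) ≠ 0 →
      F z w = κ * ((1 - p * (w / z)) / (1 - q * (w / z)))) :
    ConvergesTo (κ • expSeries (geomExp p q)) F := by
  refine ⟨‖q‖⁻¹, by positivity, fun z w hz hw => ?_⟩
  obtain ⟨u, hu⟩ : ∃ u, u = w / z := ⟨_, rfl⟩
  rw [← hu]
  have hu1 : ‖q * u‖ < 1 := by
    have hz' : 0 < ‖z‖ := norm_pos_iff.2 hz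
    have hq' : 0 < ‖q‖ := norm_pos_iff.2 hq
    rw [hu, norm_mul, norm_div, ← mul_div_assoc, div_lt_one hz']
    calc ‖q‖ * ‖w‖ < ‖q‖ * (‖q‖⁻¹ * ‖z‖) := by gcongr
      _ = ‖z‖ := by field_simp
  have hne : 1 - q * u ≠ 0 := by
    intro h
    have : q * u = 1 := by linear_combination -h
    rw [this] at hu1
    simp at hu1
  rw [hF z w hz (hu ▸ hne), ← hu]
  have h1 := ((hasSum_geometric_of_norm_lt_one hu1).mul_left ((q - p) * u))
  have h2 : HasSum (fun n : ℕ => coeff (n + 1) (expSeries (geomExp p q)) * u ^ (n + 1))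
      ((q - p) * u * (1 - q * u)⁻¹) := by
    refine h1.congr_fun fun n => ?_
    rw [geomExp, coeff_expSeries_geom, if_neg n.succ_ne_zero, Nat.add_sub_cancel]
    ring
  have h3 := ((hasSum_nat_add_iff
    (f := fun n : ℕ => coeff n (expSeries (geomExp p q)) * u ^ n) 1).1 h2).mul_left κ
  rw [range_one, sum_singleton, coeff_zero_expSeries, pow_zero, mul_one] at h3
  have h4 : κ * ((1 - p * u) / (1 - q * u)) = κ * ((q - p) * u * (1 - q * u)⁻¹ + 1) := by
    rw [← div_eq_mul_inv, div_add_one hne]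
    congr 2
    ring
  rw [h4]
  refine h3.congr_fun fun n => ?_
  rw [map_smul, smul_eq_mul, mul_assoc]

variable {L : ℕ} (A : ℤ → Matrix (Fin L) (Fin L) ℂ)

namespace VertexOp

variable (V W : VertexOp L)

/-! ### Commutators of vertex operators -/

lemma ann_comm (C D : Fin L → ℤ → ℂ) (m n : ℕ) (f : Osc L) :
    ann A C m (ann A D n f) = ann A D n (ann A C m f) := by
  have h1 : ∀ a b, Commute (coeff a (annExp A C)) (coeff b (expSeries (annExp A D))) :=
    fun a b => commute_coeff_expSeries (fun c => commute_annExp A C D a c) b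
  have h2 : Commute (ann A D n) (ann A C m) :=
    commute_coeff_expSeries (fun a => (h1 a n).symm) m
  exact (congrArg (fun T : Module.End ℂ (Osc L) => T f) h2.eq).symm

lemma normalMode_comm (a b : ℂ) (v : Fock L) :
    normalMode A V W a b v = normalMode A W V b a v := by
  induction v using Finsupp.induction_linear with
  | zero => simp [normalMode_zero]
  | add f g hf hg => simp only [normalMode_add, hf, hg]
  | single k f =>
    rw [normalMode_single, normalMode_single, add_comm V.charge, mul_comm (V.momExp k),
      ← finsum_comp_equiv (Equiv.prodComm (ℕ × ℕ) (ℕ × ℕ))]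
    congr 2
    refine finsum_congr fun x => ?_
    simp only [polyNormalTerm, Equiv.prodComm_apply, Prod.fst_swap, Prod.snd_swap]
    rw [ann_comm, mul_left_comm]
    exact if_congr and_comm rfl rfl

/-- Without prefactor and power of z, the operator V contributes only integer exponents. -/
lemma normalMode_eq_zero (hpre : V.pre = 0) (hpow : V.pow = 0) {a b : ℂ}
    (ha : ∀ n : ℤ, a ≠ n) (v : Fock L) : normalMode A V W a b v = 0 := by
  induction v using Finsupp.induction_linear with
  | zero => simp [normalMode_zero]
  | add f g hf hg => simp only [normalMode_add, hf, hg, add_zero]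
  | single k f =>
    rw [normalMode_single, finsum_eq_zero_of_forall_eq_zero, smul_zero, Finsupp.single_zero]
    intro x
    rw [polyNormalTerm, if_neg]
    rintro ⟨h, -⟩
    refine ha ((x.1.1 : ℤ) - x.1.2) ?_
    have : V.wt k = 0 := by simp [wt, hpre, hpow]
    rw [this] at h
    push_cast
    linear_combination -h

/-- The commutator of two vertex operators whose contractions are expansions of
`κ (1 - p w/z) / (1 - q w/z)` and `(1 - p⁻¹ z/w) / (1 - q⁻¹ z/w)`, `κ = q / p`. -/
theorem commutator_eq (hpre : V.pre = 0) (hpow : V.pow = 0) {p q ℓ : ℂ} (hp : p ≠ 0)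
    (hℓ : Complex.exp ℓ = q) (hVW : V.HasOPE A W ((q / p) • expSeries (geomExp p q)))
    (hWV : W.HasOPE A V (expSeries (geomExp p⁻¹ q⁻¹))) (n : ℤ) (b : ℂ) (v : Fock L) :
    V.mode A n (W.mode A b v) - W.mode A b (V.mode A n v) =
      ((q / p - 1) * Complex.exp (b * ℓ) * Complex.exp (-(ℓ * W.pre))) •
        (merge V W ℓ).mode A (b + n) v := by
  have hq : q ≠ 0 := by rw [← hℓ]; exact Complex.exp_ne_zero _
  -- All terms of both products are multiples of these: the order VW uses k ≥ 0 and the order WV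
  -- uses k ≤ 0.
  let K : ℤ → Fock L := fun k => normalMode A V W (n + k) (b - k) v
  have hK : (Function.support K).Finite := by
    have := normalMode_fiber_finite A V W (b + n) v
    refine (this.preimage (f := fun k : ℤ => ((n : ℂ) + k))
      (fun x _ y _ h => by simpa using h)).subset fun k hk => ?_
    simp only [Set.mem_preimage, Function.mem_support, K] at hk ⊢
    rwa [show b + n - (n + k) = b - (k : ℂ) by ring]
  have hexp : ∀ k : ℤ, Complex.exp (k * ℓ) = q ^ k := fun k => by rw [Complex.exp_int_mul, hℓ]
  have h1 : V.mode A n (W.mode A b v) = ∑ᶠ k : ℤ,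
      (if 0 ≤ k then (q / p) * coeff k.toNat (expSeries (geomExp p q)) else 0) • K k := by
    rw [hVW, ← finsum_comp_of_support_subset_range (fun m : ℕ => (m : ℤ)) Nat.cast_injective]
    · simp [K]
    · intro k hk
      rw [Function.mem_support] at hk
      split_ifs at hk with h
      · exact ⟨k.toNat, by simp [h]⟩
      · simp at hk
  have h2 : W.mode A b (V.mode A n v) = ∑ᶠ k : ℤ,
      (if k ≤ 0 then coeff (-k).toNat (expSeries (geomExp p⁻¹ q⁻¹)) else 0) • K k := by
    rw [hWV, ← finsum_comp_of_support_subset_range (fun m : ℕ => -(m : ℤ))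
      (fun x y h => by simpa using h)]
    · refine finsum_congr fun m => ?_
      rw [normalMode_comm]
      simp [K, sub_eq_add_neg]
    · intro k hk
      rw [Function.mem_support] at hk
      split_ifs at hk with h
      · exact ⟨(-k).toNat, by simp [h]⟩
      · simp at hk
  have h3 : ∑ᶠ a : ℂ, Complex.exp (-(b + n - a) * ℓ) • normalMode A V W a (b + n - a) v =
      ∑ᶠ k : ℤ, (Complex.exp (-(b * ℓ)) * q ^ k) • K k := by
    rw [← finsum_comp_of_support_subset_range (fun k : ℤ => ((n : ℂ) + k))
      (fun x y h => by simpa using h)]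
    · refine finsum_congr fun k => ?_
      rw [← hexp, ← Complex.exp_add]
      simp only [K]
      rw [show b + n - (n + k) = b - (k : ℂ) by ring]
      congr 2
      ring
    · intro a ha
      rw [Function.mem_support] at ha
      by_contra hc
      refine ha ?_
      rw [normalMode_eq_zero A V W hpre hpow, smul_zero]
      intro m hm
      exact hc ⟨m - n, by simp [hm]⟩
  rw [mul_smul, ← finsum_normalMode_eq_merge, h3, h1, h2, smul_finsum,
    ← finsum_sub_distrib (finite_support_smul _ hK) (finite_support_smul _ hK)]
  refine finsum_congr fun k => ?_
  rw [← sub_smul, smul_smul]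
  congr 1
  have h4 : Complex.exp (b * ℓ) * Complex.exp (-(b * ℓ)) = 1 := by
    rw [← Complex.exp_add, add_neg_cancel, Complex.exp_zero]
  rw [show (q / p - 1) * Complex.exp (b * ℓ) * (Complex.exp (-(b * ℓ)) * q ^ k) =
    (q / p - 1) * q ^ k * (Complex.exp (b * ℓ) * Complex.exp (-(b * ℓ))) by ring, h4, mul_one]
  simp only [geomExp, coeff_expSeries_geom]
  -- For k > 0 only the first product contributes, for k < 0 only the second, for k = 0 both. In
  -- every case the coefficient is (q/p - 1) q^k, so the difference is a delta function at z = q w.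
  rcases lt_trichotomy k 0 with hk | rfl | hk
  · obtain ⟨m, rfl⟩ := Int.exists_eq_neg_ofNat hk.le
    have hm : m ≠ 0 := by rintro rfl; simp at hk
    obtain ⟨m, rfl⟩ := Nat.exists_eq_succ_of_ne_zero hm
    rw [if_neg (by omega), if_pos hk.le, neg_neg, Int.toNat_natCast, if_neg hm, zpow_neg,
      zpow_natCast, Nat.succ_sub_one, Nat.succ_eq_add_one, inv_pow, pow_succ]
    have hqm : q ^ m ≠ 0 := pow_ne_zero _ hq
    generalize q ^ m = t at hqm ⊢
    field_simp
    ring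
  · simp
  · obtain ⟨m, rfl⟩ := Int.eq_ofNat_of_zero_le hk.le
    have hm : m ≠ 0 := by rintro rfl; simp at hk
    obtain ⟨m, rfl⟩ := Nat.exists_eq_succ_of_ne_zero hm
    simp only [hk.le, hk.not_ge, if_true, if_false, Int.toNat_natCast, hm, zpow_natCast,
      Nat.succ_sub_one, Nat.succ_eq_add_one]
    field_simp
    ring

end VertexOp

end DeformedW

namespace DeformedW

/-! ### Separation of poles and comparison of exponentials -/

open PowerSeries Finset

/-- By linearity powers may be replaced by any polynomial, and one that vanishes at all the other
nodes isolates a single term. With nodes q_{i,j} this separates delta functions supported at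
different poles. -/
lemma eq_zero_of_sum_pow_smul {ι M : Type*} [Fintype ι] [AddCommGroup M] [Module ℂ M]
    {z : ι → ℂ} (hz : Function.Injective z) {X : ι → M}
    (h : ∀ n : ℕ, ∑ i, z i ^ n • X i = 0) (i : ι) : X i = 0 := by
  classical
  have hP : ∀ P : Polynomial ℂ, ∑ i, P.eval (z i) • X i = 0 := by
    intro P
    induction P using Polynomial.induction_on' with
    | add p q hp hq => simp only [Polynomial.eval_add, add_smul, sum_add_distrib, hp, hq, add_zero]
    | monomial n a =>
      simp only [Polynomial.eval_monomial, mul_smul]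
      rw [← smul_sum, h, smul_zero]
  have := hP (∏ k ∈ univ.erase i, (Polynomial.X - Polynomial.C (z k)))
  rw [sum_eq_single i] at this
  · refine (smul_eq_zero.1 this).resolve_left ?_
    rw [Polynomial.eval_prod, ← ne_eq, prod_ne_zero_iff]
    intro k hk
    simpa [sub_eq_zero] using fun h => (mem_erase.1 hk).1 (hz h).symm
  · intro k _ hk
    rw [Polynomial.eval_prod, prod_eq_zero (mem_erase.2 ⟨hk, mem_univ k⟩) (by simp), zero_smul]
  · simp

lemma smul_expSeries_eq_iff {κ κ' : ℂ} (hκ : κ ≠ 0) {f g : PowerSeries ℂ} (hf : coeff 0 f = 0)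
    (hg : coeff 0 g = 0) : κ • expSeries f = κ' • expSeries g ↔ κ = κ' ∧ f = g := by
  refine ⟨fun h => ?_, fun ⟨h1, h2⟩ => by rw [h1, h2]⟩
  have h0 : κ = κ' := by
    simpa only [map_smul, coeff_zero_expSeries, smul_eq_mul, mul_one] using congrArg (coeff 0) h
  refine ⟨h0, expSeries_injective hf hg ?_⟩
  rw [← h0] at h
  exact smul_right_injective _ hκ h

namespace Params

variable {L : ℕ} (P : Params L)

/-! ### The three conditions as equations between parameters -/

/-- Mutual locality as equations between parameters. -/
structure LocalityEq : Prop where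
  zero : ∀ i j, Complex.exp (∑ k, P.lam i k 0 * P.A 0 k j) = P.q i j / P.p i j
  ne_zero : ∀ i j (m : ℤ), m ≠ 0 →
    (∑ k, P.lam i k m * P.A m k j) * P.s j (-m) = P.q i j ^ m - P.p i j ^ m

/-- The exponents `s_k(m) A_{k,l}(m) s_l(-m)` of the contraction of `S̃_k` and `S̃_l`. -/
def sig (k l : Fin L) (m : ℤ) : ℂ := P.s k m * P.A m k l * P.s l (-m)

/-- The symmetry conditions as equations between parameters. -/
structure SymmetryEq : Prop where
  symm : ∀ k l (m : ℤ), m ≠ 0 → P.sig k l m = P.sig l k m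
  far : ∀ k l : Fin L, 2 ≤ |(k : ℤ) - (l : ℤ)| → ∀ m : ℤ, m ≠ 0 → P.sig k l m = 0

/-- The matching of the two residues in the commutator of `T_1` and `S_j`. -/
structure MatchEq (lg : ℂ → ℂ) (j : Fin L) : Prop where
  scalar : P.g j.castSucc * (P.q j.castSucc j / P.p j.castSucc j - 1) =
    -(P.g j.succ * (P.q j.succ j / P.p j.succ j - 1)) *
      Complex.exp (-(lg (P.q j.succ j / P.q j.castSucc j) * (P.A 0 j j / 2)))
  zero : ∀ k, P.lam j.succ k 0 =
    P.lam j.castSucc k 0 + if k = j then lg (P.q j.succ j / P.q j.castSucc j) else 0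
  ne_zero : ∀ k (m : ℤ), m ≠ 0 → P.lam j.castSucc k m =
    P.lam j.succ k m + if k = j then P.s j m * (P.q j.succ j ^ m - P.q j.castSucc j ^ m) else 0

variable {P}

lemma opeConst_Lam_S (i : Fin (L + 1)) (j : Fin L) : VertexOp.opeConst P.A (P.Lam i) (P.S j) =
    Complex.exp (∑ k, P.lam i k 0 * P.A 0 k j) := by
  simp [VertexOp.opeConst, Lam, S, Pi.single_apply]

lemma contract_Lam_S (i : Fin (L + 1)) (j : Fin L) (m : ℕ) :
    contract P.A (P.Lam i).coef (P.S j).coef m =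
      (m : ℂ)⁻¹ * ((∑ k, P.lam i k m * P.A m k j) * P.s j (-(m : ℤ))) := by
  simp [contract, tau, Lam, S, mul_assoc]

lemma contract_S_Lam (i : Fin (L + 1)) (j : Fin L) (m : ℕ) :
    contract P.A (P.S j).coef (P.Lam i).coef m =
      (m : ℂ)⁻¹ * ((∑ k, P.lam i k (-(m : ℤ)) * P.A m j k) * P.s j m) := by
  simp only [contract, tau, Lam, S, ite_mul, zero_mul, sum_ite_eq', mem_univ, if_true, mul_sum,
    sum_mul]
  exact sum_congr rfl fun k _ => by ring

lemma contract_Stilde (k l : Fin L) (m : ℕ) :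
    contract P.A (P.Stilde k).coef (P.Stilde l).coef m = (m : ℂ)⁻¹ * P.sig k l m := by
  simp [contract, tau, Stilde, S, sig, mul_assoc]

lemma contractExp_eq_iff {c d : Fin L → ℤ → ℂ} {A : ℤ → Matrix (Fin L) (Fin L) ℂ} (f : ℕ → ℂ) :
    contractExp A c d = PowerSeries.mk (fun m => if m = 0 then 0 else f m / m) ↔
      ∀ m : ℕ, m ≠ 0 → m * contract A c d m = f m := by
  rw [PowerSeries.ext_iff]
  refine forall_congr' fun m => ?_
  by_cases hm : m = 0
  · simp [contractExp, hm]
  · have : (m : ℂ) ≠ 0 := Nat.cast_ne_zero.2 hm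
    simp only [contractExp, coeff_mk, hm, if_false, ne_eq, not_false_eq_true, true_implies]
    rw [eq_div_iff this, mul_comm]

lemma hasOPE_Lam_S_iff {i : Fin (L + 1)} {j : Fin L} :
    (P.Lam i).HasOPE P.A (P.S j)
      ((P.q i j / P.p i j) • expSeries (geomExp (P.p i j) (P.q i j))) ↔
    Complex.exp (∑ k, P.lam i k 0 * P.A 0 k j) = P.q i j / P.p i j ∧
    ∀ m : ℕ, m ≠ 0 → (∑ k, P.lam i k m * P.A m k j) * P.s j (-(m : ℤ)) =
      P.q i j ^ m - P.p i j ^ m := by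
  rw [VertexOp.hasOPE_iff _ _ _ (by simp [Lam]), VertexOp.ope, eq_comm, smul_expSeries_eq_iff
    (by rw [VertexOp.opeConst]; exact Complex.exp_ne_zero _) (by simp [contractExp])
    (by simp [geomExp]), opeConst_Lam_S, geomExp, contractExp_eq_iff]
  refine and_congr_right fun _ => forall₂_congr fun m hm => ?_
  rw [contract_Lam_S, mul_inv_cancel_left₀ (Nat.cast_ne_zero.2 hm)]

lemma hasOPE_S_Lam_iff {i : Fin (L + 1)} {j : Fin L} :
    (P.S j).HasOPE P.A (P.Lam i) (expSeries (geomExp (P.p i j)⁻¹ (P.q i j)⁻¹)) ↔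
    ∀ m : ℕ, m ≠ 0 → (∑ k, P.lam i k (-(m : ℤ)) * P.A m j k) * P.s j m =
      (P.q i j)⁻¹ ^ m - (P.p i j)⁻¹ ^ m := by
  rw [VertexOp.hasOPE_iff _ _ _ (by simp [Lam]), VertexOp.ope, eq_comm,
    ← one_smul ℂ (expSeries (geomExp _ _)), smul_expSeries_eq_iff
    (by rw [VertexOp.opeConst]; exact Complex.exp_ne_zero _) (by simp [contractExp])
    (by simp [geomExp]), geomExp, contractExp_eq_iff]
  rw [and_iff_right (by simp [VertexOp.opeConst, S])]
  refine forall₂_congr fun m hm => ?_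
  rw [contract_S_Lam, mul_inv_cancel_left₀ (Nat.cast_ne_zero.2 hm)]

/-- For |z| ≫ |w| the leading terms are -z/p and -z/q, hence the factor q/p; in the other region
both leading terms are w and no factor appears. -/
lemma convergesTo_Lam_S {p q : ℂ} (hp : p ≠ 0) (hq : q ≠ 0) :
    ConvergesTo ((q / p) • expSeries (geomExp p q)) (fun z w => (w - z / p) / (w - z / q)) := by
  refine convergesTo_geomExp _ _ _ hq _ fun z w hz h => ?_
  have h1 : z - q * w ≠ 0 := by
    intro h'
    apply h
    field_simp
    linear_combination h'
  have h2 : w - z / q ≠ 0 := by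
    intro h'
    apply h1
    field_simp at h'
    linear_combination -h'
  field_simp
  have h3 : w * q - z ≠ 0 := by intro h'; apply h1; linear_combination -h'
  rw [div_eq_div_iff h3 (by rwa [mul_comm])]
  ring

lemma convergesTo_S_Lam {p q : ℂ} (hp : p ≠ 0) (hq : q ≠ 0) :
    ConvergesTo (expSeries (geomExp p⁻¹ q⁻¹)) (fun w z => (w - z / p) / (w - z / q)) := by
  rw [← one_smul ℂ (expSeries _)]
  refine convergesTo_geomExp _ _ _ (inv_ne_zero hq) _ fun z w hz h => ?_
  have h1 : z - w / q ≠ 0 := by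
    intro h'
    apply h
    field_simp at h' ⊢
    linear_combination h'
  have h3 : q * z - w ≠ 0 := by
    intro h'
    apply h1
    field_simp
    linear_combination h'
  field_simp

/-- Mutual locality, with the contractions written out. -/
lemma mutualLocality_iff_hasOPE (hp : ∀ i j, P.p i j ≠ 0) (hq : ∀ i j, P.q i j ≠ 0) :
    P.MutualLocality ↔ ∀ i j,
      (P.Lam i).HasOPE P.A (P.S j)
        ((P.q i j / P.p i j) • expSeries (geomExp (P.p i j) (P.q i j))) ∧
      (P.S j).HasOPE P.A (P.Lam i) (expSeries (geomExp (P.p i j)⁻¹ (P.q i j)⁻¹)) := by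
  refine forall₂_congr fun i j => ⟨?_, fun h => ⟨_, _, h.1, h.2,
    convergesTo_Lam_S (hp i j) (hq i j), convergesTo_S_Lam (hp i j) (hq i j)⟩⟩
  rintro ⟨φ, ψ, h1, h2, h3, h4⟩
  rw [← h3.unique (convergesTo_Lam_S (hp i j) (hq i j)),
    ← h4.unique (convergesTo_S_Lam (hp i j) (hq i j))]
  exact ⟨h1, h2⟩

/-- The order ΛS yields the equations for m > 0 and the order SΛ those for m < 0; the relation
A_{i,j}(m) = A_{j,i}(-m) brings both to one form. -/
theorem mutualLocality_iff (hA : ∀ m : ℤ, m ≠ 0 → ∀ i j, P.A m i j = P.A (-m) j i)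
    (hp : ∀ i j, P.p i j ≠ 0) (hq : ∀ i j, P.q i j ≠ 0) :
    P.MutualLocality ↔ P.LocalityEq := by
  rw [mutualLocality_iff_hasOPE hp hq]
  simp only [hasOPE_Lam_S_iff, hasOPE_S_Lam_iff]
  constructor
  · refine fun h => ⟨fun i j => (h i j).1.1, fun i j m hm => ?_⟩
    rcases lt_or_gt_of_ne hm with hm' | hm'
    · obtain ⟨n, rfl⟩ := Int.exists_eq_neg_ofNat hm'.le
      have hn : n ≠ 0 := by simpa using hm
      have := (h i j).2 n hn
      simp only [hA n (by simpa using hn) j] at this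
      rw [neg_neg, this]
      simp
    · obtain ⟨n, rfl⟩ := Int.eq_ofNat_of_zero_le hm'.le
      simpa using (h i j).1.2 n (by simpa using hm)
  · refine fun h i j => ⟨⟨h.zero i j, fun m hm => ?_⟩, fun m hm => ?_⟩
    · simpa using h.ne_zero i j m (by simpa using hm)
    · have := h.ne_zero i j (-m) (by simpa using hm)
      simp only [hA m (by simpa using hm) j]
      rw [neg_neg] at this
      rw [this]
      simp

lemma hasOPE_Stilde_iff (k l : Fin L) (φ : PowerSeries ℂ) :
    (P.Stilde k).HasOPE P.A (P.Stilde l) φ ↔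
      φ = expSeries (contractExp P.A (P.Stilde k).coef (P.Stilde l).coef) := by
  rw [VertexOp.hasOPE_iff _ _ _ (by simp [Stilde]), VertexOp.ope, VertexOp.opeConst]
  simp [Stilde]

/-- Contractions only involve m > 0. The equations for m < 0 follow since `sig k l (-m)` is `sig l k
m`. -/
theorem symmetry_iff (hA : ∀ m : ℤ, m ≠ 0 → ∀ i j, P.A m i j = P.A (-m) j i) :
    P.Symmetry ↔ P.SymmetryEq := by
  have hneg : ∀ k l (m : ℤ), m ≠ 0 → P.sig k l (-m) = P.sig l k m := by
    intro k l m hm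
    rw [sig, sig, hA m hm, neg_neg]
    ring
  have h0 : ∀ k l : Fin L, coeff 0 (contractExp P.A (P.Stilde k).coef (P.Stilde l).coef) = 0 := by
    simp [contractExp]
  have h1 : ∀ k l, (∃ φ : PowerSeries ℂ, (P.Stilde k).HasOPE P.A (P.Stilde l) φ ∧
      (P.Stilde l).HasOPE P.A (P.Stilde k) φ) ↔ ∀ m : ℤ, m ≠ 0 → P.sig k l m = P.sig l k m := by
    intro k l
    simp only [hasOPE_Stilde_iff, exists_eq_left]
    have e : expSeries (contractExp P.A (P.Stilde k).coef (P.Stilde l).coef) =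
        expSeries (contractExp P.A (P.Stilde l).coef (P.Stilde k).coef) ↔
        ∀ m : ℕ, m ≠ 0 → P.sig k l m = P.sig l k m := by
      rw [← one_smul ℂ (expSeries (contractExp P.A (P.Stilde k).coef _)),
        ← one_smul ℂ (expSeries (contractExp P.A (P.Stilde l).coef _)),
        smul_expSeries_eq_iff one_ne_zero (h0 k l) (h0 l k), and_iff_right rfl, PowerSeries.ext_iff]
      refine forall_congr' fun m => ?_
      by_cases hm : m = 0
      · simp [contractExp, hm]
      · simp [contractExp, hm, contract_Stilde]
    rw [e]
    refine ⟨fun h m hm => ?_, fun h m hm => h m (by simpa using hm)⟩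
    rcases lt_or_gt_of_ne hm with hm' | hm'
    · obtain ⟨n, rfl⟩ := Int.exists_eq_neg_ofNat hm'.le
      have hn : n ≠ 0 := by simpa using hm
      rw [hneg _ _ _ (by simpa using hn), hneg _ _ _ (by simpa using hn), h n hn]
    · obtain ⟨n, rfl⟩ := Int.eq_ofNat_of_zero_le hm'.le
      exact h n (by simpa using hm)
  have h2 : ∀ k l, (P.Stilde k).HasOPE P.A (P.Stilde l) 1 ↔
      ∀ m : ℕ, m ≠ 0 → P.sig k l m = 0 := by
    intro k l
    have h3 : (1 : PowerSeries ℂ) = expSeries 0 := by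
      ext n
      rcases n with _ | n
      · simp
      · rw [coeff_expSeries (by simp) (Nat.lt_succ_self _), sum_range_succ']
        simp [coeff_one]
    rw [hasOPE_Stilde_iff, h3, ← one_smul ℂ (expSeries 0),
      ← one_smul ℂ (expSeries (contractExp _ _ _)), smul_expSeries_eq_iff one_ne_zero
        (by simp) (h0 k l), and_iff_right rfl, PowerSeries.ext_iff]
    refine forall_congr' fun m => ?_
    by_cases hm : m = 0
    · simp [contractExp, hm]
    · simp [contractExp, hm, contract_Stilde, eq_comm]
  simp only [Symmetry, h1, h2]
  constructor
  · rintro ⟨hs, hf⟩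
    refine ⟨hs, fun k l hkl m hm => ?_⟩
    rcases lt_or_gt_of_ne hm with hm' | hm'
    · obtain ⟨n, rfl⟩ := Int.exists_eq_neg_ofNat hm'.le
      have hn : n ≠ 0 := by simpa using hm
      rw [hneg _ _ _ (by simpa using hn), hf l k (by rwa [abs_sub_comm]) n hn]
    · obtain ⟨n, rfl⟩ := Int.eq_ofNat_of_zero_le hm'.le
      exact hf k l hkl n (by simpa using hm)
  · rintro ⟨hs, hf⟩
    exact ⟨hs, fun k l hkl m hm => hf k l hkl m (by simpa using hm)⟩

end Params

end DeformedW

namespace DeformedW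

/-! ### The commutator of T_1 and S_j as a sum over poles -/

open PowerSeries Finset

namespace Params

variable {L : ℕ} {P : Params L}

/-- `Λ_i(z) S_j(e^{-ℓ} z)`, normally ordered, up to a scalar factor. -/
abbrev fused (P : Params L) (i : Fin (L + 1)) (j : Fin L) (ℓ : ℂ) : VertexOp L :=
  VertexOp.merge (P.Lam i) (P.S j) ℓ

lemma current_eq (lg : ℂ → ℂ) (j : Fin L) (c : ℂ) (v : Fock L) :
    P.current lg j c v = (P.g j.castSucc * (P.q j.castSucc j / P.p j.castSucc j - 1) *
      Complex.exp (-(lg (P.q j.castSucc j) * (P.A 0 j j / 2)))) •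
      (P.fused j.castSucc j (lg (P.q j.castSucc j))).mode P.A c v := by
  rw [current, VertexOp.finsum_normalMode_eq_merge, smul_smul]
  rfl

/-- The commutator of `T_1` and `S_j` as a sum over the poles. -/
lemma commutator_T_S (hp : ∀ i j, P.p i j ≠ 0) (hq : ∀ i j, P.q i j ≠ 0)
    (hloc : P.MutualLocality) (j : Fin L) {ℓ : Fin (L + 1) → ℂ}
    (hℓ : ∀ i, Complex.exp (ℓ i) = P.q i j) (n : ℤ) (b : ℂ) (v : Fock L) :
    P.T n ((P.S j).mode P.A b v) - (P.S j).mode P.A b (P.T n v) =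
      ∑ i, (Complex.exp (b * ℓ i) * (P.g i * (P.q i j / P.p i j - 1) *
        Complex.exp (-(ℓ i * (P.A 0 j j / 2))))) • (P.fused i j (ℓ i)).mode P.A (b + n) v := by
  have hadd : ∀ (s : Finset (Fin (L + 1))) (F : Fin (L + 1) → Fock L),
      (P.S j).mode P.A b (∑ i ∈ s, F i) = ∑ i ∈ s, (P.S j).mode P.A b (F i) := by
    intro s F
    classical
    induction s using Finset.induction_on with
    | empty => simp [VertexOp.mode_zero]
    | insert a s ha ih => rw [sum_insert ha, sum_insert ha, VertexOp.mode_add, ih]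
  simp only [T, hadd, VertexOp.mode_smul]
  rw [← sum_sub_distrib]
  refine sum_congr rfl fun i _ => ?_
  have h := (mutualLocality_iff_hasOPE hp hq).1 hloc i j
  rw [← smul_sub, VertexOp.commutator_eq P.A (P.Lam i) (P.S j) rfl rfl (hp i j) (hℓ i) h.1 h.2,
    smul_smul]
  congr 1
  simp only [S]
  ring

/-- Logarithms of the `q_{i,j}` compatible with the powers used in the commutativity condition. -/
def poleLog (P : Params L) (lg : ℂ → ℂ) (j : Fin L) (i : Fin (L + 1)) : ℂ :=
  if i = j.castSucc then lg (P.q j.castSucc j)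
  else if i = j.succ then
    lg (P.q j.castSucc j) + lg (P.q j.succ j / P.q j.castSucc j)
  else Complex.log (P.q i j)

lemma exp_poleLog (hq : ∀ i j, P.q i j ≠ 0) {lg : ℂ → ℂ}
    (hlg : ∀ u : ℂ, u ≠ 0 → Complex.exp (lg u) = u) (j : Fin L) (i : Fin (L + 1)) :
    Complex.exp (P.poleLog lg j i) = P.q i j := by
  unfold poleLog
  split_ifs with h1 h2
  · rw [hlg _ (hq _ _), h1]
  · rw [Complex.exp_add, hlg _ (hq _ _), hlg _ (div_ne_zero (hq _ _) (hq _ _)), h2,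
      mul_div_cancel₀ _ (hq _ _)]
  · exact Complex.exp_log (hq _ _)

lemma poleLog_castSucc (lg : ℂ → ℂ) (j : Fin L) :
    P.poleLog lg j j.castSucc = lg (P.q j.castSucc j) := by simp [poleLog]

lemma succ_ne_castSucc (j : Fin L) : j.succ ≠ j.castSucc := by
  intro h; simpa using congrArg Fin.val h

lemma poleLog_succ (lg : ℂ → ℂ) (j : Fin L) :
    P.poleLog lg j j.succ =
      lg (P.q j.castSucc j) + lg (P.q j.succ j / P.q j.castSucc j) := by
  simp [poleLog, succ_ne_castSucc]

lemma fused_coef (i : Fin (L + 1)) (j k : Fin L) (ℓ : ℂ) (m : ℤ) :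
    (P.fused i j ℓ).coef k m =
      P.lam i k m + if k = j then P.s j m * Complex.exp ℓ ^ m else 0 := by
  simp only [fused, VertexOp.merge, twist, Lam, S, ← Complex.exp_int_mul]
  split_ifs <;> ring

lemma fused_mom (i : Fin (L + 1)) (j k : Fin L) (ℓ : ℂ) :
    (P.fused i j ℓ).mom k = P.lam i k 0 - if k = j then ℓ else 0 := by
  simp [fused, VertexOp.merge, Lam, S, Pi.single_apply]

/-- Degree 0 is skipped in the exponents, so `coef` at 0 is irrelevant; zero modes are carried by
`mom`. -/
lemma mode_congr_coef {V W : VertexOp L} (A : ℤ → Matrix (Fin L) (Fin L) ℂ)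
    (hpre : V.pre = W.pre) (hch : V.charge = W.charge) (hpow : V.pow = W.pow)
    (hmom : V.mom = W.mom) (hcoef : ∀ k m, m ≠ 0 → V.coef k m = W.coef k m) (c : ℂ) (v : Fock L) :
    V.mode A c v = W.mode A c v := by
  have h1 : V.creation A = W.creation A := by
    refine congrArg expSeries (PowerSeries.ext fun m => ?_)
    simp only [coeff_mk]
    split_ifs with hm
    · rfl
    · exact sum_congr rfl fun j _ => by rw [hcoef j _ (by simpa using hm)]
  have h2 : V.annihilation A = W.annihilation A := by
    refine congrArg expSeries (PowerSeries.ext fun m => ?_)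
    simp only [coeff_mk]
    split_ifs with hm
    · rfl
    · exact sum_congr rfl fun j _ => by rw [hcoef j _ (by simpa using hm)]
  have h3 : V.zeroMode = W.zeroMode := by
    unfold VertexOp.zeroMode
    rw [hpre, hpow, hmom]
  simp only [VertexOp.mode, h1, h2, h3, hch]

lemma fused_congr (i i' : Fin (L + 1)) (j : Fin L) (ℓ ℓ' : ℂ) :
    (P.fused i j ℓ).pre = (P.fused i' j ℓ').pre ∧
    (P.fused i j ℓ).charge = (P.fused i' j ℓ').charge ∧
    (P.fused i j ℓ).pow = (P.fused i' j ℓ').pow := by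
  simp [fused, VertexOp.merge, Lam]

lemma MatchEq.mode_eq (hq : ∀ i j, P.q i j ≠ 0) {lg : ℂ → ℂ}
    (hlg : ∀ u : ℂ, u ≠ 0 → Complex.exp (lg u) = u) {j : Fin L} (h : P.MatchEq lg j)
    (c : ℂ) (v : Fock L) :
    (P.fused j.castSucc j (P.poleLog lg j j.castSucc)).mode P.A c v =
      (P.fused j.succ j (P.poleLog lg j j.succ)).mode P.A c v := by
  obtain ⟨h1, h2, h3⟩ := fused_congr (P := P) j.castSucc j.succ j
    (P.poleLog lg j j.castSucc) (P.poleLog lg j j.succ)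
  refine mode_congr_coef P.A h1 h2 h3 ?_ ?_ c v
  · ext k
    rw [fused_mom, fused_mom, h.zero, poleLog_castSucc, poleLog_succ]
    split_ifs <;> ring
  · intro k m hm
    rw [fused_coef, fused_coef, h.ne_zero k m hm, exp_poleLog hq hlg, exp_poleLog hq hlg]
    split_ifs <;> ring

/-- Poles with p = q have residue 0. At the two remaining poles `MatchEq` gives the same fused
operator with opposite scalars, that is, a difference of delta functions. -/
theorem commutativity_of_matchEq (hp : ∀ i j, P.p i j ≠ 0) (hq : ∀ i j, P.q i j ≠ 0) {lg : ℂ → ℂ}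
    (hlg : ∀ u : ℂ, u ≠ 0 → Complex.exp (lg u) = u) (hloc : P.MutualLocality)
    (hother : ∀ i j, i ≠ j.castSucc → i ≠ j.succ → P.p i j = P.q i j)
    (hm : ∀ j, P.MatchEq lg j) : P.Commutativity lg (P.current lg) := by
  intro j n b v
  rw [commutator_T_S hp hq hloc j (exp_poleLog hq hlg j),
    ← sum_subset (subset_univ {j.castSucc, j.succ}), sum_pair (succ_ne_castSucc j).symm]
  · rw [← (hm j).mode_eq hq hlg, poleLog_castSucc, poleLog_succ, deltaCoeff, deltaCoeff, current_eq]
    simp only [smul_smul, ← add_smul, ← sub_smul]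
    congr 1
    rw [(hm j).scalar, add_mul, neg_add, mul_add, Complex.exp_add, Complex.exp_add]
    ring
  · intro i _ hi
    simp only [mem_insert, mem_singleton, not_or] at hi
    rw [hother i j hi.1 hi.2, div_self (hq i j)]
    simp

/-- The consequences of the commutativity condition. -/
theorem matchEq_of_commutativity (hA : ∀ m : ℤ, 0 < m → (P.A m).det ≠ 0)
    (hp : ∀ i j, P.p i j ≠ 0) (hq : ∀ i j, P.q i j ≠ 0) {lg : ℂ → ℂ}
    (hlg : ∀ u : ℂ, u ≠ 0 → Complex.exp (lg u) = u) (hg : ∀ i, P.g i ≠ 0)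
    (hloc : P.MutualLocality) (hqinj : ∀ j : Fin L, Function.Injective fun i => P.q i j)
    {B : Fin L → ℂ → Fock L → Fock L} (hB : P.Commutativity lg B) :
    (∀ j c v, B j c v = P.current lg j c v) ∧
    (∀ i j, i ≠ j.castSucc → i ≠ j.succ → P.p i j = P.q i j) ∧
    ∀ j : Fin L, (P.p j.castSucc j ≠ P.q j.castSucc j ∨ P.p j.succ j ≠ P.q j.succ j) →
      P.p j.castSucc j ≠ P.q j.castSucc j ∧ P.p j.succ j ≠ P.q j.succ j ∧ P.MatchEq lg j := by
  let ℓ := P.poleLog lg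
  have hℓ : ∀ j i, Complex.exp (ℓ j i) = P.q i j := exp_poleLog hq hlg
  let G : Fin L → Fin (L + 1) → ℂ := fun j i => P.g i * (P.q i j / P.p i j - 1) *
    Complex.exp (-(ℓ j i * (P.A 0 j j / 2)))
  have hG0 : ∀ j i, G j i = 0 → P.p i j = P.q i j := by
    intro j i h
    have h1 := (mul_eq_zero.1
      ((mul_eq_zero.1 h).resolve_right (Complex.exp_ne_zero _))).resolve_left (hg i)
    rw [sub_eq_zero, div_eq_one_iff_eq (hp i j)] at h1
    exact h1.symm
  have key : ∀ j c v i, G j i • (P.fused i j (ℓ j i)).mode P.A c v =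
      if i = j.castSucc then B j c v else if i = j.succ then -B j c v else 0 := by
    intro j c v
    have h : ∀ m : ℕ, ∑ i, P.q i j ^ m • (Complex.exp (c * ℓ j i) •
        (G j i • (P.fused i j (ℓ j i)).mode P.A c v -
        if i = j.castSucc then B j c v else if i = j.succ then -B j c v else 0)) = 0 := by
      intro m
      -- The exponents -m and c + m have constant sum c. So the operators stay fixed while m varies,
      -- and only the powers of the q_{i,j} change.
      have h1 := hB j (-(m : ℤ)) (c + m) v
      rw [commutator_T_S hp hq hloc j (hℓ j), deltaCoeff, deltaCoeff, ← poleLog_succ lg,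
        ← poleLog_castSucc lg] at h1
      have e : (c + m : ℂ) + ((-(m : ℤ) : ℤ) : ℂ) = c := by push_cast; ring
      rw [e] at h1
      simp only [smul_sub, sum_sub_distrib, smul_smul]
      rw [sub_eq_zero]
      have e2 : ∀ i, Complex.exp ((c + m) * ℓ j i) =
          P.q i j ^ m * Complex.exp (c * ℓ j i) := by
        intro i
        rw [← hℓ, ← Complex.exp_nat_mul, ← Complex.exp_add]
        congr 1; ring
      rw [← sum_subset (subset_univ {j.castSucc, j.succ}) (f := fun i =>
        (P.q i j ^ m * Complex.exp (c * ℓ j i)) •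
          if i = j.castSucc then B j c v else if i = j.succ then -B j c v else 0),
        sum_pair (succ_ne_castSucc j).symm]
      · simp only [if_true, succ_ne_castSucc, if_false, ← e2, smul_neg, ← sub_eq_add_neg]
        rw [← h1]
        exact sum_congr rfl fun i _ => by rw [e2, mul_assoc]
      · intro i _ hi
        simp only [mem_insert, mem_singleton, not_or] at hi
        simp [hi]
    intro i
    have h2 := eq_zero_of_sum_pow_smul (hqinj j) h i
    exact sub_eq_zero.1 ((smul_eq_zero.1 h2).resolve_left (Complex.exp_ne_zero _))
  refine ⟨fun j c v => ?_, fun i j h1 h2 => ?_, fun j hj => ?_⟩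
  · have := key j c v j.castSucc
    rw [if_pos rfl] at this
    rw [← this, current_eq]
    simp only [G, ℓ, poleLog_castSucc]
  · refine hG0 j i (VertexOp.eq_zero_of_mode_eq_zero P.A (P.fused i j (ℓ j i)) fun c v => ?_)
    rw [key, if_neg h1, if_neg h2]
  · have h1 : ∀ c v, G j j.castSucc • (P.fused j.castSucc j (ℓ j j.castSucc)).mode P.A c v =
        (-G j j.succ) • (P.fused j.succ j (ℓ j j.succ)).mode P.A c v := by
      intro c v
      rw [key, neg_smul, key]
      simp [succ_ne_castSucc]
    -- The two residues are opposite, so if one vanished both would, against the assumption that one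
    -- of the two poles is genuine.
    have hne : G j j.castSucc ≠ 0 := by
      intro h0
      have h2 : G j j.succ = 0 := by
        rw [← neg_eq_zero]
        refine VertexOp.eq_zero_of_mode_eq_zero P.A (P.fused j.succ j (ℓ j j.succ)) fun c v => ?_
        exact (h1 c v).symm.trans (by rw [h0, zero_smul])
      rcases hj with hj | hj
      · exact hj (hG0 _ _ h0)
      · exact hj (hG0 _ _ h2)
    obtain ⟨e1, e2, e3⟩ := fused_congr (P := P) j.castSucc j.succ j
      (ℓ j j.castSucc) (ℓ j j.succ)
    obtain ⟨hs, hmom, hcoef⟩ := VertexOp.eq_of_mode_eq P.A hA e1 e2 e3 hne h1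
    have hG1 : ∀ i, P.p i j = P.q i j → G j i = 0 := by
      intro i h
      simp [G, h, div_self (hq i j)]
    refine ⟨fun h => hne (hG1 _ h), fun h => hne (by rw [hs, hG1 _ h, neg_zero]), ?_, ?_, ?_⟩
    · simp only [G, ℓ, poleLog_castSucc, poleLog_succ] at hs
      rw [add_mul, neg_add, Complex.exp_add] at hs
      refine mul_right_cancel₀ (Complex.exp_ne_zero
        (-(lg (P.q j.castSucc j) * (P.A 0 j j / 2)))) ?_
      rw [hs]
      ring
    · intro k
      have := congrFun hmom k
      rw [fused_mom, fused_mom] at this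
      simp only [ℓ, poleLog_castSucc, poleLog_succ] at this
      split_ifs at this ⊢ <;> linear_combination -this
    · intro k m hm
      have := hcoef k m hm
      rw [fused_coef, fused_coef, hℓ, hℓ] at this
      split_ifs at this ⊢ <;> linear_combination this

end Params

end DeformedW

namespace DeformedW

open Finset

namespace Params

variable {L : ℕ} (P : Params L)

/-! ### Invariance under the changes of parameters -/

/-- The composition of the four changes of parameters. -/
def change (t : ℂ) (α : Fin L → ℤ → ℂ) (ε : Fin L → ℤˣ) (ν : Fin L → ℂ) : Params L :=
  (((P.scaleVar t).scaleBoson α).scaleSign ε).shiftZero ν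

variable {P} {t : ℂ} {α : Fin L → ℤ → ℂ} {ε : Fin L → ℤˣ} {ν : Fin L → ℂ}

/-- A sign as a complex number. -/
abbrev sgn (ε : Fin L → ℤˣ) (j : Fin L) : ℂ := ((ε j : ℤ) : ℂ)

lemma sgn_mul_self (j : Fin L) : sgn ε j * sgn ε j = 1 := by
  rcases Int.units_eq_one_or (ε j) with h | h <;> simp [sgn, h]

lemma sgn_ne_zero (j : Fin L) : sgn ε j ≠ 0 := fun h => by
  simpa [h] using sgn_mul_self (ε := ε) j

lemma sgn_inv (j : Fin L) : (sgn ε j)⁻¹ = sgn ε j :=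
  inv_eq_of_mul_eq_one_left (sgn_mul_self j)

lemma change_A (m : ℤ) (k l : Fin L) :
    (P.change t α ε ν).A m k l = (α k m)⁻¹ * P.A m k l * α l m := rfl

lemma change_A_zero (hα : ∀ j, α j 0 = 1) : (P.change t α ε ν).A 0 = P.A 0 := by
  ext k l
  simp [change_A, hα]

lemma change_A0 (hα : ∀ j, α j 0 = 1) : (P.change t α ε ν).A0 = P.A0 := by
  rw [A0, change_A_zero hα, A0]

lemma change_s (j : Fin L) (m : ℤ) :
    (P.change t α ε ν).s j m = sgn ε j ^ m * (α j m * P.s j m) := rfl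

lemma change_p (i : Fin (L + 1)) (j : Fin L) :
    (P.change t α ε ν).p i j = sgn ε j * (t * P.p i j) := rfl

lemma change_q (i : Fin (L + 1)) (j : Fin L) :
    (P.change t α ε ν).q i j = sgn ε j * (t * P.q i j) := rfl

lemma change_g (i : Fin (L + 1)) : (P.change t α ε ν).g i = P.g i := rfl

lemma change_lam_zero (hα : ∀ j, α j 0 = 1) (i : Fin (L + 1)) (j : Fin L) :
    (P.change t α ε ν).lam i j 0 = P.lam i j 0 + ν j := by
  simp [change, shiftZero, scaleSign, scaleBoson, scaleVar, hα]

lemma change_lam (i : Fin (L + 1)) (j : Fin L) {m : ℤ} (hm : m ≠ 0) :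
    (P.change t α ε ν).lam i j m = t ^ m * P.lam i j m * α j m := by
  simp [change, shiftZero, scaleSign, scaleBoson, scaleVar, hm]

lemma change_q_div (ht : t ≠ 0) (i i' : Fin (L + 1)) (j : Fin L) :
    (P.change t α ε ν).q i j / (P.change t α ε ν).q i' j = P.q i j / P.q i' j := by
  rw [change_q, change_q, mul_div_mul_left _ _ (sgn_ne_zero j), mul_div_mul_left _ _ ht]

lemma change_q_div_p (ht : t ≠ 0) (i : Fin (L + 1)) (j : Fin L) :
    (P.change t α ε ν).q i j / (P.change t α ε ν).p i j = P.q i j / P.p i j := by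
  rw [change_q, change_p, mul_div_mul_left _ _ (sgn_ne_zero j), mul_div_mul_left _ _ ht]

lemma change_p_eq_q (ht : t ≠ 0) (i : Fin (L + 1)) (j : Fin L) :
    (P.change t α ε ν).p i j = (P.change t α ε ν).q i j ↔ P.p i j = P.q i j := by
  rw [change_q, change_p, mul_right_inj' (sgn_ne_zero j), mul_right_inj' ht]

lemma change_A_symm (hα : ∀ j m, α j m ≠ 0 ∧ α j (-m) = (α j m)⁻¹) {m : ℤ} {i j : Fin L} :
    (P.change t α ε ν).A m i j = (P.change t α ε ν).A (-m) j i ↔ P.A m i j = P.A (-m) j i := by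
  have h : (α i m)⁻¹ * α j m ≠ 0 := mul_ne_zero (inv_ne_zero (hα i m).1) (hα j m).1
  rw [change_A, change_A, (hα j m).2, (hα i m).2, inv_inv]
  refine ⟨fun e => mul_left_cancel₀ h ?_, fun e => ?_⟩
  · linear_combination e
  · linear_combination ((α i m)⁻¹ * α j m) * e

lemma change_sum_lam (hα : ∀ j m, α j m ≠ 0 ∧ α j (-m) = (α j m)⁻¹) (i : Fin (L + 1)) (j : Fin L)
    {m : ℤ} (hm : m ≠ 0) :
    (∑ k, (P.change t α ε ν).lam i k m * (P.change t α ε ν).A m k j) *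
      (P.change t α ε ν).s j (-m) =
    (sgn ε j * t) ^ m * ((∑ k, P.lam i k m * P.A m k j) * P.s j (-m)) := by
  simp only [sum_mul, mul_sum]
  refine sum_congr rfl fun k _ => ?_
  rw [change_lam i k hm, change_A, change_s, (hα j m).2, zpow_neg, ← inv_zpow, sgn_inv, mul_zpow]
  have h1 := (hα j m).1
  have h2 := (hα k m).1
  field_simp

/-- For m ≠ 0 both sides scale by (ε_j t)^m. For m = 0 the shift ν changes the exponent by an
element of 2πiℤ. -/
lemma localityEq_change (ht : t ≠ 0) (hα : ∀ j m, α j m ≠ 0 ∧ α j (-m) = (α j m)⁻¹)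
    (hα0 : ∀ j, α j 0 = 1)
    (hν : ∀ j, ∃ n : ℤ, ∑ k, ν k * P.A 0 k j = 2 * Real.pi * Complex.I * n) :
    (P.change t α ε ν).LocalityEq ↔ P.LocalityEq := by
  have h1 : ∀ i j, Complex.exp (∑ k, (P.change t α ε ν).lam i k 0 * (P.change t α ε ν).A 0 k j) =
      Complex.exp (∑ k, P.lam i k 0 * P.A 0 k j) := by
    intro i j
    obtain ⟨n, hn⟩ := hν j
    simp only [change_lam_zero hα0, change_A_zero hα0, add_mul, sum_add_distrib]
    rw [Complex.exp_add, hn, mul_comm _ (n : ℂ), Complex.exp_int_mul_two_pi_mul_I, mul_one]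
  have h2 : ∀ i j (m : ℤ), (P.change t α ε ν).q i j ^ m - (P.change t α ε ν).p i j ^ m =
      (sgn ε j * t) ^ m * (P.q i j ^ m - P.p i j ^ m) := by
    intro i j m
    rw [change_q, change_p, ← mul_assoc, ← mul_assoc, mul_zpow, mul_zpow (sgn ε j * t), mul_sub]
  have h3 : ∀ j (m : ℤ), (sgn ε j * t) ^ m ≠ 0 :=
    fun j m => zpow_ne_zero _ (mul_ne_zero (sgn_ne_zero j) ht)
  constructor
  · rintro ⟨hz, hn⟩
    refine ⟨fun i j => by rw [← h1, hz, change_q_div_p ht], fun i j m hm => ?_⟩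
    have := hn i j m hm
    rw [change_sum_lam hα i j hm, h2] at this
    exact mul_left_cancel₀ (h3 j m) this
  · rintro ⟨hz, hn⟩
    refine ⟨fun i j => by rw [h1, hz, change_q_div_p ht], fun i j m hm => ?_⟩
    rw [change_sum_lam hα i j hm, h2, hn i j m hm]

/-- The rescaling of the free fields cancels, because α(-m) = α(m)⁻¹; only signs survive. -/
lemma sig_change (hα : ∀ j m, α j m ≠ 0 ∧ α j (-m) = (α j m)⁻¹) (k l : Fin L) (m : ℤ) :
    (P.change t α ε ν).sig k l m = (sgn ε k * sgn ε l) ^ m * P.sig k l m := by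
  rw [sig, sig, change_s, change_s, change_A, (hα l m).2, zpow_neg, ← inv_zpow, sgn_inv, mul_zpow]
  have h1 := (hα l m).1
  have h2 := (hα k m).1
  field_simp

lemma symmetryEq_change (hα : ∀ j m, α j m ≠ 0 ∧ α j (-m) = (α j m)⁻¹) :
    (P.change t α ε ν).SymmetryEq ↔ P.SymmetryEq := by
  have h3 : ∀ k l (m : ℤ), (sgn ε k * sgn ε l) ^ m ≠ 0 :=
    fun k l m => zpow_ne_zero _ (mul_ne_zero (sgn_ne_zero k) (sgn_ne_zero l))
  constructor
  · rintro ⟨hs, hf⟩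
    refine ⟨fun k l m hm => ?_, fun k l hkl m hm => ?_⟩
    · have := hs k l m hm
      rw [sig_change hα, sig_change hα, mul_comm (sgn ε l)] at this
      exact mul_left_cancel₀ (h3 k l m) this
    · have := hf k l hkl m hm
      rw [sig_change hα] at this
      exact (mul_eq_zero.1 this).resolve_left (h3 k l m)
  · rintro ⟨hs, hf⟩
    refine ⟨fun k l m hm => ?_, fun k l hkl m hm => ?_⟩
    · rw [sig_change hα, sig_change hα, mul_comm (sgn ε l), hs k l m hm]
    · rw [sig_change hα, hf k l hkl m hm, mul_zero]

lemma matchEq_change (ht : t ≠ 0) (hα : ∀ j m, α j m ≠ 0 ∧ α j (-m) = (α j m)⁻¹)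
    (hα0 : ∀ j, α j 0 = 1) (lg : ℂ → ℂ) (j : Fin L) :
    (P.change t α ε ν).MatchEq lg j ↔ P.MatchEq lg j := by
  have h2 : ∀ k (m : ℤ), m ≠ 0 → ((P.change t α ε ν).lam j.castSucc k m =
      (P.change t α ε ν).lam j.succ k m + (if k = j then (P.change t α ε ν).s j m *
        ((P.change t α ε ν).q j.succ j ^ m - (P.change t α ε ν).q j.castSucc j ^ m) else 0) ↔
      P.lam j.castSucc k m = P.lam j.succ k m +
        if k = j then P.s j m * (P.q j.succ j ^ m - P.q j.castSucc j ^ m) else 0) := by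
    intro k m hm
    have h0 : t ^ m * α k m ≠ 0 := mul_ne_zero (zpow_ne_zero _ ht) (hα k m).1
    rw [change_lam _ _ hm, change_lam _ _ hm]
    have e : (if k = j then (P.change t α ε ν).s j m *
        ((P.change t α ε ν).q j.succ j ^ m - (P.change t α ε ν).q j.castSucc j ^ m) else 0) =
        t ^ m * α k m * if k = j then P.s j m * (P.q j.succ j ^ m - P.q j.castSucc j ^ m)
          else 0 := by
      split_ifs with hk
      -- Both s_j(m) and q^m acquire ε_j^m. Their product is unchanged because ε_j^2 = 1, which is
      -- why only signs are allowed here.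
      · have h3 : sgn ε j ^ m * sgn ε j ^ m = 1 := by
          rw [← mul_zpow, sgn_mul_self, one_zpow]
        rw [change_s, change_q, change_q, mul_zpow, mul_zpow, mul_zpow, mul_zpow, hk]
        linear_combination (α j m * P.s j m * t ^ m *
          (P.q j.succ j ^ m - P.q j.castSucc j ^ m)) * h3
      · simp
    rw [e]
    refine ⟨fun h => mul_left_cancel₀ h0 ?_, fun h => ?_⟩
    · linear_combination h
    · linear_combination (t ^ m * α k m) * h
  constructor
  · rintro ⟨hs, hz, hn⟩
    refine ⟨?_, fun k => ?_, fun k m hm => (h2 k m hm).1 (hn k m hm)⟩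
    · simpa only [change_q_div ht, change_q_div_p ht, change_g, change_A_zero hα0] using hs
    · have := hz k
      rw [change_lam_zero hα0, change_lam_zero hα0, change_q_div ht] at this
      linear_combination this
  · rintro ⟨hs, hz, hn⟩
    refine ⟨?_, fun k => ?_, fun k m hm => (h2 k m hm).2 (hn k m hm)⟩
    · simpa only [change_q_div ht, change_q_div_p ht, change_g, change_A_zero hα0] using hs
    · rw [change_lam_zero hα0, change_lam_zero hα0, change_q_div ht, hz k]
      ring

end Params

end DeformedW

namespace DeformedW

open Finset

/-! ### Powers of `x` -/

/-- `x^a - x^{-a}` for `η = log x`. -/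
def nint (η : ℂ) (a : ℝ) : ℂ := xpow η a - xpow η (-a)

section xpow

variable {η : ℂ}

lemma xpow_add (a b : ℝ) : xpow η (a + b) = xpow η a * xpow η b := by
  simp only [xpow, ← Complex.exp_add]
  push_cast
  ring_nf

lemma xpow_zero : xpow η 0 = 1 := by simp [xpow]

lemma xpow_ne_zero (a : ℝ) : xpow η a ≠ 0 := Complex.exp_ne_zero _

lemma xpow_neg (a : ℝ) : xpow η (-a) = (xpow η a)⁻¹ := by
  simp only [xpow, ← Complex.exp_neg]
  push_cast
  ring_nf

lemma xpow_sub (a b : ℝ) : xpow η (a - b) = xpow η a / xpow η b := by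
  rw [sub_eq_add_neg, xpow_add, xpow_neg, div_eq_mul_inv]

lemma xpow_zpow (a : ℝ) (m : ℤ) : xpow η a ^ m = xpow η (a * m) := by
  simp only [xpow, ← Complex.exp_int_mul]
  push_cast
  ring_nf

lemma norm_xpow (a : ℝ) : ‖xpow η a‖ = Real.exp (a * η.re) := by
  simp [xpow, Complex.norm_exp]

lemma re_ne_zero_of_norm_exp_ne_one (hη : ‖Complex.exp η‖ ≠ 1) : η.re ≠ 0 := fun h => by
  simp [Complex.norm_exp, h] at hη

lemma nint_ne_zero (hη : ‖Complex.exp η‖ ≠ 1) {a : ℝ} (ha : a ≠ 0) : nint η a ≠ 0 := by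
  intro h
  have h1 : ‖xpow η a‖ = ‖xpow η (-a)‖ := by rw [sub_eq_zero.1 h]
  rw [norm_xpow, norm_xpow, Real.exp_eq_exp] at h1
  have := mul_ne_zero ha (re_ne_zero_of_norm_exp_ne_one hη)
  exact this (by linarith)

lemma nint_neg (a : ℝ) : nint η (-a) = -nint η a := by
  simp [nint]

lemma nint_zero : nint η 0 = 0 := by simp [nint]

lemma qint_eq (a : ℝ) : qint η a = nint η a / nint η 1 := rfl

/-- A Ptolemy type identity for hyperbolic sines; it settles the nodes where two different weights
meet. -/
lemma nint_mul_add_mul (a b c : ℝ) :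
    nint η a * nint η c + nint η (a + b + c) * nint η b = nint η (a + b) * nint η (b + c) := by
  simp only [nint, neg_add, xpow_add, xpow_neg]
  have ha := xpow_ne_zero (η := η) a
  have hb := xpow_ne_zero (η := η) b
  have hc := xpow_ne_zero (η := η) c
  field_simp
  ring

lemma xpow_mul_nint (a b : ℝ) : xpow η a * nint η b = xpow η (a + b) - xpow η (a - b) := by
  rw [nint, mul_sub, ← xpow_add, ← xpow_add, sub_eq_add_neg a b]

lemma nint_two_mul (b : ℝ) : nint η (b + b) = nint η b * (xpow η b + xpow η (-b)) := by
  simp only [nint, neg_add, xpow_add, xpow_neg]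
  ring

/-- The sum formula for hyperbolic sines; it settles the nodes where two equal weights meet. -/
lemma nint_add_nint (a b : ℝ) :
    nint η a + nint η (a + b + b) = nint η (a + b) * (xpow η b + xpow η (-b)) := by
  simp only [nint, neg_add, xpow_add, xpow_neg]
  have hb := xpow_ne_zero (η := η) b
  field_simp
  ring

end xpow

/-! ### Tridiagonal systems -/

/-- The unknowns are extended by zero at positions 0 and L + 1, so that the three-term form also
holds in the first and last columns. -/
lemma sum_tridiagonal {L : ℕ} {σ : Fin L → Fin L → ℂ} {F e : ℕ → ℂ} (h0 : F 0 = 0)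
    (hL : F (L + 1) = 0) (hfar : ∀ k l : Fin L, 2 ≤ |(k : ℤ) - (l : ℤ)| → σ k l = 0)
    (hnext : ∀ k l : Fin L, (k : ℕ) + 1 = l → σ k l = e l)
    (hprev : ∀ k l : Fin L, (k : ℕ) + 1 = l → σ l k = e l) (l : Fin L) :
    ∑ k : Fin L, F (k + 1) * σ k l = F l * e l + F (l + 1) * σ l l + F (l + 2) * e (l + 1) := by
  have h : ∀ k : Fin L, F (k + 1) * σ k l = ((if (k : ℕ) + 1 = l then F l * e l else 0) +
      if k = l then F (l + 1) * σ l l else 0) +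
      if (k : ℕ) = l + 1 then F (l + 2) * e (l + 1) else 0 := by
    intro k
    by_cases h1 : (k : ℕ) + 1 = l
    · rw [if_pos h1, if_neg (by rintro rfl; omega), if_neg (by omega), hnext k l h1, h1]
      ring
    by_cases h2 : k = l
    · subst h2
      simp
    by_cases h3 : (k : ℕ) = l + 1
    · rw [if_neg h1, if_neg h2, if_pos h3, hprev l k h3.symm, h3]
      ring
    · have h2' : (k : ℕ) ≠ l := fun h => h2 (Fin.ext h)
      rw [if_neg h1, if_neg h2, if_neg h3, hfar k l (by rw [le_abs]; omega)]
      ring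
  rw [sum_congr rfl fun k _ => h k, sum_add_distrib, sum_add_distrib]
  congr 1
  · congr 1
    · rcases Nat.eq_zero_or_pos (l : ℕ) with hl | hl
      · rw [hl, h0]
        simp
      · rw [sum_eq_single (⟨l - 1, by omega⟩ : Fin L)]
        · rw [if_pos (by simp; omega)]
        · intro k _ hk
          rw [if_neg]
          intro h
          exact hk (Fin.ext (by simp; omega))
        · simp
    · simp
  · by_cases hl : (l : ℕ) + 1 < L
    · rw [sum_eq_single (⟨l + 1, hl⟩ : Fin L)]
      · simp
      · intro k _ hk
        rw [if_neg]
        intro h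
        exact hk (Fin.ext h)
      · simp
    · have : (l : ℕ) + 2 = L + 1 := by omega
      rw [this, hL]
      simp

/-! ### Chains of weights -/

section Chain

variable (L : ℕ) (r : ℝ) (η : ℂ) (d : ℕ → ℝ)

/-- The partial sums of the weights. -/
def wsum (n : ℕ) : ℝ := ∑ t ∈ range n, d t

/-- The value of `s_{t-1}(m) A_{t-1,t}(m) s_t(-m)`. -/
def edgeSig (t : ℕ) (m : ℤ) : ℂ := nint η ((r - d t) * m) / nint η (r * m)

/-- The value of `s_t(m) A_{t,t}(m) s_t(-m)`. -/
def nodeSig (t : ℕ) (m : ℤ) : ℂ :=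
  -(nint η ((r - d t) * m) * nint η ((d t + d (t + 1)) * m) /
    (nint η (r * m) * nint η (d (t + 1) * m)))

/-- The value of `λ_{i,n}(0)`. -/
def zeroPhi (i n : ℕ) : ℂ :=
  2 * r * η / wsum d (L + 1) * if n ≤ i then (wsum d n : ℂ) else wsum d n - wsum d (L + 1)

/-- The value of `λ_{i,n}(m) / s_n(m)` for `n ≤ i`. -/
def oscLow (n : ℕ) (m : ℤ) : ℂ :=
  nint η (r * m) / nint η (wsum d (L + 1) * m) *
    -(xpow η ((r + wsum d (L + 1) - d 0) * m) * nint η (wsum d n * m))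

/-- The value of `λ_{i,n}(m) / s_n(m)` for `i < n`. -/
def oscUp (n : ℕ) (m : ℤ) : ℂ :=
  nint η (r * m) / nint η (wsum d (L + 1) * m) *
    (xpow η ((r - d 0) * m) * nint η ((wsum d (L + 1) - wsum d n) * m))

/-- The value of `λ_{i,n}(m) / s_n(m)`. -/
def oscPhi (i n : ℕ) (m : ℤ) : ℂ := if n ≤ i then oscLow L r η d n m else oscUp L r η d n m

/-- The weights are `1` or `r - 1`. -/
def IsWeight : Prop := ∀ t ≤ L, d t = r - 1 ∨ d t = 1

variable {L r η d}

lemma wsum_zero : wsum d 0 = 0 := by simp [wsum]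

lemma wsum_one : wsum d 1 = d 0 := by simp [wsum]

lemma wsum_succ (n : ℕ) : wsum d (n + 1) = wsum d n + d n := by
  rw [wsum, sum_range_succ, wsum]

lemma IsWeight.eq_or_add_eq (hd : IsWeight L r d) {l : ℕ} (hl : l < L) :
    d l = d (l + 1) ∨ d l + d (l + 1) = r := by
  rcases hd l hl.le with h | h <;> rcases hd (l + 1) hl with h' | h' <;> rw [h, h']
  · exact Or.inl rfl
  · exact Or.inr (by ring)
  · exact Or.inr (by ring)
  · exact Or.inl rfl

lemma IsWeight.pos (hr : 1 < r) (hd : IsWeight L r d) {t : ℕ} (ht : t ≤ L) : 0 < d t := by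
  rcases hd t ht with h | h <;> rw [h] <;> linarith

lemma IsWeight.lt (hr : 1 < r) (hd : IsWeight L r d) {t : ℕ} (ht : t ≤ L) : d t < r := by
  rcases hd t ht with h | h <;> rw [h] <;> linarith

lemma IsWeight.wsum_pos (hr : 1 < r) (hd : IsWeight L r d) : 0 < wsum d (L + 1) :=
  sum_pos (fun t ht => hd.pos hr (by simpa [Nat.lt_succ_iff] using ht)) ⟨0, by simp⟩

/-- The numbers 1 and r - 1 are the roots of d² - r d + r - 1. This common value makes the zero mode
system telescope. -/
lemma IsWeight.mul_sub (hd : IsWeight L r d) {t : ℕ} (ht : t ≤ L) :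
    d t * (d t - r) = 1 - r := by
  rcases hd t ht with h | h <;> rw [h] <;> ring

/-- Shifted partial sums are in the kernel of the tridiagonal system. -/
lemma nint_mul_edgeSig_add (hη : ‖Complex.exp η‖ ≠ 1) (hr : 1 < r) (hd : IsWeight L r d)
    {l : ℕ} (hl : l < L) (u : ℝ) {m : ℤ} (hm : m ≠ 0) :
    nint η ((wsum d l + u) * m) * edgeSig r η d l m +
      nint η ((wsum d (l + 1) + u) * m) * nodeSig r η d l m +
      nint η ((wsum d (l + 2) + u) * m) * edgeSig r η d (l + 1) m = 0 := by
  have hm' : (m : ℝ) ≠ 0 := Int.cast_ne_zero.2 hm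
  have h1 : nint η (r * m) ≠ 0 := nint_ne_zero hη (mul_ne_zero (by linarith) hm')
  have h2 : nint η (d (l + 1) * m) ≠ 0 := nint_ne_zero hη (mul_ne_zero (hd.pos hr hl).ne' hm')
  rw [wsum_succ (l + 1), wsum_succ, edgeSig, edgeSig, nodeSig]
  -- Equal weights call for `nint_add_nint`; weights of sum r call for `nint_mul_add_mul`.
  rcases hd.eq_or_add_eq hl with h | h
  · rw [h, show (d (l + 1) + d (l + 1)) * (m : ℝ) = d (l + 1) * m + d (l + 1) * m by ring,
      nint_two_mul]
    have := nint_add_nint (η := η) ((wsum d l + u) * m) (d (l + 1) * m)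
    rw [show (wsum d l + u) * m + d (l + 1) * m + d (l + 1) * m =
      (wsum d l + d (l + 1) + d (l + 1) + u) * m by ring,
      show (wsum d l + u) * m + d (l + 1) * m = (wsum d l + d (l + 1) + u) * m by ring] at this
    generalize nint η (r * m) = R at *
    generalize nint η (d (l + 1) * m) = R' at *
    generalize nint η ((r - d (l + 1)) * m) = S at *
    generalize nint η ((wsum d l + u) * m) = N₀ at *
    generalize nint η ((wsum d l + d (l + 1) + u) * m) = N₁ at *
    generalize nint η ((wsum d l + d (l + 1) + d (l + 1) + u) * m) = N₂ at *
    generalize xpow η (d (l + 1) * m) + xpow η (-(d (l + 1) * m)) = X at *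
    field_simp
    linear_combination S * this
  · have := nint_mul_add_mul (η := η) ((wsum d l + u) * m) (d l * m) (d (l + 1) * m)
    rw [show (wsum d l + u) * m + d l * m + d (l + 1) * m =
      (wsum d l + d l + d (l + 1) + u) * m by ring,
      show (wsum d l + u) * m + d l * m = (wsum d l + d l + u) * m by ring,
      show d l * (m : ℝ) + d (l + 1) * m = r * m by rw [← h]; ring] at this
    rw [h, show r - d l = d (l + 1) by linarith, show r - d (l + 1) = d l by linarith]
    generalize nint η (r * m) = R at *
    generalize nint η (d (l + 1) * m) = R' at *
    generalize nint η (d l * m) = S at *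
    generalize nint η ((wsum d l + u) * m) = N₀ at *
    generalize nint η ((wsum d l + d l + u) * m) = N₁ at *
    generalize nint η ((wsum d l + d l + d (l + 1) + u) * m) = N₂ at *
    field_simp
    linear_combination this

/-- The jump between the two branches. It is the source term in the locality system and also the
difference of consecutive rows required by `MatchEq`. -/
lemma oscUp_eq (hη : ‖Complex.exp η‖ ≠ 1) (hw : wsum d (L + 1) ≠ 0) (n : ℕ) {m : ℤ}
    (hm : m ≠ 0) : oscUp L r η d n m =
      oscLow L r η d n m + nint η (r * m) * xpow η ((r - d 0 + wsum d n) * m) := by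
  have h1 : nint η (wsum d (L + 1) * m) ≠ 0 :=
    nint_ne_zero hη (mul_ne_zero hw (Int.cast_ne_zero.2 hm))
  have h2 : xpow η ((r - d 0) * m) * nint η ((wsum d (L + 1) - wsum d n) * m) =
      -(xpow η ((r + wsum d (L + 1) - d 0) * m) * nint η (wsum d n * m)) +
        xpow η ((r - d 0 + wsum d n) * m) * nint η (wsum d (L + 1) * m) := by
    rw [show (r + wsum d (L + 1) - d 0) * (m : ℝ) = (r - d 0) * m + wsum d (L + 1) * m by ring,
      show (r - d 0 + wsum d n) * (m : ℝ) = (r - d 0) * m + wsum d n * m by ring,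
      show (wsum d (L + 1) - wsum d n) * (m : ℝ) = wsum d (L + 1) * m + -(wsum d n * m) by ring]
    have h3 := xpow_ne_zero (η := η) (wsum d (L + 1) * m)
    have h4 := xpow_ne_zero (η := η) (wsum d n * m)
    simp only [nint, neg_add, xpow_add, xpow_neg, inv_inv]
    field_simp
    ring
  rw [oscUp, oscLow, h2, mul_add, ← mul_assoc, mul_comm _ (xpow η ((r - d 0 + wsum d n) * m))]
  generalize nint η (wsum d (L + 1) * m) = R at *
  field_simp

lemma oscPhi_zero (i : ℕ) (m : ℤ) : oscPhi L r η d i 0 m = 0 := by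
  rw [oscPhi, if_pos (Nat.zero_le _), oscLow, wsum_zero, zero_mul, nint_zero]
  ring

lemma oscPhi_last {i : ℕ} (hi : i ≤ L) (m : ℤ) : oscPhi L r η d i (L + 1) m = 0 := by
  rw [oscPhi, if_neg (by omega), oscUp, sub_self, zero_mul, nint_zero]
  ring

/-- The tridiagonal system solved by `oscPhi`. -/
lemma oscPhi_mul_edgeSig_add (hη : ‖Complex.exp η‖ ≠ 1) (hr : 1 < r) (hd : IsWeight L r d)
    {l : ℕ} (hl : l < L) (i : ℕ) {m : ℤ} (hm : m ≠ 0) :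
    oscPhi L r η d i l m * edgeSig r η d l m + oscPhi L r η d i (l + 1) m * nodeSig r η d l m +
      oscPhi L r η d i (l + 2) m * edgeSig r η d (l + 1) m =
    (if i = l then -(xpow η ((r - d 0 + wsum d l) * m) * nint η ((r - d l) * m)) else 0) +
    if i = l + 1 then xpow η ((r - d 0 + wsum d (l + 2)) * m) * nint η ((r - d (l + 1)) * m)
      else 0 := by
  have hm' : (m : ℝ) ≠ 0 := Int.cast_ne_zero.2 hm
  have hw : wsum d (L + 1) ≠ 0 := (hd.wsum_pos hr).ne'
  have h1 : nint η (r * m) ≠ 0 := nint_ne_zero hη (mul_ne_zero (by linarith) hm')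
  have e1 : nint η (r * m) * edgeSig r η d l m = nint η ((r - d l) * m) :=
    mul_div_cancel₀ _ h1
  have e2 : nint η (r * m) * edgeSig r η d (l + 1) m = nint η ((r - d (l + 1)) * m) :=
    mul_div_cancel₀ _ h1
  -- Each branch is a multiple of shifted partial sums, with shift 0 or minus the total weight,
  -- hence lies in the kernel. The right-hand side arises only where the three consecutive positions
  -- straddle the jump.
  have low : oscLow L r η d l m * edgeSig r η d l m +
      oscLow L r η d (l + 1) m * nodeSig r η d l m +
      oscLow L r η d (l + 2) m * edgeSig r η d (l + 1) m = 0 := by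
    have := nint_mul_edgeSig_add hη hr hd hl 0 hm
    simp only [add_zero] at this
    simp only [oscLow]
    linear_combination (nint η (r * m) / nint η (wsum d (L + 1) * m) *
      -(xpow η ((r + wsum d (L + 1) - d 0) * m))) * this
  have up : oscUp L r η d l m * edgeSig r η d l m +
      oscUp L r η d (l + 1) m * nodeSig r η d l m +
      oscUp L r η d (l + 2) m * edgeSig r η d (l + 1) m = 0 := by
    have := nint_mul_edgeSig_add hη hr hd hl (-wsum d (L + 1)) hm
    have e : ∀ n, nint η ((wsum d (L + 1) - wsum d n) * m) =
        -nint η ((wsum d n + -wsum d (L + 1)) * m) := fun n => by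
      rw [← nint_neg]
      ring_nf
    simp only [oscUp, e]
    linear_combination (-(nint η (r * m) / nint η (wsum d (L + 1) * m) *
      xpow η ((r - d 0) * m))) * this
  simp only [oscPhi]
  rcases lt_trichotomy i l with h | h | h
  · rw [if_neg (by omega), if_neg (by omega), if_neg (by omega), if_neg (by omega),
      if_neg (by omega), up, add_zero]
  · subst h
    rw [if_pos le_rfl, if_neg (by omega), if_neg (by omega), if_pos rfl, if_neg (by omega)]
    linear_combination up - edgeSig r η d i m * oscUp_eq (r := r) hη hw i hm -
      xpow η ((r - d 0 + wsum d i) * m) * e1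
  · rcases Nat.lt_or_ge (l + 1) i with h' | h'
    · rw [if_pos (by omega), if_pos (by omega), if_pos (by omega), if_neg (by omega),
        if_neg (by omega), low, add_zero]
    · obtain rfl : i = l + 1 := by omega
      rw [if_pos (by omega), if_pos le_rfl, if_neg (by omega), if_neg (by omega), if_pos rfl]
      linear_combination low + edgeSig r η d (l + 1) m * oscUp_eq (r := r) hη hw (l + 2) hm +
        xpow η ((r - d 0 + wsum d (l + 2)) * m) * e2

lemma zeroPhi_zero (i : ℕ) : zeroPhi L r η d i 0 = 0 := by
  rw [zeroPhi, if_pos (Nat.zero_le _), wsum_zero]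
  simp

lemma zeroPhi_last {i : ℕ} (hi : i ≤ L) : zeroPhi L r η d i (L + 1) = 0 := by
  rw [zeroPhi, if_neg (by omega), sub_self, mul_zero]

lemma zeroPhi_succ (hr : 1 < r) (hd : IsWeight L r d) (j k : ℕ) :
    zeroPhi L r η d (j + 1) (k + 1) =
      zeroPhi L r η d j (k + 1) + if k = j then 2 * r * η else 0 := by
  have hw : (wsum d (L + 1) : ℂ) ≠ 0 := by exact_mod_cast (hd.wsum_pos hr).ne'
  simp only [zeroPhi]
  rcases lt_trichotomy k j with h | h | h
  · rw [if_pos (by omega), if_pos (by omega), if_neg (by omega), add_zero]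
  · rw [if_pos (by omega), if_neg (by omega), if_pos h]
    field_simp
    ring
  · rw [if_neg (by omega), if_neg (by omega), if_neg (by omega), add_zero]

/-- The tridiagonal system solved by `zeroPhi`. -/
lemma zeroPhi_mul_add (hr : 1 < r) (hd : IsWeight L r d) {l : ℕ} (hl : l < L) (i : ℕ) :
    zeroPhi L r η d i l * ((d l - r) / r : ℝ) +
      zeroPhi L r η d i (l + 1) * ((2 * r - d l - d (l + 1)) / r : ℝ) +
      zeroPhi L r η d i (l + 2) * ((d (l + 1) - r) / r : ℝ) =
    (if i = l then 2 * η * (d l - r) else 0) +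
    if i = l + 1 then 2 * η * (r - d (l + 1)) else 0 := by
  have hr' : (r : ℂ) ≠ 0 := by exact_mod_cast (by linarith : r ≠ 0)
  have hw : (wsum d (L + 1) : ℂ) ≠ 0 := by exact_mod_cast (hd.wsum_pos hr).ne'
  have h1 : (d l : ℂ) * (d l - r) = 1 - r := by exact_mod_cast hd.mul_sub hl.le
  have h2 : (d (l + 1) : ℂ) * (d (l + 1) - r) = 1 - r := by exact_mod_cast hd.mul_sub hl
  have h3 : (wsum d (l + 1) : ℂ) = wsum d l + d l := by exact_mod_cast wsum_succ l
  have h4 : (wsum d (l + 2) : ℂ) = wsum d l + d l + d (l + 1) := by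
    rw [← h3]
    exact_mod_cast wsum_succ (l + 1)
  simp only [zeroPhi]
  push_cast
  rw [h3, h4]
  generalize (wsum d (L + 1) : ℂ) = w at *
  rcases lt_trichotomy i l with h | h | h
  · rw [if_neg (by omega), if_neg (by omega), if_neg (by omega), if_neg (by omega),
      if_neg (by omega)]
    field_simp
    linear_combination 2 * η * (h2 - h1)
  · subst h
    rw [if_pos le_rfl, if_neg (by omega), if_neg (by omega), if_pos rfl, if_neg (by omega)]
    field_simp
    linear_combination 2 * η * (h2 - h1)
  · rcases Nat.lt_or_ge (l + 1) i with h' | h'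
    · rw [if_pos (by omega), if_pos (by omega), if_pos (by omega), if_neg (by omega),
        if_neg (by omega)]
      field_simp
      linear_combination 2 * η * (h2 - h1)
    · obtain rfl : i = l + 1 := by omega
      rw [if_pos (by omega), if_pos le_rfl, if_neg (by omega), if_neg (by omega), if_pos rfl]
      field_simp
      linear_combination 2 * η * (h2 - h1)

end Chain

end DeformedW

namespace DeformedW

/-! ### The weight form of the parameters solves the equations -/

open Finset

namespace Params

variable {L : ℕ} (P : Params L)

/-- The form of `A(0)`, of the products `s_k(m) A_{k,l}(m) s_l(-m)`, and of the zeros and poles,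
in terms of a sequence of weights. -/
structure ChainForm (r : ℝ) (η : ℂ) (d : ℕ → ℝ) : Prop where
  zero_diag : ∀ j : Fin L, P.A 0 j j = ((2 * r - d j - d (j + 1)) / r : ℝ)
  zero_next : ∀ k l : Fin L, (k : ℕ) + 1 = l → P.A 0 k l = ((d l - r) / r : ℝ)
  zero_prev : ∀ k l : Fin L, (k : ℕ) + 1 = l → P.A 0 l k = ((d l - r) / r : ℝ)
  zero_far : ∀ k l : Fin L, 2 ≤ |(k : ℤ) - (l : ℤ)| → P.A 0 k l = 0
  sig_diag : ∀ (j : Fin L) (m : ℤ), m ≠ 0 → P.sig j j m = nodeSig r η d j m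
  sig_next : ∀ (k l : Fin L) (m : ℤ), m ≠ 0 → (k : ℕ) + 1 = l → P.sig k l m = edgeSig r η d l m
  sig_prev : ∀ (k l : Fin L) (m : ℤ), m ≠ 0 → (k : ℕ) + 1 = l → P.sig l k m = edgeSig r η d l m
  sig_far : ∀ (k l : Fin L) (m : ℤ), m ≠ 0 → 2 ≤ |(k : ℤ) - (l : ℤ)| → P.sig k l m = 0
  q_diag : ∀ j : Fin L, P.q j.castSucc j = xpow η (wsum d (j + 1) - d 0)
  q_sub : ∀ j : Fin L, P.q j.succ j = xpow η (2 * r + wsum d (j + 1) - d 0)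
  p_diag : ∀ j : Fin L, P.p j.castSucc j = xpow η (wsum d (j + 1) - d 0 + 2 * (r - d j))
  p_sub : ∀ j : Fin L, P.p j.succ j =
    xpow η (2 * r + wsum d (j + 1) - d 0 - 2 * (r - d (j + 1)))
  p_other : ∀ (k : Fin (L + 1)) (l : Fin L), k ≠ l.castSucc → k ≠ l.succ → P.p k l = P.q k l

/-- The form of the coefficients `λ_{i,j}(m)` in terms of a sequence of weights. -/
structure LamForm (r : ℝ) (η : ℂ) (d : ℕ → ℝ) : Prop where
  zero : ∀ i k, P.lam i k 0 = zeroPhi L r η d i (k + 1)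
  ne_zero : ∀ i k (m : ℤ), m ≠ 0 → P.lam i k m = P.s k m * oscPhi L r η d i (k + 1) m

variable {P} {r : ℝ} {η : ℂ} {d : ℕ → ℝ}

lemma eq_castSucc_iff {i : Fin (L + 1)} {l : Fin L} : i = l.castSucc ↔ (i : ℕ) = l := by
  rw [Fin.ext_iff, Fin.val_castSucc]

lemma eq_succ_iff {i : Fin (L + 1)} {l : Fin L} : i = l.succ ↔ (i : ℕ) = l + 1 := by
  rw [Fin.ext_iff, Fin.val_succ]

namespace ChainForm

lemma exp_sum_zeroPhi (hP : P.ChainForm r η d) (hr : 1 < r) (hd : IsWeight L r d)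
    (hq : ∀ i j, P.q i j ≠ 0) (i : Fin (L + 1)) (l : Fin L) :
    Complex.exp (∑ k : Fin L, zeroPhi L r η d i (k + 1) * P.A 0 k l) = P.q i l / P.p i l := by
  rw [sum_tridiagonal (F := fun n => zeroPhi L r η d i n)
    (e := fun t => (((d t - r) / r : ℝ) : ℂ)) (zeroPhi_zero i) (zeroPhi_last (by omega))
    hP.zero_far hP.zero_next hP.zero_prev, hP.zero_diag, zeroPhi_mul_add hr hd l.2]
  by_cases h : i = l.castSucc
  · rw [if_pos (eq_castSucc_iff.1 h), if_neg (by rw [eq_castSucc_iff.1 h]; omega), h, hP.q_diag,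
      hP.p_diag, ← xpow_sub, xpow]
    congr 1
    push_cast
    ring
  by_cases h' : i = l.succ
  · rw [if_neg (by rw [eq_succ_iff.1 h']; omega), if_pos (eq_succ_iff.1 h'), h', hP.q_sub,
      hP.p_sub, ← xpow_sub, xpow]
    congr 1
    push_cast
    ring
  · rw [if_neg (by rwa [← eq_castSucc_iff]), if_neg (by rwa [← eq_succ_iff]), hP.p_other i l h h',
      div_self (hq i l)]
    simp

lemma sum_oscPhi (hP : P.ChainForm r η d) (hη : ‖Complex.exp η‖ ≠ 1) (hr : 1 < r)
    (hd : IsWeight L r d) (i : Fin (L + 1)) (l : Fin L) {m : ℤ} (hm : m ≠ 0) :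
    (∑ k : Fin L, P.s k m * oscPhi L r η d i (k + 1) m * P.A m k l) * P.s l (-m) =
      P.q i l ^ m - P.p i l ^ m := by
  have e : (∑ k : Fin L, P.s k m * oscPhi L r η d i (k + 1) m * P.A m k l) * P.s l (-m) =
      ∑ k : Fin L, oscPhi L r η d i (k + 1) m * P.sig k l m := by
    rw [sum_mul]
    exact sum_congr rfl fun k _ => by rw [sig]; ring
  rw [e, sum_tridiagonal (σ := fun k l => P.sig k l m) (F := fun n => oscPhi L r η d i n m)
    (e := fun t => edgeSig r η d t m) (oscPhi_zero i m)
    (oscPhi_last (by omega) m) (fun k l => hP.sig_far k l m hm) (fun k l => hP.sig_next k l m hm)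
    (fun k l => hP.sig_prev k l m hm), hP.sig_diag l m hm,
    oscPhi_mul_edgeSig_add hη hr hd l.2 i hm]
  have hs := wsum_succ (d := d) l
  have hs' := wsum_succ (d := d) (l + 1)
  by_cases h : i = l.castSucc
  · rw [if_pos (eq_castSucc_iff.1 h), if_neg (by rw [eq_castSucc_iff.1 h]; omega), h, hP.q_diag,
      hP.p_diag, xpow_zpow, xpow_zpow, xpow_mul_nint, add_zero, neg_sub, hs]
    ring_nf
  by_cases h' : i = l.succ
  · rw [if_neg (by rw [eq_succ_iff.1 h']; omega), if_pos (eq_succ_iff.1 h'), h', hP.q_sub,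
      hP.p_sub, xpow_zpow, xpow_zpow, xpow_mul_nint, zero_add, hs']
    ring_nf
  · rw [if_neg (by rwa [← eq_castSucc_iff]), if_neg (by rwa [← eq_succ_iff]), hP.p_other i l h h']
    simp

lemma localityEq (hP : P.ChainForm r η d) (hl : P.LamForm r η d) (hη : ‖Complex.exp η‖ ≠ 1)
    (hr : 1 < r) (hd : IsWeight L r d) (hq : ∀ i j, P.q i j ≠ 0) : P.LocalityEq where
  zero i j := by
    rw [← hP.exp_sum_zeroPhi hr hd hq]
    simp only [hl.zero]
  ne_zero i j m hm := by
    rw [← hP.sum_oscPhi hη hr hd i j hm]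
    simp only [hl.ne_zero _ _ m hm]

lemma symmetryEq (hP : P.ChainForm r η d) : P.SymmetryEq where
  symm k l m hm := by
    rcases lt_trichotomy (k : ℕ) l with h | h | h
    · rcases Nat.lt_or_ge ((k : ℕ) + 1) l with h' | h'
      · rw [hP.sig_far k l m hm (by rw [le_abs]; omega),
          hP.sig_far l k m hm (by rw [le_abs]; omega)]
      · rw [hP.sig_next k l m hm (by omega), hP.sig_prev k l m hm (by omega)]
    · rw [Fin.ext h]
    · rcases Nat.lt_or_ge ((l : ℕ) + 1) k with h' | h'
      · rw [hP.sig_far k l m hm (by rw [le_abs]; omega),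
          hP.sig_far l k m hm (by rw [le_abs]; omega)]
      · rw [hP.sig_next l k m hm (by omega), hP.sig_prev l k m hm (by omega)]
  far k l hkl m hm := hP.sig_far k l m hm hkl

lemma q_div (hP : P.ChainForm r η d) (j : Fin L) :
    P.q j.succ j / P.q j.castSucc j = xpow η (2 * r) := by
  rw [hP.q_sub, hP.q_diag, ← xpow_sub]
  ring_nf

lemma q_div_p_sub (hP : P.ChainForm r η d) (j : Fin L) :
    P.q j.castSucc j / P.p j.castSucc j - 1 = -(xpow η (d j - r) * nint η (r - d j)) := by
  rw [hP.q_diag, hP.p_diag, ← xpow_sub, nint, mul_sub (xpow η _), ← xpow_add, ← xpow_add,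
    ← xpow_zero (η := η)]
  ring_nf

lemma q_div_p_sub' (hP : P.ChainForm r η d) (j : Fin L) :
    P.q j.succ j / P.p j.succ j - 1 = xpow η (r - d (j + 1)) * nint η (r - d (j + 1)) := by
  rw [hP.q_sub, hP.p_sub, ← xpow_sub, nint, mul_sub (xpow η _), ← xpow_add, ← xpow_add,
    ← xpow_zero (η := η)]
  ring_nf

/-- The exponential equals x^{d_j - r} x^{d_{j+1} - r}, because A_{j,j}(0) = (2r - d_j - d_{j+1})/r.
It cancels the prefactors of the two residues, and what remains is that g_i (x^{r - d_i} - x^{d_i -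
r}) takes equal values at the two ends of the node. -/
lemma scalar_iff (hP : P.ChainForm r η d) (hr : 1 < r) {lg : ℂ → ℂ}
    (hlg : lg (Complex.exp (2 * r * η)) = 2 * r * η) (j : Fin L) :
    P.g j.castSucc * (P.q j.castSucc j / P.p j.castSucc j - 1) =
      -(P.g j.succ * (P.q j.succ j / P.p j.succ j - 1)) *
        Complex.exp (-(lg (P.q j.succ j / P.q j.castSucc j) * (P.A 0 j j / 2))) ↔
    P.g j.castSucc * nint η (r - d j) = P.g j.succ * nint η (r - d (j + 1)) := by
  have hr' : (r : ℂ) ≠ 0 := by exact_mod_cast (by linarith : r ≠ 0)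
  have hx : xpow η (2 * r) = Complex.exp (2 * r * η) := by
    rw [xpow]
    push_cast
    rfl
  have he : Complex.exp (-(lg (P.q j.succ j / P.q j.castSucc j) * (P.A 0 j j / 2))) =
      xpow η (d j - r) * xpow η (d (j + 1) - r) := by
    rw [hP.q_div, hx, hlg, hP.zero_diag, ← xpow_add, xpow]
    congr 1
    push_cast
    field_simp
    ring
  have h1 : xpow η (r - d (j + 1)) * xpow η (d (j + 1) - r) = 1 := by
    rw [← xpow_add, ← xpow_zero (η := η)]
    ring_nf
  have h0 : -xpow η (d j - r) ≠ 0 := neg_ne_zero.2 (xpow_ne_zero _)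
  rw [hP.q_div_p_sub, hP.q_div_p_sub', he]
  constructor
  · intro h
    refine mul_left_cancel₀ h0 ?_
    linear_combination h - xpow η (d j - r) * P.g j.succ * nint η (r - d (j + 1)) * h1
  · intro h
    linear_combination -xpow η (d j - r) * h +
      xpow η (d j - r) * P.g j.succ * nint η (r - d (j + 1)) * h1

lemma matchEq (hP : P.ChainForm r η d) (hl : P.LamForm r η d) (hη : ‖Complex.exp η‖ ≠ 1)
    (hr : 1 < r) (hd : IsWeight L r d) {lg : ℂ → ℂ}
    (hlg : lg (Complex.exp (2 * r * η)) = 2 * r * η) (j : Fin L)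
    (hg : P.g j.castSucc * nint η (r - d j) = P.g j.succ * nint η (r - d (j + 1))) :
    P.MatchEq lg j where
  scalar := (hP.scalar_iff hr hlg j).2 hg
  zero k := by
    have hx : xpow η (2 * r) = Complex.exp (2 * r * η) := by
      rw [xpow]
      push_cast
      rfl
    rw [hl.zero, hl.zero, hP.q_div, hx, hlg, Fin.val_succ, Fin.val_castSucc, zeroPhi_succ hr hd]
    simp only [Fin.ext_iff]
  ne_zero k m hm := by
    rw [hl.ne_zero _ _ m hm, hl.ne_zero _ _ m hm]
    simp only [oscPhi, Fin.val_succ, Fin.val_castSucc]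
    rcases lt_trichotomy (k : ℕ) j with h | h | h
    · rw [if_pos (by omega), if_pos (by omega), if_neg (by rintro rfl; omega), add_zero]
    · rw [if_neg (by omega), if_pos (by omega), if_pos (Fin.ext h), Fin.ext h,
        oscUp_eq hη (hd.wsum_pos hr).ne' _ hm, hP.q_sub, hP.q_diag, xpow_zpow, xpow_zpow, nint]
      have e : (xpow η (r * m) - xpow η (-(r * m))) *
          xpow η ((r - d 0 + wsum d (j + 1)) * m) =
          xpow η ((2 * r + wsum d (j + 1) - d 0) * m) - xpow η ((wsum d (j + 1) - d 0) * m) := by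
        rw [sub_mul, ← xpow_add, ← xpow_add]
        ring_nf
      rw [e, mul_add]
    · rw [if_neg (by omega), if_neg (by omega), if_neg (by rintro rfl; omega), add_zero]

end ChainForm

end Params

end DeformedW

namespace DeformedW

open Finset

/-! ### The extended matrix and its weights -/

section Extended

open Classical

variable {L : ℕ} {hL : 2 ≤ L} {M : Matrix (Fin L) (Fin L) ℝ} {r : ℝ} {η : ℂ}

variable (hL M r) in
/-- The weight attached to an edge of the extended diagram. -/
def weight (t : ℕ) : ℝ := D hL M r t t

lemma weight_val (t : Fin (L + 1)) :
    weight hL M r t = if edge hL M t = -1 / r then r - 1 else 1 := by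
  rw [weight, D, sum_eq_single t]
  · intro b hb hbt
    simp only [mem_filter, mem_univ, true_and] at hb
    exact absurd (Fin.ext (le_antisymm hb.2 hb.1)) hbt
  · simp

lemma isWeight_weight : IsWeight L r (weight hL M r) := by
  intro t ht
  have := weight_val (hL := hL) (M := M) (r := r) ⟨t, Nat.lt_succ_of_le ht⟩
  rw [this]
  split_ifs
  · exact Or.inl rfl
  · exact Or.inr rfl

lemma D_eq_wsum_sub {k l : ℕ} (hkl : k ≤ l + 1) (hl : l ≤ L) :
    D hL M r k l = wsum (weight hL M r) (l + 1) - wsum (weight hL M r) k := by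
  rw [wsum, wsum, ← sum_Ico_eq_sub _ hkl, D, sum_filter]
  have h := Fin.sum_univ_eq_sum_range
    (fun t => if k ≤ t ∧ t ≤ l then weight hL M r t else 0) (L + 1)
  simp only [weight_val] at h
  rw [h, ← sum_filter]
  congr 1
  ext t
  simp only [mem_filter, mem_range, mem_Ico]
  omega

lemma edge_castSucc {k l : Fin L} (h : (k : ℕ) + 1 = l) : edge hL M l.castSucc = M k l := by
  have e : l.castSucc = k.succ := Fin.ext (by simp [h])
  rw [edge, Fin.coeSucc_eq_succ, e]
  rfl

lemma mem_oddHat_succ {j : Fin L} : j.succ ∈ oddHat M ↔ j ∈ oddSet M := by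
  rw [oddHat]
  split_ifs <;> simp [Fin.succ_ne_zero]

lemma succ_sub_one (j : Fin L) : j.succ - 1 = j.castSucc := by
  rw [← Fin.coeSucc_eq_succ, add_sub_cancel_right]

namespace IsExtendedCartan

lemma edge_eq (h : IsExtendedCartan hL M r) (t : Fin (L + 1)) :
    edge hL M t = (weight hL M r t - r) / r := by
  rw [weight_val]
  split_ifs with h1
  · rw [h1]
    ring
  · exact ((h.2.1 t).1.resolve_left h1)

lemma next (h : IsExtendedCartan hL M r) {k l : Fin L} (hkl : (k : ℕ) + 1 = l) :
    M k l = (weight hL M r l - r) / r := by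
  rw [← edge_castSucc (hL := hL) (M := M) hkl, h.edge_eq, Fin.val_castSucc]

lemma prev (h : IsExtendedCartan hL M r) {k l : Fin L} (hkl : (k : ℕ) + 1 = l) :
    M l k = (weight hL M r l - r) / r := by
  have h1 := (h.2.1 l.castSucc).2
  rw [h.edge_eq, Fin.val_castSucc, Fin.coeSucc_eq_succ,
    (Fin.ext (by simp [hkl]) : l.castSucc = k.succ)] at h1
  exact h1

lemma odd_weight (h : IsExtendedCartan hL M r) (hr : 1 < r) {j : Fin L} (hj : j ∈ oddSet M) :
    weight hL M r j + weight hL M r (j + 1) = r := by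
  have h1 := h.2.2.1 j.succ
  rw [if_pos (mem_oddHat_succ.2 hj), succ_sub_one, h.edge_eq, h.edge_eq, Fin.val_succ,
    Fin.val_castSucc] at h1
  have : r ≠ 0 := by linarith
  field_simp at h1
  linarith

lemma even_weight (h : IsExtendedCartan hL M r) (hr : 1 < r) {j : Fin L} (hj : j ∉ oddSet M) :
    weight hL M r (j + 1) = weight hL M r j := by
  have h1 := h.2.2.1 j.succ
  rw [if_neg (mt mem_oddHat_succ.1 hj), succ_sub_one, h.edge_eq, h.edge_eq, Fin.val_succ,
    Fin.val_castSucc] at h1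
  have : r ≠ 0 := by linarith
  field_simp at h1
  linarith

/-- The two cases of the diagonal merge: at an odd node the adjacent weights add up to r, at an even
node they coincide. -/
lemma diag (h : IsExtendedCartan hL M r) (hr : 1 < r) (j : Fin L) :
    M j j = (2 * r - weight hL M r j - weight hL M r (j + 1)) / r := by
  have hr' : r ≠ 0 := by linarith
  by_cases hj : j ∈ oddSet M
  · have h1 : M j j = 1 := by simpa [oddSet] using hj
    have h2 := h.odd_weight hr hj
    rw [h1, eq_div_iff hr']
    linarith
  · have h1 := h.1 j.succ
    have h2 := weight_val (hL := hL) (M := M) (r := r) j.castSucc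
    rw [if_neg (mt mem_oddHat_succ.1 hj), succ_sub_one] at h1
    rw [h.even_weight hr hj]
    rw [Fin.val_castSucc] at h2
    have h3 : M j j = extA hL M j.succ j.succ := rfl
    rw [h3, h1, h2]
    split_ifs <;> ring

end IsExtendedCartan

/-! ### Explicit values in terms of the weights -/

lemma edgeSig_neg (d : ℕ → ℝ) (t : ℕ) (m : ℤ) : edgeSig r η d t (-m) = edgeSig r η d t m := by
  simp only [edgeSig, Int.cast_neg, mul_neg, nint_neg, neg_div_neg_eq]

lemma nodeSig_neg (d : ℕ → ℝ) (t : ℕ) (m : ℤ) : nodeSig r η d t (-m) = nodeSig r η d t m := by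
  simp only [nodeSig, Int.cast_neg, mul_neg, nint_neg, neg_mul, neg_neg]

lemma qint_div_qint (hη : ‖Complex.exp η‖ ≠ 1) (a b : ℝ) :
    qint η a / qint η b = nint η a / nint η b :=
  div_div_div_cancel_right₀ (nint_ne_zero hη one_ne_zero) _ _

lemma edgeSig_weight (hη : ‖Complex.exp η‖ ≠ 1) (t : Fin (L + 1)) (m : ℤ) :
    edgeSig r η (weight hL M r) t m =
      (if edge hL M t = -1 / r then qint η m else qint η ((r - 1) * m)) / qint η (r * m) := by
  rw [edgeSig, weight_val]
  split_ifs
  · rw [qint_div_qint hη, sub_sub_cancel, one_mul]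
  · rw [qint_div_qint hη]

lemma nodeSig_ne_zero {d : ℕ → ℝ} (hη : ‖Complex.exp η‖ ≠ 1) (hr : 1 < r) (hd : IsWeight L r d)
    {t : ℕ} (ht : t < L) {m : ℤ} (hm : m ≠ 0) : nodeSig r η d t m ≠ 0 := by
  have hm' : (m : ℝ) ≠ 0 := Int.cast_ne_zero.2 hm
  have h1 := hd.pos hr ht.le
  have h2 := hd.pos hr ht
  refine neg_ne_zero.2 (div_ne_zero (mul_ne_zero ?_ ?_) (mul_ne_zero ?_ ?_)) <;>
    refine nint_ne_zero hη (mul_ne_zero ?_ hm')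
  · linarith [hd.lt hr ht.le]
  · linarith
  · linarith
  · linarith

lemma nodeSig_weight (h : IsExtendedCartan hL M r) (hη : ‖Complex.exp η‖ ≠ 1) (hr : 1 < r)
    (j : Fin L) {m : ℤ} (hm : m ≠ 0) : nodeSig r η (weight hL M r) j m =
      if j ∈ oddSet M then -1
      else if edge hL M j.castSucc = -1 / r then
        -(qint η m * qint η (2 * (r - 1) * m) / (qint η (r * m) * qint η ((r - 1) * m)))
      else -(qint η ((r - 1) * m) * qint η (2 * m) / (qint η (r * m) * qint η m)) := by
  have hm' : (m : ℝ) ≠ 0 := Int.cast_ne_zero.2 hm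
  have h1 : nint η (r * m) ≠ 0 := nint_ne_zero hη (mul_ne_zero (by linarith) hm')
  by_cases hj : j ∈ oddSet M
  · have h2 := h.odd_weight hr hj
    have h3 : nint η (weight hL M r (j + 1) * m) ≠ 0 :=
      nint_ne_zero hη (mul_ne_zero (isWeight_weight.pos hr (Nat.succ_le_of_lt j.2)).ne' hm')
    rw [if_pos hj, nodeSig, h2, show r - weight hL M r j = weight hL M r (j + 1) by linarith,
      mul_comm, div_self (mul_ne_zero h1 h3)]
  · have h2 := weight_val (hL := hL) (M := M) (r := r) j.castSucc
    rw [Fin.val_castSucc] at h2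
    rw [if_neg hj, nodeSig, h.even_weight hr hj, h2]
    simp only [mul_div_mul_comm, qint_div_qint hη]
    split_ifs
    · rw [sub_sub_cancel, one_mul, ← two_mul]
    · rw [one_mul, one_add_one_eq_two]

lemma qint_mul_eq_nint {a : ℝ} (hη : ‖Complex.exp η‖ ≠ 1) :
    qint η a * (xpow η 1 - xpow η (-1)) = nint η a :=
  div_mul_cancel₀ _ (nint_ne_zero hη one_ne_zero)

lemma oscPhi_weight (hη : ‖Complex.exp η‖ ≠ 1) (i : Fin (L + 1)) (j : Fin L) (m : ℤ) :
    oscPhi L r η (weight hL M r) i (j + 1) m =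
      qint η (r * m) * (xpow η 1 - xpow η (-1)) / qint η (D hL M r 0 L * m) *
      if (j : ℕ) < i then
        -(xpow η ((r + D hL M r 1 L) * m) * qint η (D hL M r 0 j * m))
      else xpow η ((r - D hL M r 0 0) * m) * qint η (D hL M r (j + 1) L * m) := by
  have h1 : nint η 1 ≠ 0 := nint_ne_zero hη one_ne_zero
  rw [qint_mul_eq_nint hη, D_eq_wsum_sub (by omega) le_rfl, D_eq_wsum_sub (by omega) le_rfl,
    D_eq_wsum_sub (by omega) j.2.le, D_eq_wsum_sub (by omega) (Nat.zero_le _),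
    D_eq_wsum_sub (by omega) le_rfl, wsum_zero, zero_add, wsum_one, sub_zero, sub_zero,
    sub_zero, oscPhi, oscLow, oscUp, ← add_sub_assoc]
  simp only [qint_eq, Nat.succ_le_iff]
  generalize nint η (wsum (weight hL M r) (L + 1) * m) = R at *
  split_ifs
  · rw [← mul_div_assoc, ← neg_div, div_div_eq_mul_div, div_mul_div_comm, div_mul_eq_mul_div,
      mul_right_comm, mul_div_mul_right _ _ h1]
  · rw [← mul_div_assoc, div_div_eq_mul_div, div_mul_div_comm, div_mul_eq_mul_div,
      mul_right_comm, mul_div_mul_right _ _ h1]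

lemma zeroPhi_weight (i : Fin (L + 1)) (j : Fin L) :
    zeroPhi L r η (weight hL M r) i (j + 1) = 2 * r * η / D hL M r 0 L *
      if (j : ℕ) < i then (D hL M r 0 j : ℂ) else -(D hL M r (j + 1) L : ℂ) := by
  rw [D_eq_wsum_sub (by omega) le_rfl, D_eq_wsum_sub (by omega) le_rfl,
    D_eq_wsum_sub (by omega) j.2.le, wsum_zero, sub_zero, sub_zero, zeroPhi]
  simp only [Nat.add_one_le_iff]
  push_cast
  rw [neg_sub]

end Extended

/-! ### Explicit parameters in weight form, and the converse direction -/

namespace Params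

open Classical

variable {L : ℕ} {P : Params L} {hL : 2 ≤ L} {r : ℝ} {η g₀ : ℂ}

lemma A0_eq (h : ∀ i j, (P.A 0 i j).im = 0) (i j : Fin L) : P.A 0 i j = (P.A0 i j : ℂ) :=
  (Complex.ext (by simp [A0]) (by simp [h i j]))

/-- At the first node the offset is minus the first weight, which is not a value of `D`; this is why
p_{1,1} has its own formula. -/
lemma p_diag_weight (j : Fin L) (M : Matrix (Fin L) (Fin L) ℝ) :
    xpow η (wsum (weight hL M r) (j + 1) - weight hL M r 0 + 2 * (r - weight hL M r j)) =
    if (j : ℕ) = 0 then if edge hL M j.castSucc = -1 / r then xpow η 2 else xpow η (2 * r - 2)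
    else xpow η (D hL M r 1 (j - 1)) *
      if edge hL M j.castSucc = -1 / r then xpow η (r + 1) else xpow η (2 * r - 1) := by
  have h := weight_val (hL := hL) (M := M) (r := r) j.castSucc
  rw [Fin.val_castSucc] at h
  rw [wsum_succ]
  by_cases hj : (j : ℕ) = 0
  · rw [if_pos hj, hj, wsum_zero]
    rw [hj] at h
    rw [h]
    split_ifs <;> ring_nf
  · rw [if_neg hj, D_eq_wsum_sub (by omega) (by omega), h, wsum_one,
      Nat.sub_add_cancel (Nat.pos_of_ne_zero hj)]
    split_ifs <;> rw [← xpow_add] <;> ring_nf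

lemma p_sub_weight (j : Fin L) (M : Matrix (Fin L) (Fin L) ℝ) :
    xpow η (2 * r + wsum (weight hL M r) (j + 1) - weight hL M r 0 -
      2 * (r - weight hL M r (j + 1))) =
    xpow η (D hL M r 1 j) *
      if edge hL M j.succ = -1 / r then xpow η (2 * r - 2) else xpow η 2 := by
  have h := weight_val (hL := hL) (M := M) (r := r) j.succ
  rw [Fin.val_succ] at h
  rw [D_eq_wsum_sub (by omega) j.2.le, h, wsum_one]
  split_ifs <;> rw [← xpow_add] <;> ring_nf

/-- The prescribed coefficients are exactly those that make the quantity in `ChainForm.scalar_iff`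
constant along the chain. -/
lemma g_weight (hη : ‖Complex.exp η‖ ≠ 1) (i : Fin (L + 1)) (M : Matrix (Fin L) (Fin L) ℝ) :
    (if edge hL M i = -1 / r then qint η (r - 1) else 1) * nint η (r - weight hL M r i) =
      nint η (r - 1) := by
  rw [weight_val]
  split_ifs
  · rw [sub_sub_cancel, qint_eq, div_mul_cancel₀ _ (nint_ne_zero hη one_ne_zero)]
  · rw [one_mul]

namespace IsExplicit

lemma s_neg_eq (h : P.IsExplicit hL r η g₀) (hη : ‖Complex.exp η‖ ≠ 1) (hr : 1 < r)
    (j : Fin L) {m : ℤ} (hm : 0 < m) :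
    P.s j (-m) = nodeSig r η (weight hL P.A0 r) j m := by
  rw [h.s_neg j m hm, nodeSig_weight h.A_zero hη hr j hm.ne']

lemma s_ne_zero (h : P.IsExplicit hL r η g₀) (hη : ‖Complex.exp η‖ ≠ 1) (hr : 1 < r)
    (j : Fin L) {m : ℤ} (hm : m ≠ 0) : P.s j m ≠ 0 := by
  rcases hm.lt_or_gt with h' | h'
  · rw [← neg_neg m, h.s_neg_eq hη hr j (by omega)]
    exact nodeSig_ne_zero hη hr isWeight_weight j.2 (by omega)
  · rw [h.s_pos j m h']
    exact one_ne_zero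

lemma A_next_eq (h : P.IsExplicit hL r η g₀) (hη : ‖Complex.exp η‖ ≠ 1)
    {k l : Fin L} {m : ℤ} (hm : m ≠ 0) (hkl : (k : ℕ) + 1 = l) : P.A m k l =
    edgeSig r η (weight hL P.A0 r) l m * if 0 < m then 1 / P.s l (-m) else 1 / P.s k m := by
  have := edgeSig_weight (hL := hL) (M := P.A0) (r := r) hη l.castSucc m
  rw [Fin.val_castSucc] at this
  rw [h.A_next k l m hm hkl, this]

lemma A_symm_eq (h : P.IsExplicit hL r η g₀) {m : ℤ} (hm : m ≠ 0) (k l : Fin L) :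
    P.A m k l = P.A (-m) l k := by
  have key : ∀ k l : Fin L, (k : ℕ) + 1 = l → ∀ m : ℤ, m ≠ 0 → P.A m k l = P.A (-m) l k := by
    intro k l hkl m hm
    rcases hm.lt_or_gt with h' | h'
    · have := (h.A_symm k l (-m) (by omega) hkl).1
      rwa [neg_neg] at this
    · exact (h.A_symm k l m h' hkl).2.symm
  rcases lt_trichotomy (k : ℕ) l with hkl | hkl | hkl
  · rcases Nat.lt_or_ge ((k : ℕ) + 1) l with h' | h'
    · rw [h.A_far k l m hm (by rw [le_abs]; omega),
        h.A_far l k (-m) (by omega) (by rw [le_abs]; omega)]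
    · exact key k l (by omega) m hm
  · rw [Fin.ext hkl, h.A_diag l m hm, h.A_diag l (-m) (by omega)]
  · rcases Nat.lt_or_ge ((l : ℕ) + 1) k with h' | h'
    · rw [h.A_far k l m hm (by rw [le_abs]; omega),
        h.A_far l k (-m) (by omega) (by rw [le_abs]; omega)]
    · have := key l k (by omega) (-m) (by omega)
      rwa [neg_neg, eq_comm] at this

lemma chainForm (h : P.IsExplicit hL r η g₀) (hη : ‖Complex.exp η‖ ≠ 1) (hr : 1 < r) :
    P.ChainForm r η (weight hL P.A0 r) where
  zero_diag j := by rw [A0_eq h.A_zero_real, h.A_zero.diag hr]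
  zero_next k l hkl := by rw [A0_eq h.A_zero_real, h.A_zero.next hkl]
  zero_prev k l hkl := by rw [A0_eq h.A_zero_real, h.A_zero.prev hkl]
  zero_far k l hkl := by rw [A0_eq h.A_zero_real, h.A_zero.2.2.2.1 k l hkl, Complex.ofReal_zero]
  sig_diag j m hm := by
    rw [sig, h.A_diag j m hm, mul_one]
    rcases hm.lt_or_gt with h' | h'
    · rw [h.s_pos j (-m) (by omega), mul_one, ← nodeSig_neg, ← h.s_neg_eq hη hr j (by omega),
        neg_neg]
    · rw [h.s_pos j m h', one_mul, h.s_neg_eq hη hr j h']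
  sig_next k l m hm hkl := by
    rw [sig, h.A_next_eq hη hm hkl]
    rcases hm.lt_or_gt with h' | h'
    · have := h.s_ne_zero hη hr k hm
      rw [if_neg (by omega), h.s_pos l (-m) (by omega)]
      field_simp
    · have := h.s_ne_zero hη hr l (neg_ne_zero.2 hm)
      rw [if_pos h', h.s_pos k m h']
      field_simp
  sig_prev k l m hm hkl := by
    rw [sig, h.A_symm_eq hm, h.A_next_eq hη (neg_ne_zero.2 hm) hkl, neg_neg, edgeSig_neg]
    rcases hm.lt_or_gt with h' | h'
    · have := h.s_ne_zero hη hr l hm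
      rw [if_pos (by omega), h.s_pos k (-m) (by omega)]
      field_simp
    · have := h.s_ne_zero hη hr k (neg_ne_zero.2 hm)
      rw [if_neg (by omega), h.s_pos l m h']
      field_simp
  sig_far k l m hm hkl := by rw [sig, h.A_far k l m hm hkl, mul_zero, zero_mul]
  q_diag j := by rw [h.q_diag, D_eq_wsum_sub (by omega) j.2.le, wsum_one]
  q_sub j := by rw [h.q_sub, D_eq_wsum_sub (by omega) j.2.le, wsum_one, add_sub_assoc]
  p_diag j := by
    rw [p_diag_weight j]
    split_ifs with h1 h2 h2
    · rw [h.p_first j h1, if_pos h2]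
    · rw [h.p_first j h1, if_neg h2]
    · rw [h.p_diag j (by omega), if_pos h2]
    · rw [h.p_diag j (by omega), if_neg h2]
  p_sub j := by rw [p_sub_weight, h.p_sub]
  p_other := h.p_other

lemma lamForm (h : P.IsExplicit hL r η g₀) (hη : ‖Complex.exp η‖ ≠ 1) (hr : 1 < r) :
    P.LamForm r η (weight hL P.A0 r) where
  zero i k := by rw [h.lam_zero, zeroPhi_weight]
  ne_zero i k m hm := by
    rw [oscPhi_weight hη, ← h.lam_ne_zero i k m hm, mul_div_cancel₀ _ (h.s_ne_zero hη hr k hm)]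

lemma g_mul (h : P.IsExplicit hL r η g₀) (hη : ‖Complex.exp η‖ ≠ 1) (i : Fin (L + 1)) :
    P.g i * nint η (r - weight hL P.A0 r i) = g₀ * nint η (r - 1) := by
  rw [h.g_eq, mul_assoc, g_weight hη]

end IsExplicit

/-- Parameters in chain form, with normalized free fields, are explicit. -/
lemma ChainForm.isExplicit (h : P.ChainForm r η (weight hL P.A0 r))
    (hl : P.LamForm r η (weight hL P.A0 r)) (hη : ‖Complex.exp η‖ ≠ 1) (hr : 1 < r)
    (hreal : ∀ i j, (P.A 0 i j).im = 0) (hM : IsExtendedCartan hL P.A0 r)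
    (hs : ∀ (j : Fin L) (m : ℤ), 0 < m → P.s j m = 1)
    (hA : ∀ (j : Fin L) (m : ℤ), m ≠ 0 → P.A m j j = 1)
    (hsymm : ∀ (m : ℤ) (i j : Fin L), i ≠ j → P.A m i j = P.A (-m) j i)
    (hg : ∀ i, P.g i * nint η (r - weight hL P.A0 r i) = g₀ * nint η (r - 1)) :
    P.IsExplicit hL r η g₀ := by
  have hneg : ∀ (j : Fin L) (m : ℤ), 0 < m → P.s j (-m) = nodeSig r η (weight hL P.A0 r) j m := by
    intro j m hm
    rw [← h.sig_diag j m hm.ne', sig, hA j m hm.ne', hs j m hm, one_mul, one_mul]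
  have hs0 : ∀ (j : Fin L) (m : ℤ), m ≠ 0 → P.s j m ≠ 0 := by
    intro j m hm
    rcases hm.lt_or_gt with h' | h'
    · rw [← neg_neg m, hneg j _ (by omega)]
      exact nodeSig_ne_zero hη hr isWeight_weight j.2 (by omega)
    · rw [hs j m h']
      exact one_ne_zero
  exact
  { A_zero_real := hreal
    A_zero := hM
    q_diag := fun j => by rw [h.q_diag, D_eq_wsum_sub (by omega) j.2.le, wsum_one]
    q_sub := fun j => by rw [h.q_sub, D_eq_wsum_sub (by omega) j.2.le, wsum_one, add_sub_assoc]
    p_first := fun j hj => by rw [h.p_diag, p_diag_weight j, if_pos hj]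
    p_diag := fun j hj => by rw [h.p_diag, p_diag_weight j, if_neg (by omega)]
    p_sub := fun j => by rw [h.p_sub, p_sub_weight]
    p_other := h.p_other
    s_pos := hs
    s_neg := fun j m hm => by rw [hneg j m hm, nodeSig_weight hM hη hr j hm.ne']
    A_diag := hA
    A_far := fun k l m hm hkl => by
      have := h.sig_far k l m hm hkl
      rw [sig] at this
      exact (mul_eq_zero.1 ((mul_eq_zero.1 this).resolve_right
        (hs0 l _ (neg_ne_zero.2 hm)))).resolve_left (hs0 k m hm)
    A_next := fun k l m hm hkl => by
      have h1 := edgeSig_weight (hL := hL) (M := P.A0) (r := r) hη l.castSucc m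
      rw [Fin.val_castSucc, ← h.sig_next k l m hm hkl, sig] at h1
      rw [← h1]
      rcases hm.lt_or_gt with h' | h'
      · have := hs0 k m hm
        rw [if_neg (by omega), hs l (-m) (by omega)]
        field_simp
      · have := hs0 l _ (neg_ne_zero.2 hm)
        rw [if_pos h', hs k m h']
        field_simp
    A_symm := fun k l m _ hkl => by
      have hne : k ≠ l := by
        rintro rfl
        omega
      exact ⟨(hsymm m l k hne.symm).symm, (hsymm m k l hne).symm⟩
    lam_zero := fun i k => by rw [hl.zero, zeroPhi_weight]
    lam_ne_zero := fun i k m hm => by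
      rw [hl.ne_zero i k m hm, mul_div_cancel_left₀ _ (hs0 k m hm), oscPhi_weight hη]
    g_eq := fun i => by
      have h1 : nint η (r - weight hL P.A0 r i) ≠ 0 := nint_ne_zero hη
        (by linarith [(isWeight_weight (hL := hL) (M := P.A0)).lt hr (Nat.le_of_lt_succ i.2)])
      refine mul_right_cancel₀ h1 ?_
      rw [hg, mul_assoc, g_weight hη] }

/-- Parameters that are explicit up to freedom satisfy the three conditions. -/
theorem IsExplicitUpToFreedom.conditions {lg : ℂ → ℂ}
    (hlg : ∀ u : ℂ, u ≠ 0 → Complex.exp (lg u) = u)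
    (h : P.IsExplicitUpToFreedom hL r η g₀) (hη : ‖Complex.exp η‖ ≠ 1) (hr : 1 < r)
    (hlr : lg (Complex.exp (2 * r * η)) = 2 * r * η) (hq : ∀ i j, P.q i j ≠ 0) :
    P.MutualLocality ∧ P.Commutativity lg (P.current lg) ∧ P.Symmetry := by
  obtain ⟨t, α, ε, ν, ht, hα, hα0, hν, he⟩ := h
  change (P.change t α ε ν).IsExplicit hL r η g₀ at he
  have hd : IsWeight L r (weight hL (P.change t α ε ν).A0 r) := isWeight_weight
  have hc := he.chainForm hη hr
  have hl := he.lamForm hη hr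
  have hloc : P.LocalityEq := by
    rw [← localityEq_change ht hα hα0 hν]
    refine hc.localityEq hl hη hr hd fun i j => ?_
    rw [change_q]
    exact mul_ne_zero (sgn_ne_zero j) (mul_ne_zero ht (hq i j))
  have hA : ∀ m : ℤ, m ≠ 0 → ∀ i j, P.A m i j = P.A (-m) j i := fun m hm i j =>
    (change_A_symm hα).1 (he.A_symm_eq hm i j)
  -- With p = 0 the quotient q / p is 0 by convention, whereas locality equates it to an
  -- exponential.
  have hp : ∀ i j, P.p i j ≠ 0 := fun i j hp => by
    have := hloc.zero i j
    rw [hp, div_zero] at this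
    exact Complex.exp_ne_zero _ this
  have hloc' := (mutualLocality_iff hA hp hq).2 hloc
  refine ⟨hloc', ?_, (symmetry_iff hA).2
    ((symmetryEq_change hα).1 hc.symmetryEq)⟩
  refine commutativity_of_matchEq hp hq hlg hloc' ?_ fun j => ?_
  · intro i j h1 h2
    exact (change_p_eq_q ht i j).1 (hc.p_other i j h1 h2)
  · refine (matchEq_change ht hα hα0 lg j).1 (hc.matchEq hl hη hr hd hlr j ?_)
    have h1 := he.g_mul hη j.castSucc
    have h2 := he.g_mul hη j.succ
    rw [Fin.val_castSucc] at h1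
    rw [Fin.val_succ] at h2
    rw [h1, h2]

end Params

end DeformedW

namespace DeformedW

open Finset

/-! ### Consequences of the equations -/

/-- Inverting turns the difference p - c into -(p - c)/(pc), and likewise b - a into -(b - a)/(ab).
As s is the same in both equations, the denominators must agree. -/
lemma mul_eq_mul_of_even {a b c p s : ℂ} (ha : a ≠ 0) (hb : b ≠ 0) (hc : c ≠ 0) (hp : p ≠ 0)
    (hpc : p ≠ c) (h1 : p - c = s * (b - a)) (h2 : p⁻¹ - c⁻¹ = s * (b⁻¹ - a⁻¹)) :
    p * c = a * b := by
  have h3 : (c - p) * (a * b) = s * (a - b) * (p * c) := by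
    field_simp at h2
    linear_combination h2
  refine mul_left_cancel₀ (sub_ne_zero.2 hpc) ?_
  linear_combination h3 + p * c * h1

/-- Absolute values remove the ambiguity of the logarithm when the exponent is real; this is how
entries of A(0) are read off. -/
lemma exp_mul_ofReal_inj {u : ℂ} (hu : u.re ≠ 0) {a b : ℝ}
    (h : Complex.exp (u * a) = Complex.exp (u * b)) : a = b := by
  have h1 : ‖Complex.exp (u * a)‖ = ‖Complex.exp (u * b)‖ := by rw [h]
  rw [Complex.norm_exp, Complex.norm_exp, Real.exp_eq_exp] at h1
  simpa [hu] using h1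

lemma exp_mul_ofReal_eq_one {u : ℂ} (hu : u.re ≠ 0) {a : ℝ} (h : Complex.exp (u * a) = 1) :
    a = 0 :=
  exp_mul_ofReal_inj hu (by rw [h]; simp)

/-- Write y, z, w, t for the exponentials of u, v, uβ, vβ. The product relations and the cases m =
1, 2 reduce to z + w = y + t and z² + w² = y² + t². If y ≠ z, dividing z² - y² = t² - w² by z - y =
t - w gives z + y = t + w, whence z = t, contrary to β ≠ 1. -/
lemma exp_eq_exp_of_edge {u v a c : ℂ} {β : ℝ} (hv : v.re ≠ 0) (hβ : β ≠ 1) (ha : a ≠ 0)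
    (h1 : c * Complex.exp (-(u * β)) * c = a * (a * Complex.exp u))
    (h2 : a * Complex.exp u * Complex.exp (v * β) * (a * Complex.exp u) = c * (c * Complex.exp v))
    (h3 : ∀ m : ℕ, m ≠ 0 → ((c * Complex.exp (-(u * β))) ^ m - c ^ m) *
        ((c * Complex.exp v) ^ m - c ^ m) =
      ((a * Complex.exp u) ^ m - (a * Complex.exp u * Complex.exp (v * β)) ^ m) *
        ((a * Complex.exp u) ^ m - a ^ m)) :
    Complex.exp u = Complex.exp v := by
  have hvt : Complex.exp v ≠ Complex.exp (v * β) := by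
    intro h
    exact hβ (exp_mul_ofReal_inj hv (a := 1) (by simpa using h)).symm
  rw [Complex.exp_neg] at h1 h3
  have hy := Complex.exp_ne_zero u
  have hw := Complex.exp_ne_zero (u * β)
  generalize Complex.exp u = y at *
  generalize Complex.exp v = z at *
  generalize Complex.exp (u * β) = w at *
  generalize Complex.exp (v * β) = t at *
  have e1 : c ^ 2 = a ^ 2 * y * w := by
    field_simp at h1
    linear_combination h1
  have e2 : y * t = w * z := by
    have : a ^ 2 * y ≠ 0 := mul_ne_zero (pow_ne_zero 2 ha) hy
    refine mul_left_cancel₀ this ?_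
    linear_combination h2 + z * e1
  have e3 : z + w = y + t := by
    have h := h3 1 one_ne_zero
    have h0 : a ^ 2 * y ≠ 0 := mul_ne_zero (pow_ne_zero 2 ha) hy
    refine mul_left_cancel₀ h0 ?_
    simp only [pow_one] at h
    have h' : c ^ 2 * (w⁻¹ - 1) * (z - 1) = a ^ 2 * y * (1 - t) * (y - 1) := by
      linear_combination h
    rw [e1] at h'
    field_simp at h'
    have h'' : (1 - w) * (z - 1) = (1 - t) * (y - 1) := by
      refine mul_left_cancel₀ h0 ?_
      linear_combination a ^ 2 * y * h'
    linear_combination a ^ 2 * y * (h'' - e2)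
  have e4 : z ^ 2 + w ^ 2 = y ^ 2 + t ^ 2 := by
    have h := h3 2 two_ne_zero
    have h0 : (a ^ 2 * y) ^ 2 ≠ 0 := pow_ne_zero 2 (mul_ne_zero (pow_ne_zero 2 ha) hy)
    have h' : (c ^ 2) ^ 2 * ((w⁻¹) ^ 2 - 1) * (z ^ 2 - 1) =
        (a ^ 2 * y) ^ 2 * (1 - t ^ 2) * (y ^ 2 - 1) := by
      linear_combination h
    rw [e1] at h'
    have hww : w ^ 2 * ((w⁻¹) ^ 2 - 1) = 1 - w ^ 2 := by
      field_simp
    have h'' : (1 - w ^ 2) * (z ^ 2 - 1) = (1 - t ^ 2) * (y ^ 2 - 1) := by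
      refine mul_left_cancel₀ h0 ?_
      linear_combination h' - (a ^ 2 * y) ^ 2 * (z ^ 2 - 1) * hww
    linear_combination h'' - (y * t + w * z) * e2
  by_contra hne
  have h5 : z + y = t + w := by
    refine mul_left_cancel₀ (sub_ne_zero.2 (Ne.symm hne)) ?_
    linear_combination e4 - (t + w) * e3
  refine hvt (mul_left_cancel₀ two_ne_zero ?_)
  linear_combination h5 + e3

/-! ### Relations between the zeros and poles of adjacent nodes -/

namespace Params

variable {L : ℕ} {P : Params L} {lg : ℂ → ℂ}

/-- The ratio `q_{j+1,j} / q_{j,j}`. -/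
abbrev ratio (P : Params L) (j : Fin L) : ℂ := P.q j.succ j / P.q j.castSucc j

/-- Rows j and j+1 of λ(0) differ only in column j, so dividing their locality equations leaves a
single entry of A(0). -/
lemma MatchEq.column_zero {j : Fin L} (hm : P.MatchEq lg j) (hloc : P.LocalityEq) (l : Fin L) :
    Complex.exp (-(lg (P.ratio j) * P.A 0 j l)) =
      (P.q j.castSucc l / P.p j.castSucc l) / (P.q j.succ l / P.p j.succ l) := by
  rw [← hloc.zero, ← hloc.zero, ← Complex.exp_sub]
  congr 1
  simp only [hm.zero, add_mul, sum_add_distrib, ite_mul, zero_mul, sum_ite_eq', mem_univ, if_true]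
  ring

lemma MatchEq.column_ne_zero {j : Fin L} (hm : P.MatchEq lg j) (hloc : P.LocalityEq) (l : Fin L)
    {m : ℤ} (h : m ≠ 0) :
    (P.q j.castSucc l ^ m - P.p j.castSucc l ^ m) - (P.q j.succ l ^ m - P.p j.succ l ^ m) =
      P.sig j l m * (P.q j.succ j ^ m - P.q j.castSucc j ^ m) := by
  rw [← hloc.ne_zero _ _ m h, ← hloc.ne_zero _ _ m h, sig]
  simp only [hm.ne_zero _ m h, add_mul, sum_add_distrib, ite_mul, zero_mul, sum_ite_eq', mem_univ,
    if_true]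
  ring

lemma castSucc_ne_of_next {k l : Fin L} (h : (k : ℕ) + 1 = l) :
    k.castSucc ≠ l.castSucc ∧ k.castSucc ≠ l.succ ∧ k.succ = l.castSucc ∧
      l.succ ≠ k.castSucc ∧ l.succ ≠ k.succ := by
  refine ⟨?_, ?_, ?_, ?_, ?_⟩ <;> simp [Fin.ext_iff] <;> omega

/-- The equations equivalent to the three conditions, for parameters of the type considered. -/
structure LocalSolution (P : Params L) (lg : ℂ → ℂ) : Prop where
  A_diag : ∀ (m : ℤ), m ≠ 0 → ∀ i, P.A m i i = 1
  A_symm : ∀ (m : ℤ) (i j : Fin L), i ≠ j → P.A m i j = P.A (-m) j i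
  real : ∀ i j, (P.A 0 i j).im = 0
  edge_mem : ∀ k l : Fin L, (k : ℕ) + 1 = l → -1 < P.A0 k l ∧ P.A0 k l < 0
  p_ne_zero : ∀ i j, P.p i j ≠ 0
  q_ne_zero : ∀ i j, P.q i j ≠ 0
  exp_lg : ∀ u : ℂ, u ≠ 0 → Complex.exp (lg u) = u
  norm_ratio : ∀ j : Fin L, ‖P.ratio j‖ ≠ 1
  p_other : ∀ (i : Fin (L + 1)) (j : Fin L), i ≠ j.castSucc → i ≠ j.succ → P.p i j = P.q i j
  locality : P.LocalityEq
  symmetry : P.SymmetryEq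
  matching : ∀ j, P.MatchEq lg j

namespace LocalSolution

lemma ratio_ne_zero (h : P.LocalSolution lg) (j : Fin L) : P.ratio j ≠ 0 :=
  div_ne_zero (h.q_ne_zero _ _) (h.q_ne_zero _ _)

lemma exp_lg_ratio (h : P.LocalSolution lg) (j : Fin L) :
    Complex.exp (lg (P.ratio j)) = P.ratio j := h.exp_lg _ (h.ratio_ne_zero j)

lemma re_lg_ratio (h : P.LocalSolution lg) (j : Fin L) : (lg (P.ratio j)).re ≠ 0 := by
  have := h.norm_ratio j
  rw [← h.exp_lg_ratio] at this
  exact re_ne_zero_of_norm_exp_ne_one this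

lemma q_sub_eq (h : P.LocalSolution lg) (j : Fin L) :
    P.q j.succ j = P.q j.castSucc j * Complex.exp (lg (P.ratio j)) := by
  rw [h.exp_lg_ratio, mul_div_cancel₀ _ (h.q_ne_zero _ _)]

lemma A_eq (h : P.LocalSolution lg) (i j : Fin L) : P.A 0 i j = (P.A0 i j : ℂ) :=
  A0_eq h.real i j

lemma A0_symm (h : P.LocalSolution lg) (i j : Fin L) : P.A0 i j = P.A0 j i := by
  by_cases hij : i = j
  · rw [hij]
  · rw [A0, Matrix.map_apply, h.A_symm 0 i j hij, neg_zero, Matrix.map_apply]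

/-- Evenness in m combines the symmetry of `sig` with A_{i,j}(m) = A_{j,i}(-m). It allows m = 1 and
m = -1 to be compared. -/
lemma sig_neg (h : P.LocalSolution lg) (i j : Fin L) {m : ℤ} (hm : m ≠ 0) :
    P.sig i j (-m) = P.sig i j m := by
  rw [← h.symmetry.symm j i m hm, sig, sig, neg_neg]
  by_cases hij : i = j
  · rw [hij, h.A_diag m hm, h.A_diag (-m) (neg_ne_zero.2 hm)]
    ring
  · rw [h.A_symm (-m) i j hij, neg_neg]
    ring

/-- Of the two rows attached to node k, one has no pole with S_l, and the other is the row shared by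
k and l. So `column_zero` gives q/p at the shared row. -/
lemma p_diag_eq (h : P.LocalSolution lg) {k l : Fin L} (hkl : (k : ℕ) + 1 = l) :
    P.p l.castSucc l =
      P.q l.castSucc l * Complex.exp (-(lg (P.ratio k) * (P.A0 k l : ℂ))) := by
  obtain ⟨h1, h2, h3, -, -⟩ := castSucc_ne_of_next hkl
  have := (h.matching k).column_zero h.locality l
  rw [h.p_other _ _ h1 h2, div_self (h.q_ne_zero _ _), h3, h.A_eq] at this
  rw [this]
  have := h.q_ne_zero l.castSucc l
  field_simp

lemma p_sub_eq (h : P.LocalSolution lg) {k l : Fin L} (hkl : (k : ℕ) + 1 = l) :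
    P.p k.succ k = P.q k.succ k * Complex.exp (lg (P.ratio l) * (P.A0 k l : ℂ)) := by
  obtain ⟨-, -, h3, h1, h2⟩ := castSucc_ne_of_next hkl
  have := (h.matching l).column_zero h.locality k
  rw [h.p_other _ _ h1 h2, div_self (h.q_ne_zero _ _), div_one, ← h3, h.A_eq, h.A0_symm,
    Complex.exp_neg, inv_eq_iff_eq_inv, inv_div] at this
  rw [this, mul_div_cancel₀ _ (h.q_ne_zero _ _)]

lemma column_next (h : P.LocalSolution lg) {k l : Fin L} (hkl : (k : ℕ) + 1 = l) {m : ℤ}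
    (hm : m ≠ 0) : P.p l.castSucc l ^ m - P.q l.castSucc l ^ m =
      P.sig k l m * (P.q k.succ k ^ m - P.q k.castSucc k ^ m) := by
  obtain ⟨h1, h2, h3, -, -⟩ := castSucc_ne_of_next hkl
  rw [← (h.matching k).column_ne_zero h.locality l hm, h.p_other _ _ h1 h2, h3]
  ring

lemma column_prev (h : P.LocalSolution lg) {k l : Fin L} (hkl : (k : ℕ) + 1 = l) {m : ℤ}
    (hm : m ≠ 0) : P.q k.succ k ^ m - P.p k.succ k ^ m =
      P.sig k l m * (P.q l.succ l ^ m - P.q l.castSucc l ^ m) := by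
  obtain ⟨-, -, h3, h1, h2⟩ := castSucc_ne_of_next hkl
  rw [h.symmetry.symm k l m hm, ← (h.matching l).column_ne_zero h.locality k hm,
    h.p_other _ _ h1 h2, ← h3]
  ring

lemma column_diag (h : P.LocalSolution lg) (j : Fin L) {m : ℤ} (hm : m ≠ 0) :
    P.p j.succ j ^ m - P.p j.castSucc j ^ m =
      (P.sig j j m + 1) * (P.q j.succ j ^ m - P.q j.castSucc j ^ m) := by
  rw [add_mul, ← (h.matching j).column_ne_zero h.locality j hm]
  ring

lemma p_diag_ne (h : P.LocalSolution lg) {k l : Fin L} (hkl : (k : ℕ) + 1 = l) :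
    P.p l.castSucc l ≠ P.q l.castSucc l := by
  rw [h.p_diag_eq hkl]
  intro e
  rw [mul_eq_left₀ (h.q_ne_zero _ _), ← neg_mul] at e
  exact (h.edge_mem k l hkl).2.ne (exp_mul_ofReal_eq_one
    (by simpa using h.re_lg_ratio k) e)

lemma p_sub_ne (h : P.LocalSolution lg) {k l : Fin L} (hkl : (k : ℕ) + 1 = l) :
    P.q k.succ k ≠ P.p k.succ k := by
  rw [h.p_sub_eq hkl]
  intro e
  rw [left_eq_mul₀ (h.q_ne_zero _ _)] at e
  exact (h.edge_mem k l hkl).2.ne (exp_mul_ofReal_eq_one (h.re_lg_ratio l) e)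

lemma p_mul_q_diag (h : P.LocalSolution lg) {k l : Fin L} (hkl : (k : ℕ) + 1 = l) :
    P.p l.castSucc l * P.q l.castSucc l = P.q k.castSucc k * P.q k.succ k := by
  have h1 := h.column_next hkl one_ne_zero
  have h2 := h.column_next hkl (m := -1) (by norm_num)
  simp only [zpow_one] at h1
  simp only [zpow_neg_one, h.sig_neg k l one_ne_zero] at h2
  exact mul_eq_mul_of_even (h.q_ne_zero _ _) (h.q_ne_zero _ _) (h.q_ne_zero _ _)
    (h.p_ne_zero _ _) (h.p_diag_ne hkl) h1 h2

lemma q_mul_p_sub (h : P.LocalSolution lg) {k l : Fin L} (hkl : (k : ℕ) + 1 = l) :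
    P.q k.succ k * P.p k.succ k = P.q l.castSucc l * P.q l.succ l := by
  have h1 := h.column_prev hkl one_ne_zero
  have h2 := h.column_prev hkl (m := -1) (by norm_num)
  simp only [zpow_one] at h1
  simp only [zpow_neg_one, h.sig_neg k l one_ne_zero] at h2
  exact mul_eq_mul_of_even (h.q_ne_zero _ _) (h.q_ne_zero _ _) (h.p_ne_zero _ _)
    (h.q_ne_zero _ _) (h.p_sub_ne hkl) h1 h2

/-- The entry `sig k l` is expressed from either end of the edge; eliminating it for every m gives
the hypothesis of `exp_eq_exp_of_edge`. -/
lemma ratio_next (h : P.LocalSolution lg) {k l : Fin L} (hkl : (k : ℕ) + 1 = l) :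
    P.ratio k = P.ratio l := by
  rw [← h.exp_lg_ratio k, ← h.exp_lg_ratio l]
  have e1 := h.p_mul_q_diag hkl
  have e2 := h.q_mul_p_sub hkl
  rw [h.p_diag_eq hkl, h.q_sub_eq k] at e1
  rw [h.p_sub_eq hkl, h.q_sub_eq l, h.q_sub_eq k] at e2
  refine exp_eq_exp_of_edge (h.re_lg_ratio l) (by linarith [(h.edge_mem k l hkl).2])
    (h.q_ne_zero k.castSucc k) e1 (by linear_combination e2) fun m hm => ?_
  have hm' : (m : ℤ) ≠ 0 := by exact_mod_cast hm
  have e3 := h.column_next hkl hm'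
  have e4 := h.column_prev hkl hm'
  simp only [zpow_natCast] at e3 e4
  rw [← h.p_diag_eq hkl, ← h.q_sub_eq, ← h.q_sub_eq, ← h.p_sub_eq hkl]
  linear_combination (P.q l.succ l ^ m - P.q l.castSucc l ^ m) * e3 -
    (P.q k.succ k ^ m - P.q k.castSucc k ^ m) * e4

lemma ratio_eq (h : P.LocalSolution lg) (j k : Fin L) : P.ratio j = P.ratio k := by
  have key : ∀ n (hn : n < L), P.ratio ⟨n, hn⟩ = P.ratio ⟨0, by omega⟩ := by
    intro n
    induction n with
    | zero => exact fun _ => rfl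
    | succ n ih =>
      intro hn
      rw [← ih (by omega)]
      exact (h.ratio_next rfl).symm
  rw [key j j.2, key k k.2]

end LocalSolution

end Params

end DeformedW

namespace DeformedW

open Finset

namespace Params

open Classical

variable {L : ℕ} {P : Params L} {lg : ℂ → ℂ} {u : ℂ}

namespace LocalSolution

/-! ### The nodes -/

/-- If the two zeros differ, the evenness argument applies to `sig j j + 1` and gives the product
relation; if they coincide, the m = 0 equation forces the diagonal entry 1. -/
lemma node_cases (h : P.LocalSolution lg) (hu : ∀ j, lg (P.ratio j) = u) (j : Fin L) :
    (P.p j.succ j = P.p j.castSucc j ∧ P.A0 j j = 1) ∨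
      P.p j.succ j * P.p j.castSucc j = P.q j.castSucc j * P.q j.succ j := by
  by_cases e : P.p j.succ j = P.p j.castSucc j
  · refine Or.inl ⟨e, ?_⟩
    have h1 := (h.matching j).column_zero h.locality j
    have h2 := h.q_sub_eq j
    have h3 := h.re_lg_ratio j
    rw [hu] at h1 h2 h3
    rw [e, h.A_eq, div_div_div_cancel_right₀ (h.p_ne_zero _ _), h2,
      div_mul_cancel_left₀ (h.q_ne_zero _ _), Complex.exp_neg, inv_inj] at h1
    exact exp_mul_ofReal_inj h3 (by simpa using h1)
  · right
    have h1 := h.column_diag j one_ne_zero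
    have h2 := h.column_diag j (m := -1) (by norm_num)
    simp only [zpow_one] at h1
    simp only [zpow_neg_one, h.sig_neg j j one_ne_zero] at h2
    exact mul_eq_mul_of_even (h.q_ne_zero _ _) (h.q_ne_zero _ _) (h.p_ne_zero _ _)
      (h.p_ne_zero _ _) e h1 h2

lemma column_zero_diag (h : P.LocalSolution lg) (hu : ∀ j, lg (P.ratio j) = u) (j : Fin L) :
    Complex.exp (-(u * (P.A0 j j : ℂ))) * P.q j.succ j * P.p j.castSucc j =
      P.q j.castSucc j * P.p j.succ j := by
  have h1 := (h.matching j).column_zero h.locality j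
  have h2 := h.q_ne_zero j.succ j
  have h3 := h.p_ne_zero j.succ j
  have h4 := h.p_ne_zero j.castSucc j
  rw [hu, h.A_eq] at h1
  rw [h1]
  field_simp

lemma node_right (h : P.LocalSolution lg) (hu : ∀ j, lg (P.ratio j) = u) {j : Fin L} {β : ℝ}
    (hp : P.p j.castSucc j = P.q j.castSucc j * Complex.exp (-(u * β))) :
    P.p j.succ j = P.q j.succ j *
        Complex.exp (u * ((if P.A0 j j = 1 then -1 - β else β : ℝ) : ℂ)) ∧
      P.A0 j j = -(β + if P.A0 j j = 1 then -1 - β else β) := by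
  have hre := h.re_lg_ratio j
  have hb := h.q_sub_eq j
  have hq := h.q_ne_zero j.castSucc j
  rw [hu] at hre hb
  rcases h.node_cases hu j with ⟨e, e1⟩ | e
  · rw [if_pos e1, e, hp, hb, mul_assoc, ← Complex.exp_add]
    refine ⟨?_, by rw [e1]; ring⟩
    push_cast
    ring_nf
  · have e1 : P.p j.succ j = P.q j.succ j * Complex.exp (u * β) := by
      rw [hp] at e
      refine mul_left_cancel₀ (mul_ne_zero hq (Complex.exp_ne_zero (-(u * β)))) ?_
      have : Complex.exp (-(u * β)) * Complex.exp (u * β) = 1 := by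
        rw [← Complex.exp_add, neg_add_cancel, Complex.exp_zero]
      linear_combination e - P.q j.castSucc j * P.q j.succ j * this
    have e2 : P.A0 j j = -2 * β := by
      have h1 := h.column_zero_diag hu j
      rw [hp, e1] at h1
      refine exp_mul_ofReal_inj hre ?_
      have h2 : Complex.exp (-(u * (P.A0 j j : ℂ))) * Complex.exp (-(u * β)) =
          Complex.exp (u * β) := by
        refine mul_left_cancel₀ (mul_ne_zero hq (h.q_ne_zero j.succ j)) ?_
        linear_combination h1
      rw [← inv_inj, ← Complex.exp_neg, ← Complex.exp_neg]
      rw [← Complex.exp_add] at h2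
      refine mul_right_cancel₀ (Complex.exp_ne_zero (-(u * β))) ?_
      rw [← Complex.exp_add, h2, ← Complex.exp_add]
      push_cast
      ring_nf
    -- When the diagonal entry is 1 in the product case, -2β = 1, so β = -1/2 is fixed by the
    -- reflection and both descriptions agree.
    split_ifs with h1
    · have : β = -1 - β := by linarith
      rw [← this]
      exact ⟨e1, by linarith⟩
    · exact ⟨e1, by linarith⟩

/-- The mirror image of `node_right`, needed to obtain the added edge to the left of the first node.
-/
lemma node_left (h : P.LocalSolution lg) (hu : ∀ j, lg (P.ratio j) = u) {j : Fin L} {β : ℝ}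
    (hp : P.p j.succ j = P.q j.succ j * Complex.exp (u * β)) :
    P.p j.castSucc j = P.q j.castSucc j *
        Complex.exp (-(u * ((if P.A0 j j = 1 then -1 - β else β : ℝ) : ℂ))) := by
  have hre := h.re_lg_ratio j
  have hb := h.q_sub_eq j
  have hq := h.q_ne_zero j.castSucc j
  rw [hu] at hre hb
  rcases h.node_cases hu j with ⟨e, e1⟩ | e
  · rw [if_pos e1, ← e, hp, hb, mul_assoc, ← Complex.exp_add]
    push_cast
    ring_nf
  · have e1 : P.p j.castSucc j = P.q j.castSucc j * Complex.exp (-(u * β)) := by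
      rw [hp] at e
      refine mul_left_cancel₀ (mul_ne_zero (h.q_ne_zero j.succ j)
        (Complex.exp_ne_zero (u * β))) ?_
      have : Complex.exp (-(u * β)) * Complex.exp (u * β) = 1 := by
        rw [← Complex.exp_add, neg_add_cancel, Complex.exp_zero]
      linear_combination e - P.q j.castSucc j * P.q j.succ j * this
    have e2 := (h.node_right hu e1).2
    split_ifs at e2 ⊢ with h1
    · have h2 := (h.node_right hu e1).1
      rw [if_pos h1, hp] at h2
      have : β = -1 - β :=
        exp_mul_ofReal_inj hre (mul_left_cancel₀ (h.q_ne_zero j.succ j) h2)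
      rw [← this]
      exact e1
    · exact e1

/-! ### The extended diagram -/

variable {hL : 2 ≤ L}

lemma mem_oddSet {M : Matrix (Fin L) (Fin L) ℝ} {j : Fin L} : j ∈ oddSet M ↔ M j j = 1 := by
  simp [oddSet]

lemma edge_zero (M : Matrix (Fin L) (Fin L) ℝ) (j : Fin L) (hj : (j : ℕ) = 0) :
    edge hL M j.castSucc = if M j j = 1 then -1 - edge hL M j.succ else edge hL M j.succ := by
  have h1 : edge hL M j.castSucc = extFirst hL M := by
    rw [edge, Fin.coeSucc_eq_succ, (Fin.ext (by simpa using hj) : j.castSucc = 0)]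
    change extRow hL M j = _
    rw [extRow, if_pos hj]
  have hL0 : 0 < L := by omega
  obtain rfl : j = ⟨0, hL0⟩ := Fin.ext hj
  have h2 : edge hL M (⟨0, by omega⟩ : Fin L).succ = M ⟨0, by omega⟩ ⟨1, by omega⟩ := by
    rw [← edge_castSucc (hL := hL) (M := M) (k := ⟨0, by omega⟩) (l := ⟨1, by omega⟩) rfl]
    rfl
  rw [h1, h2, extFirst]
  exact if_congr mem_oddSet rfl rfl

lemma extA_zero_succ (M : Matrix (Fin L) (Fin L) ℝ) (j : Fin L) :
    extA hL M 0 j.succ = extRow hL M j := rfl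

lemma extA_succ_zero (M : Matrix (Fin L) (Fin L) ℝ) (j : Fin L) :
    extA hL M j.succ 0 = extRow hL M j := rfl

lemma succ_add_one_eq_zero {j : Fin L} (hj : (j : ℕ) + 1 = L) : j.succ + 1 = 0 := by
  have : j.succ = Fin.last L := Fin.ext (by simpa using hj)
  rw [this, Fin.last_add_one]

lemma edge_last_eq (M : Matrix (Fin L) (Fin L) ℝ) {j : Fin L} (hj : (j : ℕ) + 1 = L) :
    edge hL M j.succ = extLast hL M := by
  rw [edge, succ_add_one_eq_zero hj, extA_succ_zero, extRow, if_neg (by omega), if_pos (by omega)]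

lemma edge_last (M : Matrix (Fin L) (Fin L) ℝ) (hM : ∀ i j, M i j = M j i) (j : Fin L)
    (hj : (j : ℕ) + 1 = L) :
    edge hL M j.succ = if M j j = 1 then -1 - edge hL M j.castSucc else edge hL M j.castSucc := by
  have hL1 : L - 1 < L := by omega
  obtain rfl : j = ⟨L - 1, hL1⟩ := Fin.ext (by simp; omega)
  rw [edge_last_eq M hj, extLast, hM _ ⟨L - 2, by omega⟩,
    edge_castSucc (k := ⟨L - 2, by omega⟩) (by simp; omega)]
  exact if_congr mem_oddSet rfl rfl

/-- An interior edge value comes from the left neighbour. At the first node it is propagated from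
the right, and `extFirst` is defined by just this rule. -/
lemma p_edge (h : P.LocalSolution lg) (hu : ∀ j, lg (P.ratio j) = u) (j : Fin L) :
    P.p j.castSucc j =
      P.q j.castSucc j * Complex.exp (-(u * (edge hL P.A0 j.castSucc : ℂ))) := by
  by_cases hj : (j : ℕ) = 0
  · rw [edge_zero P.A0 j hj]
    refine h.node_left hu ?_
    have h1 : (j : ℕ) + 1 = (⟨1, by omega⟩ : Fin L) := by simp [hj]
    rw [h.p_sub_eq h1, hu, ← edge_castSucc (hL := hL) (M := P.A0) h1,
      (castSucc_ne_of_next h1).2.2.1]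
  · have h1 : ((⟨j - 1, by omega⟩ : Fin L) : ℕ) + 1 = j := by simp; omega
    rw [h.p_diag_eq h1, hu, edge_castSucc h1]

lemma edge_succ (h : P.LocalSolution lg) (hu : ∀ j, lg (P.ratio j) = u) (j : Fin L) :
    edge hL P.A0 j.succ =
      if P.A0 j j = 1 then -1 - edge hL P.A0 j.castSucc else edge hL P.A0 j.castSucc := by
  by_cases hj : (j : ℕ) + 1 = L
  · exact edge_last P.A0 h.A0_symm j hj
  · have h1 : (j : ℕ) + 1 = (⟨j + 1, by omega⟩ : Fin L) := rfl
    have h2 := (h.node_right hu (h.p_edge (hL := hL) hu j)).1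
    rw [h.p_sub_eq h1, hu, ← edge_castSucc (hL := hL) (M := P.A0) h1,
      ← (castSucc_ne_of_next h1).2.2.1] at h2
    have hre := h.re_lg_ratio j
    rw [hu] at hre
    exact exp_mul_ofReal_inj hre (mul_left_cancel₀ (h.q_ne_zero _ _) h2)

lemma p_edge' (h : P.LocalSolution lg) (hu : ∀ j, lg (P.ratio j) = u) (j : Fin L) :
    P.p j.succ j = P.q j.succ j * Complex.exp (u * (edge hL P.A0 j.succ : ℂ)) := by
  rw [h.edge_succ hu]
  exact (h.node_right hu (h.p_edge hu j)).1

lemma A0_diag (h : P.LocalSolution lg) (hu : ∀ j, lg (P.ratio j) = u) (j : Fin L) :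
    P.A0 j j = -(edge hL P.A0 j.castSucc + edge hL P.A0 j.succ) := by
  rw [h.edge_succ hu]
  exact (h.node_right hu (h.p_edge hu j)).2

lemma A0_far (h : P.LocalSolution lg) (k l : Fin L) (hkl : 2 ≤ |(k : ℤ) - (l : ℤ)|) :
    P.A0 k l = 0 := by
  have h1 := (h.matching k).column_zero h.locality l
  rw [le_abs] at hkl
  rw [h.p_other k.castSucc l (by simp only [ne_eq, Fin.ext_iff, Fin.val_castSucc]; omega)
    (by simp only [ne_eq, Fin.ext_iff, Fin.val_castSucc, Fin.val_succ]; omega),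
    h.p_other k.succ l (by simp only [ne_eq, Fin.ext_iff, Fin.val_castSucc, Fin.val_succ]; omega)
    (by simp only [ne_eq, Fin.ext_iff, Fin.val_succ]; omega), div_self (h.q_ne_zero _ _),
    div_self (h.q_ne_zero _ _), div_one, h.A_eq, ← neg_mul] at h1
  exact exp_mul_ofReal_eq_one (by simpa using h.re_lg_ratio k) h1

/-- The edges alternate along the odd nodes. -/
lemma edge_val (h : P.LocalSolution lg) (hu : ∀ j, lg (P.ratio j) = u) (t : ℕ) (ht : t < L + 1) :
    edge hL P.A0 ⟨t, ht⟩ = if Even ((oddSet P.A0).filter fun j : Fin L => (j : ℕ) < t).card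
      then edge hL P.A0 0 else -1 - edge hL P.A0 0 := by
  induction t with
  | zero => simp
  | succ t ih =>
    have h1 := h.edge_succ (hL := hL) hu ⟨t, by omega⟩
    have h2 : (⟨t, by omega⟩ : Fin L).castSucc = (⟨t, by omega⟩ : Fin (L + 1)) := rfl
    have h3 : (⟨t, by omega⟩ : Fin L).succ = (⟨t + 1, ht⟩ : Fin (L + 1)) := rfl
    rw [h2, h3, ih (by omega)] at h1
    rw [h1]
    by_cases hm : P.A0 ⟨t, by omega⟩ ⟨t, by omega⟩ = 1
    · have e : (oddSet P.A0).filter (fun j : Fin L => (j : ℕ) < t + 1) =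
          insert ⟨t, by omega⟩ ((oddSet P.A0).filter fun j : Fin L => (j : ℕ) < t) := by
        ext j
        simp only [mem_filter, mem_insert, mem_oddSet, Fin.ext_iff]
        constructor
        · rintro ⟨hj, hjt⟩
          by_cases hj' : (j : ℕ) = t
          · exact Or.inl hj'
          · exact Or.inr ⟨hj, by omega⟩
        · rintro (hj | ⟨hj, hjt⟩)
          · have hj' : j = ⟨t, by omega⟩ := Fin.ext hj
            exact ⟨by rw [hj']; exact hm, by omega⟩
          · exact ⟨hj, by omega⟩
      rw [e, card_insert_of_notMem (by simp), if_pos hm]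
      simp only [Nat.even_add_one, ite_not]
      split_ifs <;> ring
    · have e : (oddSet P.A0).filter (fun j : Fin L => (j : ℕ) < t + 1) =
          (oddSet P.A0).filter fun j : Fin L => (j : ℕ) < t := by
        ext j
        simp only [mem_filter, mem_oddSet]
        refine ⟨fun ⟨hj, hjt⟩ => ⟨hj, ?_⟩, fun ⟨hj, hjt⟩ => ⟨hj, by omega⟩⟩
        rcases Nat.lt_succ_iff_lt_or_eq.1 hjt with h' | h'
        · exact h'
        · have hj' : j = ⟨t, by omega⟩ := Fin.ext h'
          rw [hj'] at hj
          exact absurd hj hm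
      rw [e, if_neg hm]

lemma edge_mem_pair (h : P.LocalSolution lg) (hu : ∀ j, lg (P.ratio j) = u) (t : Fin (L + 1)) :
    edge hL P.A0 t = P.A0 ⟨0, by omega⟩ ⟨1, by omega⟩ ∨
      edge hL P.A0 t = -1 - P.A0 ⟨0, by omega⟩ ⟨1, by omega⟩ := by
  have h1 := h.edge_val (hL := hL) hu 1 (by omega)
  have h2 := h.edge_val (hL := hL) hu t t.2
  have h3 : edge hL P.A0 ⟨1, by omega⟩ = P.A0 ⟨0, by omega⟩ ⟨1, by omega⟩ :=
    edge_castSucc (k := (⟨0, by omega⟩ : Fin L)) (l := ⟨1, by omega⟩) rfl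
  rw [h3] at h1
  rw [h1, h2]
  split_ifs
  · exact Or.inl rfl
  · exact Or.inr (by ring)
  · exact Or.inr rfl
  · exact Or.inl rfl

/-- Going once around the diagram reflects the edge value once per odd node; when K is odd, the
added node is declared odd to close the cycle. -/
lemma edge_wrap (h : P.LocalSolution lg) (hu : ∀ j, lg (P.ratio j) = u) :
    edge hL P.A0 0 = if Even (oddSet P.A0).card then edge hL P.A0 (Fin.last L)
      else -1 - edge hL P.A0 (Fin.last L) := by
  have h1 := h.edge_val (hL := hL) hu L (Nat.lt_succ_self L)
  rw [filter_true_of_mem (fun j _ => j.2)] at h1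
  change edge hL P.A0 (Fin.last L) = _ at h1
  rw [h1]
  split_ifs <;> ring

lemma zero_mem_oddHat (M : Matrix (Fin L) (Fin L) ℝ) :
    (0 : Fin (L + 1)) ∈ oddHat M ↔ ¬ Even (oddSet M).card := by
  rw [oddHat]
  split_ifs with h <;> simp [h, Fin.succ_ne_zero]

/-- The reflection β ↦ -1 - β exchanges -1/r and (1-r)/r, so propagating one admissible edge value
around the cycle yields only these two. -/
lemma isExtendedCartan (h : P.LocalSolution lg) (hu : ∀ j, lg (P.ratio j) = u) {r : ℝ}
    (hr : 1 < r) (hβ : P.A0 ⟨0, by omega⟩ ⟨1, by omega⟩ = -1 / r ∨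
      P.A0 ⟨0, by omega⟩ ⟨1, by omega⟩ = (1 - r) / r) : IsExtendedCartan hL P.A0 r := by
  have hr' : r ≠ 0 := by linarith
  have hval : ∀ t, edge hL P.A0 t = -1 / r ∨ edge hL P.A0 t = (1 - r) / r := by
    intro t
    have e1 : -1 - -1 / r = (1 - r) / r := by field_simp; ring
    have e2 : -1 - (1 - r) / r = -1 / r := by field_simp; ring
    rcases hβ with e | e <;> rcases h.edge_mem_pair (hL := hL) hu t with e' | e' <;> rw [e'] <;>
      rw [e] <;> simp only [e1, e2] <;> tauto
  have hmul : ∀ t, -2 * edge hL P.A0 t =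
      if edge hL P.A0 t = -1 / r then 2 / r else 2 * (r - 1) / r := by
    intro t
    split_ifs with e
    · rw [e]
      ring
    · rw [(hval t).resolve_left e]
      ring
  have hlast : (⟨L - 1, by omega⟩ : Fin L).succ = Fin.last L := Fin.ext (by simp; omega)
  have hzero : (0 : Fin (L + 1)) - 1 = Fin.last L := by
    rw [sub_eq_iff_eq_add, Fin.last_add_one]
  refine ⟨fun i => ?_, fun t => ⟨hval t, ?_⟩, fun i => ?_, fun k l hkl => h.A0_far k l hkl,
    fun l h0 hl => ?_⟩
  · refine Fin.cases ?_ (fun j => ?_) i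
    · change extCorner hL P.A0 = _
      rw [hzero, ← hmul, extCorner, ← hlast, edge_last_eq P.A0 (by simp; omega)]
      by_cases hK : Even (oddSet P.A0).card
      · rw [if_pos hK, if_neg (by rwa [zero_mem_oddHat, not_not])]
      · rw [if_neg hK, if_pos (by rwa [zero_mem_oddHat])]
    · change P.A0 j j = _
      rw [succ_sub_one, ← hmul]
      by_cases hj : P.A0 j j = 1
      · rw [if_pos (mem_oddHat_succ.2 (mem_oddSet.2 hj)), hj]
      · rw [if_neg (mt (fun e => mem_oddSet.1 (mem_oddHat_succ.1 e)) hj), h.A0_diag (hL := hL) hu,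
          h.edge_succ hu, if_neg hj]
        ring
  · induction t using Fin.lastCases with
    | last =>
      rw [edge, Fin.last_add_one, ← hlast, extA_zero_succ, extA_succ_zero]
    | cast j =>
      rw [edge, Fin.coeSucc_eq_succ]
      by_cases hj : (j : ℕ) = 0
      · rw [(Fin.ext (by simpa using hj) : j.castSucc = 0), extA_zero_succ, extA_succ_zero]
      · have e : j.castSucc = (⟨j - 1, by omega⟩ : Fin L).succ := Fin.ext (by simp; omega)
        rw [e]
        exact h.A0_symm _ _
  · refine Fin.cases ?_ (fun j => ?_) i
    · rw [hzero, h.edge_wrap hu]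
      by_cases hK : Even (oddSet P.A0).card
      · rw [if_pos hK, if_neg (by rwa [zero_mem_oddHat, not_not])]
      · rw [if_neg hK, if_pos (by rwa [zero_mem_oddHat])]
    · rw [succ_sub_one, h.edge_succ hu]
      by_cases hj : P.A0 j j = 1
      · rw [if_pos hj, if_pos (mem_oddHat_succ.2 (mem_oddSet.2 hj))]
      · rw [if_neg hj, if_neg (mt (fun e => mem_oddSet.1 (mem_oddHat_succ.1 e)) hj)]
  · rw [extA_zero_succ, extA_succ_zero, extRow, if_neg h0, if_neg hl]
    exact ⟨rfl, rfl⟩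

/-- Solving β = (1-r)/r or β = -1/r for r gives the two branches, and r > 1 in both since -1 < β <
0. The comparison of edge counts only selects one of them. -/
lemma rParam_spec {M : Matrix (Fin L) (Fin L) ℝ}
    (hβ : -1 < M ⟨0, by omega⟩ ⟨1, by omega⟩ ∧ M ⟨0, by omega⟩ ⟨1, by omega⟩ < 0) :
    1 < rParam hL M ∧ (M ⟨0, by omega⟩ ⟨1, by omega⟩ = -1 / rParam hL M ∨
      M ⟨0, by omega⟩ ⟨1, by omega⟩ = (1 - rParam hL M) / rParam hL M) := by
  simp only [rParam]
  generalize M ⟨0, by omega⟩ ⟨1, by omega⟩ = β at *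
  obtain ⟨h1, h2⟩ := hβ
  split_ifs
  · refine ⟨by rw [lt_div_iff₀ (by linarith)]; linarith, Or.inr ?_⟩
    have : 1 + β ≠ 0 := by linarith
    field_simp
    ring
  · refine ⟨by rw [lt_div_iff_of_neg h2]; linarith, Or.inl ?_⟩
    field_simp

end LocalSolution

end Params

end DeformedW

namespace DeformedW

/-! ### From the equations to the weight form -/

open Finset

/-- The diagonal value is written as a sum of contributions of the two adjacent edges, the shape in
which `column_ne_zero` produces it. -/
lemma nodeSig_mul {L : ℕ} {r : ℝ} {η : ℂ} {d : ℕ → ℝ} (hη : ‖Complex.exp η‖ ≠ 1) (hr : 1 < r)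
    (hd : IsWeight L r d) {l : ℕ} (hl : l < L) {m : ℤ} (hm : m ≠ 0) :
    nodeSig r η d l m * nint η (r * m) =
      -(xpow η (-(d l * m)) * nint η ((r - d l) * m) +
        xpow η (d (l + 1) * m) * nint η ((r - d (l + 1)) * m)) := by
  have hm' : (m : ℝ) ≠ 0 := Int.cast_ne_zero.2 hm
  have h1 : nint η (r * m) ≠ 0 := nint_ne_zero hη (mul_ne_zero (by linarith) hm')
  have h2 : nint η (d (l + 1) * m) ≠ 0 := nint_ne_zero hη (mul_ne_zero (hd.pos hr hl).ne' hm')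
  have h3 : nodeSig r η d l m * nint η (r * m) =
      -(nint η ((r - d l) * m) * nint η ((d l + d (l + 1)) * m) / nint η (d (l + 1) * m)) := by
    rw [nodeSig]
    generalize nint η (r * m) = R at *
    generalize nint η (d (l + 1) * m) = R' at *
    field_simp
  rw [h3, neg_inj, div_eq_iff h2]
  rcases hd.eq_or_add_eq hl with h | h
  · rw [h, add_mul (d (l + 1)), nint_two_mul]
    ring
  · rw [h, show r - d l = d (l + 1) by linarith, show r - d (l + 1) = d l by linarith,
      show r * (m : ℝ) = d l * m + d (l + 1) * m by rw [← h]; ring]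
    simp only [nint, neg_add, xpow_add, xpow_neg]
    have ha := xpow_ne_zero (η := η) (d l * m)
    have hb := xpow_ne_zero (η := η) (d (l + 1) * m)
    generalize xpow η (d l * m) = a at *
    generalize xpow η (d (l + 1) * m) = b at *
    field_simp
    ring

namespace Params

open Classical

variable {L : ℕ} {P : Params L} {lg : ℂ → ℂ} {u : ℂ} {hL : 2 ≤ L}

lemma det_change_ne_zero {t : ℂ} {α : Fin L → ℤ → ℂ} {ε : Fin L → ℤˣ} {ν : Fin L → ℂ}
    (hα : ∀ j m, α j m ≠ 0 ∧ α j (-m) = (α j m)⁻¹) {m : ℤ} (h : (P.A m).det ≠ 0) :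
    ((P.change t α ε ν).A m).det ≠ 0 := by
  have e : (P.change t α ε ν).A m =
      Matrix.diagonal (fun j => (α j m)⁻¹) * P.A m * Matrix.diagonal fun j => α j m := by
    ext k l
    rw [change_A, Matrix.mul_diagonal, Matrix.diagonal_mul]
  rw [e, Matrix.det_mul, Matrix.det_mul, Matrix.det_diagonal, Matrix.det_diagonal]
  exact mul_ne_zero (mul_ne_zero (prod_ne_zero_iff.2 fun j _ => inv_ne_zero (hα j m).1) h)
    (prod_ne_zero_iff.2 fun j _ => (hα j m).1)

namespace LocalSolution

lemma change (h : P.LocalSolution lg) {t : ℂ} {α : Fin L → ℤ → ℂ} {ε : Fin L → ℤˣ}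
    {ν : Fin L → ℂ} (ht : t ≠ 0) (hα : ∀ j m, α j m ≠ 0 ∧ α j (-m) = (α j m)⁻¹)
    (hα0 : ∀ j, α j 0 = 1)
    (hν : ∀ j, ∃ n : ℤ, ∑ k, ν k * P.A 0 k j = 2 * Real.pi * Complex.I * n) :
    (P.change t α ε ν).LocalSolution lg where
  A_diag m hm i := by
    rw [change_A, h.A_diag m hm, mul_one, inv_mul_cancel₀ (hα i m).1]
  A_symm m i j hij := (change_A_symm hα).2 (h.A_symm m i j hij)
  real := by rw [change_A_zero hα0]; exact h.real
  edge_mem := by rw [change_A0 hα0]; exact h.edge_mem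
  p_ne_zero i j := mul_ne_zero (sgn_ne_zero j) (mul_ne_zero ht (h.p_ne_zero i j))
  q_ne_zero i j := mul_ne_zero (sgn_ne_zero j) (mul_ne_zero ht (h.q_ne_zero i j))
  exp_lg := h.exp_lg
  norm_ratio j := by rw [ratio, change_q_div ht]; exact h.norm_ratio j
  p_other i j h1 h2 := (change_p_eq_q ht i j).2 (h.p_other i j h1 h2)
  locality := (localityEq_change ht hα hα0 hν).2 h.locality
  symmetry := (symmetryEq_change hα).2 h.symmetry
  matching j := (matchEq_change ht hα hα0 lg j).2 (h.matching j)

section Chain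

variable {r : ℝ} {η : ℂ}

lemma exp_mul_edge (hM : IsExtendedCartan hL P.A0 r) (hr : 1 < r) (hη : 2 * r * η = u)
    (t : Fin (L + 1)) : Complex.exp (u * (edge hL P.A0 t : ℂ)) =
      xpow η (2 * (weight hL P.A0 r t - r)) := by
  have hr' : (r : ℂ) ≠ 0 := by exact_mod_cast (by linarith : r ≠ 0)
  rw [hM.edge_eq, ← hη, xpow]
  congr 1
  push_cast
  field_simp

lemma exp_eq_xpow (hη : 2 * r * η = u) : Complex.exp u = xpow η (2 * r) := by
  rw [xpow, ← hη]
  push_cast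
  rfl

lemma q_sub_eq_mul (h : P.LocalSolution lg) (hu : ∀ j, lg (P.ratio j) = u) (hη : 2 * r * η = u)
    (j : Fin L) : P.q j.succ j = P.q j.castSucc j * xpow η (2 * r) := by
  rw [h.q_sub_eq, hu, exp_eq_xpow hη]

lemma p_diag_eq_mul (h : P.LocalSolution lg) (hu : ∀ j, lg (P.ratio j) = u)
    (hM : IsExtendedCartan hL P.A0 r) (hr : 1 < r) (hη : 2 * r * η = u) (j : Fin L) :
    P.p j.castSucc j = P.q j.castSucc j * xpow η (2 * (r - weight hL P.A0 r j)) := by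
  rw [h.p_edge (hL := hL) hu, Complex.exp_neg, exp_mul_edge hM hr hη, ← xpow_neg,
    Fin.val_castSucc]
  ring_nf

lemma p_sub_eq_mul (h : P.LocalSolution lg) (hu : ∀ j, lg (P.ratio j) = u)
    (hM : IsExtendedCartan hL P.A0 r) (hr : 1 < r) (hη : 2 * r * η = u) (j : Fin L) :
    P.p j.succ j = P.q j.castSucc j * xpow η (2 * weight hL P.A0 r (j + 1)) := by
  rw [h.p_edge' (hL := hL) hu, h.q_sub_eq_mul hu hη, mul_assoc, exp_mul_edge hM hr hη,
    ← xpow_add, Fin.val_succ]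
  ring_nf

/-- The zeros `q_{j,j}` are determined up to signs by the first one. -/
lemma exists_sign (h : P.LocalSolution lg) (hu : ∀ j, lg (P.ratio j) = u)
    (hM : IsExtendedCartan hL P.A0 r) (hr : 1 < r) (hη : 2 * r * η = u) :
    ∃ t : ℂ, t ≠ 0 ∧ ∀ j : Fin L, ∃ ε : ℤˣ, ((ε : ℤ) : ℂ) * (t * P.q j.castSucc j) =
      xpow η (wsum (weight hL P.A0 r) (j + 1) - weight hL P.A0 r 0) := by
  have hL0 : 0 < L := by omega
  set j₀ : Fin L := ⟨0, hL0⟩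
  -- The relation p_{l,l} q_{l,l} = q_{k,k} q_{l,k}, for l = k + 1, only gives q_{l,l}² = q_{k,k}²
  -- x^{2 d_l}. The undetermined sign is the freedom in the variable of S_l.
  have hsq : ∀ n (hn : n < L), P.q (⟨n, hn⟩ : Fin L).castSucc ⟨n, hn⟩ ^ 2 =
      (P.q j₀.castSucc j₀ *
        xpow η (wsum (weight hL P.A0 r) (n + 1) - weight hL P.A0 r 0)) ^ 2 := by
    intro n
    induction n with
    | zero =>
      intro hn
      rw [wsum_one, sub_self, xpow_zero, mul_one]
    | succ n ih =>
      intro hn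
      have e1 := h.p_mul_q_diag (k := ⟨n, by omega⟩) (l := ⟨n + 1, hn⟩) rfl
      rw [h.p_diag_eq_mul hu hM hr hη, h.q_sub_eq_mul hu hη] at e1
      have e2 := ih (by omega)
      rw [wsum_succ (n + 1), add_sub_right_comm, xpow_add]
      have e3 : xpow η (2 * (r - weight hL P.A0 r (n + 1))) *
          xpow η (weight hL P.A0 r (n + 1)) ^ 2 = xpow η (2 * r) := by
        rw [sq, ← xpow_add, ← xpow_add]
        ring_nf
      refine mul_left_cancel₀ (xpow_ne_zero (η := η) (2 * (r - weight hL P.A0 r (n + 1)))) ?_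
      linear_combination e1 + xpow η (2 * r) * e2 - (P.q j₀.castSucc j₀ *
        xpow η (wsum (weight hL P.A0 r) (n + 1) - weight hL P.A0 r 0)) ^ 2 * e3
  have hq := h.q_ne_zero j₀.castSucc j₀
  refine ⟨(P.q j₀.castSucc j₀)⁻¹, inv_ne_zero hq, fun j => ?_⟩
  rcases sq_eq_sq_iff_eq_or_eq_neg.1 (hsq j j.2) with e | e
  · refine ⟨1, ?_⟩
    rw [Fin.eta] at e
    rw [e, inv_mul_cancel_left₀ hq]
    simp
  · refine ⟨-1, ?_⟩
    rw [Fin.eta] at e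
    rw [e, mul_neg, inv_mul_cancel_left₀ hq]
    simp

/-- Once the q_{j,j} are normalized, the edge values give the remaining zeros and poles, and the
column equations can be solved for `sig` because x^{rm} ≠ x^{-rm}. -/
lemma chainForm (h : P.LocalSolution lg) (hu : ∀ j, lg (P.ratio j) = u)
    (hM : IsExtendedCartan hL P.A0 r) (hr : 1 < r) (hη : 2 * r * η = u)
    (hx : ‖Complex.exp η‖ ≠ 1) (hq : ∀ j : Fin L, P.q j.castSucc j =
      xpow η (wsum (weight hL P.A0 r) (j + 1) - weight hL P.A0 r 0)) :
    P.ChainForm r η (weight hL P.A0 r) := by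
  have hb : ∀ j : Fin L, P.q j.succ j =
      xpow η (2 * r + wsum (weight hL P.A0 r) (j + 1) - weight hL P.A0 r 0) := fun j => by
    rw [h.q_sub_eq_mul hu hη, hq, ← xpow_add]
    ring_nf
  have hp : ∀ j : Fin L, P.p j.castSucc j = xpow η (wsum (weight hL P.A0 r) (j + 1) -
      weight hL P.A0 r 0 + 2 * (r - weight hL P.A0 r j)) := fun j => by
    rw [h.p_diag_eq_mul hu hM hr hη, hq, ← xpow_add]
  have hp' : ∀ j : Fin L, P.p j.succ j = xpow η (2 * r + wsum (weight hL P.A0 r) (j + 1) -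
      weight hL P.A0 r 0 - 2 * (r - weight hL P.A0 r (j + 1))) := fun j => by
    rw [h.p_sub_eq_mul hu hM hr hη, hq, ← xpow_add]
    ring_nf
  have hba : ∀ (j : Fin L) (m : ℤ), P.q j.succ j ^ m - P.q j.castSucc j ^ m =
      xpow η ((wsum (weight hL P.A0 r) (j + 1) - weight hL P.A0 r 0 + r) * m) *
        nint η (r * m) := fun j m => by
    rw [hb, hq, xpow_zpow, xpow_zpow, xpow_mul_nint]
    ring_nf
  have hnr : ∀ m : ℤ, m ≠ 0 → nint η (r * m) ≠ 0 := fun m hm =>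
    nint_ne_zero hx (mul_ne_zero (by linarith) (Int.cast_ne_zero.2 hm))
  have hnext : ∀ (k l : Fin L) (m : ℤ), m ≠ 0 → (k : ℕ) + 1 = l →
      P.sig k l m = edgeSig r η (weight hL P.A0 r) l m := by
    intro k l m hm hkl
    have e := h.column_next hkl hm
    have e1 := xpow_ne_zero (η := η)
      ((wsum (weight hL P.A0 r) (k + 1) - weight hL P.A0 r 0 + r) * m)
    rw [edgeSig, eq_div_iff (hnr m hm)]
    refine mul_left_cancel₀ e1 ?_
    rw [hba] at e
    rw [mul_left_comm, ← e, hp, hq, xpow_zpow, xpow_zpow, xpow_mul_nint, wsum_succ l, ← hkl]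
    ring_nf
  exact
  { zero_diag := fun j => by rw [h.A_eq, hM.diag hr]
    zero_next := fun k l hkl => by rw [h.A_eq, hM.next hkl]
    zero_prev := fun k l hkl => by rw [h.A_eq, hM.prev hkl]
    zero_far := fun k l hkl => by rw [h.A_eq, h.A0_far k l hkl, Complex.ofReal_zero]
    sig_diag := fun j m hm => by
      have e := (h.matching j).column_ne_zero h.locality j hm
      have e1 := xpow_ne_zero (η := η)
        ((wsum (weight hL P.A0 r) (j + 1) - weight hL P.A0 r 0 + r) * m)
      refine mul_left_cancel₀ (mul_ne_zero e1 (hnr m hm)) ?_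
      rw [← hba, mul_comm, ← e, hba, mul_assoc, mul_comm (nint η (r * m)),
        nodeSig_mul hx hr isWeight_weight j.2 hm, hq, hp, hb, hp']
      simp only [xpow_zpow]
      rw [mul_neg, mul_add, ← mul_assoc, ← xpow_add, ← mul_assoc, ← xpow_add, xpow_mul_nint,
        xpow_mul_nint]
      ring_nf
    sig_next := hnext
    sig_prev := fun k l m hm hkl => by rw [h.symmetry.symm l k m hm, hnext k l m hm hkl]
    sig_far := fun k l m hm hkl => h.symmetry.far k l hkl m hm
    q_diag := hq
    q_sub := hb
    p_diag := hp
    p_sub := hp'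
    p_other := h.p_other }

/-- A vanishing s_j(m) would make the locality equation at -m say q^{-m} = p^{-m}, whereas p/q is a
nonzero real power of x and |x| ≠ 1. -/
lemma s_ne_zero (h : P.LocalSolution lg) (hu : ∀ j, lg (P.ratio j) = u)
    (hM : IsExtendedCartan hL P.A0 r) (hr : 1 < r) (hη : 2 * r * η = u)
    (hx : ‖Complex.exp η‖ ≠ 1) (j : Fin L) {m : ℤ} (hm : m ≠ 0) : P.s j m ≠ 0 := by
  intro hs
  have e := h.locality.ne_zero j.castSucc j (-m) (neg_ne_zero.2 hm)
  rw [neg_neg, hs, mul_zero, h.p_diag_eq_mul hu hM hr hη, mul_zpow, eq_comm, sub_eq_zero,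
    left_eq_mul₀ (zpow_ne_zero _ (h.q_ne_zero _ _)), xpow_zpow, xpow, ] at e
  have e1 := exp_mul_ofReal_eq_one (u := η) (re_ne_zero_of_norm_exp_ne_one hx)
    (by rw [mul_comm]; exact e)
  have e2 := (isWeight_weight (hL := hL) (M := P.A0)).lt hr j.2.le
  have e3 : ((-m : ℤ) : ℝ) ≠ 0 := Int.cast_ne_zero.2 (neg_ne_zero.2 hm)
  rcases mul_eq_zero.1 e1 with e4 | e4
  · linarith
  · exact e3 e4

/-- For m ≠ 0 the locality system has a unique solution, since A(m) is invertible. For m = 0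
locality holds only up to 2πiℤ, so row 0 is taken as given and the other rows follow by matching. -/
lemma lamForm (h : P.LocalSolution lg) (hu : ∀ j, lg (P.ratio j) = u) (hr : 1 < r)
    (hη : 2 * r * η = u) (hx : ‖Complex.exp η‖ ≠ 1) {d : ℕ → ℝ} (hd : IsWeight L r d)
    (hc : P.ChainForm r η d) (hs : ∀ (j : Fin L) (m : ℤ), m ≠ 0 → P.s j m ≠ 0)
    (hdet : ∀ m, (P.A m).det ≠ 0) (hz : ∀ k : Fin L, P.lam 0 k 0 = zeroPhi L r η d 0 (k + 1)) :
    P.LamForm r η d where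
  zero i k := by
    induction i using Fin.induction with
    | zero => exact hz k
    | succ j ih =>
      rw [(h.matching j).zero, ih, Fin.val_succ, zeroPhi_succ hr hd, hu, hη, Fin.val_castSucc]
      simp only [Fin.ext_iff]
  ne_zero i k m hm := by
    have e : (fun k => P.lam i k m - P.s k m * oscPhi L r η d i (k + 1) m) = 0 := by
      refine Matrix.eq_zero_of_vecMul_eq_zero (hdet m) (funext fun l => ?_)
      have e1 := h.locality.ne_zero i l m hm
      rw [← hc.sum_oscPhi hx hr hd i l hm] at e1
      have e2 := mul_right_cancel₀ (hs l _ (neg_ne_zero.2 hm)) e1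
      rw [Pi.zero_apply, Matrix.vecMul, dotProduct]
      simp only [sub_mul, sum_sub_distrib]
      rw [e2, sub_self]
    exact sub_eq_zero.1 (congrFun e k)

end Chain

end LocalSolution

end Params

end DeformedW

namespace DeformedW

open Finset

/-! ### Activity of all nodes and the end of part (i) -/

namespace Params

open Classical

variable {L : ℕ} {P : Params L} {lg : ℂ → ℂ} {hL : 2 ≤ L}

/-- If one of the screening currents has a nontrivial commutator, then all of them do. -/
lemma matchEq_of_active (hlg : ∀ u : ℂ, u ≠ 0 → Complex.exp (lg u) = u)
    (hq : ∀ i j, P.q i j ≠ 0) (hsymm : ∀ i j, P.A 0 i j = P.A 0 j i)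
    (hreal : ∀ i j, (P.A 0 i j).im = 0)
    (hedge : ∀ k l : Fin L, (k : ℕ) + 1 = l → -1 < P.A0 k l ∧ P.A0 k l < 0)
    (hnorm : ∀ j : Fin L, ‖P.ratio j‖ ≠ 1)
    (hother : ∀ (i : Fin (L + 1)) (j : Fin L), i ≠ j.castSucc → i ≠ j.succ → P.p i j = P.q i j)
    (hloc : P.LocalityEq)
    (hact : ∀ j : Fin L, (P.p j.castSucc j ≠ P.q j.castSucc j ∨ P.p j.succ j ≠ P.q j.succ j) →
      P.MatchEq lg j)
    (hne : ∃ i j, P.p i j ≠ P.q i j) (j : Fin L) : P.MatchEq lg j := by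
  have hexp : ∀ k l : Fin L, P.A0 k l ≠ 0 →
      Complex.exp (-(lg (P.ratio k) * P.A 0 k l)) ≠ 1 := by
    intro k l hkl e
    have h1 : P.ratio k ≠ 0 := div_ne_zero (hq _ _) (hq _ _)
    have h2 := hnorm k
    rw [← hlg _ h1] at h2
    rw [A0_eq hreal, ← neg_mul] at e
    exact hkl (exp_mul_ofReal_eq_one
      (by simpa using re_ne_zero_of_norm_exp_ne_one h2) e)
  -- If the row shared with the active node had no pole at the neighbour, `column_zero` would give
  -- an exponential equal to 1, although the edge entry of A(0) is nonzero.
  have hup : ∀ k l : Fin L, (k : ℕ) + 1 = l → P.MatchEq lg k → P.MatchEq lg l := by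
    intro k l hkl hk
    obtain ⟨h1, h2, h3, -, -⟩ := castSucc_ne_of_next hkl
    refine hact l (Or.inl fun e => hexp k l (hedge k l hkl).2.ne ?_)
    rw [hk.column_zero hloc l, hother _ _ h1 h2, div_self (hq _ _), h3, e, div_self (hq _ _),
      div_one]
  have hdown : ∀ k l : Fin L, (k : ℕ) + 1 = l → P.MatchEq lg l → P.MatchEq lg k := by
    intro k l hkl hl
    obtain ⟨-, -, h3, h1, h2⟩ := castSucc_ne_of_next hkl
    refine hact k (Or.inr fun e => hexp l k ?_ ?_)
    · have := (hedge k l hkl).2.ne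
      rwa [A0, Matrix.map_apply, hsymm, ← Matrix.map_apply (f := Complex.re)] at this
    · rw [hl.column_zero hloc k, hother _ _ h1 h2, div_self (hq _ _), ← h3, e, div_self (hq _ _),
        div_one]
  obtain ⟨i, j₀, hij⟩ := hne
  have h0 : P.MatchEq lg j₀ := by
    refine hact j₀ ?_
    by_cases h1 : i = j₀.castSucc
    · exact Or.inl (h1 ▸ hij)
    by_cases h2 : i = j₀.succ
    · exact Or.inr (h2 ▸ hij)
    exact absurd (hother i j₀ h1 h2) hij
  have hzero : ∀ n (hn : n < L), P.MatchEq lg ⟨n, hn⟩ ↔ P.MatchEq lg ⟨0, by omega⟩ := by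
    intro n
    induction n with
    | zero => exact fun _ => Iff.rfl
    | succ n ih => exact fun hn => ⟨fun h => (ih (by omega)).1 (hdown _ _ rfl h),
        fun h => hup _ _ rfl ((ih (by omega)).2 h)⟩
  exact (hzero j j.2).2 ((hzero j₀ j₀.2).1 h0)

/-- Normalizing s_j(m) to 1 for m > 0 determines α_j there; the values at negative m are then forced
by α_j(-m) = α_j(m)⁻¹. -/
lemma exists_scaling {s : Fin L → ℤ → ℂ} (hs : ∀ j m, m ≠ 0 → s j m ≠ 0) (ε : Fin L → ℤˣ) :
    ∃ α : Fin L → ℤ → ℂ, (∀ j m, α j m ≠ 0 ∧ α j (-m) = (α j m)⁻¹) ∧ (∀ j, α j 0 = 1) ∧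
      ∀ j (m : ℤ), 0 < m → sgn ε j ^ m * (α j m * s j m) = 1 := by
  refine ⟨fun j m => if 0 < m then (sgn ε j ^ m * s j m)⁻¹
    else if m < 0 then sgn ε j ^ (-m) * s j (-m) else 1, fun j m => ?_, fun j => by simp,
    fun j m hm => ?_⟩
  · have h1 : ∀ m : ℤ, m ≠ 0 → sgn ε j ^ m * s j m ≠ 0 := fun m hm =>
      mul_ne_zero (zpow_ne_zero _ (sgn_ne_zero j)) (hs j m hm)
    rcases lt_trichotomy m 0 with h | h | h
    · simp only [if_neg h.not_gt, if_pos h, if_pos (neg_pos.2 h)]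
      exact ⟨h1 _ (by omega), trivial⟩
    · simp [h]
    · simp only [if_pos h, if_neg (by omega : ¬ 0 < -m), if_pos (by omega : -m < 0), neg_neg,
        inv_inv]
      exact ⟨inv_ne_zero (h1 m h.ne'), trivial⟩
  · have h1 := zpow_ne_zero m (sgn_ne_zero (ε := ε) j)
    have h2 := hs j m hm.ne'
    simp only [if_pos hm]
    generalize sgn ε j ^ m = e at *
    field_simp

/-- A solution of the equations is explicit up to freedom. -/
lemma LocalSolution.isExplicitUpToFreedom (h : P.LocalSolution lg) {u η : ℂ} {r : ℝ}
    (hu : ∀ j, lg (P.ratio j) = u) (hM : IsExtendedCartan hL P.A0 r) (hr : 1 < r)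
    (hη : 2 * r * η = u) (hx : ‖Complex.exp η‖ ≠ 1) (hdet : ∀ m, (P.A m).det ≠ 0)
    (hg : P.g 0 ≠ 0) : ∃ g₀ : ℂ, g₀ ≠ 0 ∧ P.IsExplicitUpToFreedom hL r η g₀ := by
  have hL0 : 0 < L := by omega
  have hlr : lg (Complex.exp (2 * r * η)) = 2 * r * η := by
    rw [hη, ← hu ⟨0, hL0⟩, h.exp_lg_ratio]
  obtain ⟨t, ht, hε⟩ := h.exists_sign hu hM hr hη
  choose ε hε using hε
  obtain ⟨α, hα, hα0, hαs⟩ := exists_scaling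
    (fun j m hm => h.s_ne_zero hu hM hr hη hx j hm) ε
  have hd : IsWeight L r (weight hL P.A0 r) := isWeight_weight
  -- Stated for every central shift, because the right one is computed from the weight form already
  -- obtained with shift 0.
  have key : ∀ ν : Fin L → ℂ, (∀ j, ∃ n : ℤ, ∑ k, ν k * P.A 0 k j = 2 * Real.pi * Complex.I * n) →
      (P.change t α ε ν).LocalSolution lg ∧
        (P.change t α ε ν).ChainForm r η (weight hL P.A0 r) := by
    intro ν hν
    have h' := h.change ht hα hα0 (ε := ε) hν
    have hA0 : (P.change t α ε ν).A0 = P.A0 := change_A0 hα0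
    have hu' : ∀ j, lg ((P.change t α ε ν).ratio j) = u := fun j => by
      rw [ratio, change_q_div ht, hu]
    refine ⟨h', ?_⟩
    rw [← hA0]
    refine h'.chainForm hu' (by rwa [hA0]) hr hη hx fun j => ?_
    rw [hA0, change_q, hε]
  have hc := (key 0 fun j => ⟨0, by simp⟩).2
  -- The difference between the explicit and the given zero modes of Λ_1. Both satisfy the same
  -- exponentiated locality equation, so this shift is admissible.
  set ν : Fin L → ℂ := fun k => zeroPhi L r η (weight hL P.A0 r) 0 (k + 1) - P.lam 0 k 0
  have hν : ∀ j, ∃ n : ℤ, ∑ k, ν k * P.A 0 k j = 2 * Real.pi * Complex.I * n := by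
    intro j
    have e1 := hc.exp_sum_zeroPhi hr hd (fun i j =>
      mul_ne_zero (sgn_ne_zero j) (mul_ne_zero ht (h.q_ne_zero i j))) 0 j
    rw [change_q_div_p ht, ← h.locality.zero, change_A_zero hα0] at e1
    have e2 : Complex.exp (∑ k, ν k * P.A 0 k j) = 1 := by
      simp only [ν, sub_mul, sum_sub_distrib]
      rw [Complex.exp_sub]
      exact (div_eq_one_iff_eq (Complex.exp_ne_zero _)).2 e1
    obtain ⟨n, hn⟩ := Complex.exp_eq_one_iff.1 e2
    exact ⟨n, by rw [hn]; ring⟩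
  obtain ⟨h', hc'⟩ := key ν hν
  have hA0 : (P.change t α ε ν).A0 = P.A0 := change_A0 hα0
  have hu' : ∀ j, lg ((P.change t α ε ν).ratio j) = u := fun j => by
    rw [ratio, change_q_div ht, hu]
  have hM' : IsExtendedCartan hL (P.change t α ε ν).A0 r := by rwa [hA0]
  have hl' := h'.lamForm hu' hr hη hx hd hc' (fun j m hm => h'.s_ne_zero hu' hM' hr hη hx j hm)
    (fun m => det_change_ne_zero hα (hdet m)) fun k => by
      rw [change_lam_zero hα0]
      simp [ν]
  have hn1 : nint η (r - 1) ≠ 0 := nint_ne_zero hx (by linarith)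
  have hgn : ∀ i : Fin (L + 1), P.g i * nint η (r - weight hL P.A0 r i) =
      P.g 0 * nint η (r - weight hL P.A0 r 0) := by
    intro i
    induction i using Fin.induction with
    | zero => rfl
    | succ j ih =>
      have := (hc'.scalar_iff hr hlr j).1 (h'.matching j).scalar
      rw [change_g, change_g] at this
      rw [← ih, Fin.val_succ, ← this, Fin.val_castSucc]
  refine ⟨P.g 0 * nint η (r - weight hL P.A0 r 0) / nint η (r - 1), div_ne_zero (mul_ne_zero hg
    (nint_ne_zero hx (by linarith [hd.lt hr (Nat.zero_le L)]))) hn1, t, α, ε, ν, ht, hα, hα0, hν,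
    ?_⟩
  rw [← hA0] at hc' hl'
  refine hc'.isExplicit hl' hx hr h'.real hM' (fun j m hm => ?_) (fun j m hm => h'.A_diag m hm j)
    h'.A_symm fun i => ?_
  · rw [change_s, hαs j m hm]
  · rw [hA0, div_mul_cancel₀ _ hn1, change_g, hgn]

/-- The conditions determine the parameters and the currents. -/
theorem explicit_of_conditions (hlg : ∀ u : ℂ, u ≠ 0 → Complex.exp (lg u) = u)
    {B : Fin L → ℂ → Fock L → Fock L} (hA : IsHeisenberg P.A)
    (hreal : ∀ i j, (P.A 0 i j).im = 0) (hg : ∀ i, P.g i ≠ 0)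
    (hpq : ∀ i j, P.p i j ≠ 0 ∧ P.q i j ≠ 0) (hne : ∃ i j, P.p i j ≠ P.q i j)
    (hloc : P.MutualLocality) (hB : P.Commutativity lg B) (hsymm : P.Symmetry)
    (hinj : ∀ j, Function.Injective fun i => P.q i j)
    (hnorm : ∀ j : Fin L, ‖P.q j.succ j / P.q j.castSucc j‖ ≠ 1)
    (hedge : ∀ k l : Fin L, (k : ℕ) + 1 = l → -1 < P.A0 k l ∧ P.A0 k l < 0) {r : ℝ} {η : ℂ}
    (hr : r = rParam hL P.A0) {i : Fin L} (hη : η = lg (P.ratio i) / (2 * r)) :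
    1 < r ∧ ‖Complex.exp η‖ ≠ 1 ∧ (∃ g₀ : ℂ, g₀ ≠ 0 ∧ P.IsExplicitUpToFreedom hL r η g₀) ∧
      ∀ j c v, B j c v = P.current lg j c v := by
  obtain ⟨hdiag, hA2, hdet⟩ := hA
  have hA' : ∀ m : ℤ, m ≠ 0 → ∀ i j, P.A m i j = P.A (-m) j i := by
    intro m hm i j
    by_cases hij : i = j
    · rw [hij, hdiag m hm, hdiag (-m) (neg_ne_zero.2 hm)]
    · exact hA2 m i j hij
  have hp : ∀ i j, P.p i j ≠ 0 := fun i j => (hpq i j).1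
  have hq : ∀ i j, P.q i j ≠ 0 := fun i j => (hpq i j).2
  have hloc' := (mutualLocality_iff hA' hp hq).1 hloc
  obtain ⟨hcur, hother, hact⟩ := matchEq_of_commutativity (fun m _ => hdet m) hp hq hlg hg hloc
    hinj hB
  have h : P.LocalSolution lg :=
    { A_diag := hdiag
      A_symm := hA2
      real := hreal
      edge_mem := hedge
      p_ne_zero := hp
      q_ne_zero := hq
      exp_lg := hlg
      norm_ratio := hnorm
      p_other := hother
      locality := hloc'
      symmetry := (symmetry_iff hA').1 hsymm
      matching := matchEq_of_active hlg hq (fun i j => by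
          by_cases hij : i = j
          · rw [hij]
          · rw [hA2 0 i j hij, neg_zero]) hreal hedge hnorm hother hloc'
        (fun j hj => (hact j hj).2.2) hne }
  obtain ⟨hr1, hβ⟩ := LocalSolution.rParam_spec (hL := hL)
    (hedge ⟨0, Nat.zero_lt_of_lt hL⟩ ⟨1, hL⟩ rfl)
  rw [← hr] at hr1 hβ
  have hr0 : (r : ℂ) ≠ 0 := by exact_mod_cast (by linarith : r ≠ 0)
  have hη' : 2 * r * η = lg (P.ratio i) := by
    rw [hη]
    field_simp
  -- The ratios are equal as complex numbers, so the fixed function `lg` assigns them one common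
  -- logarithm.
  have hu : ∀ j, lg (P.ratio j) = lg (P.ratio i) := fun j => by rw [h.ratio_eq j i]
  have hx : ‖Complex.exp η‖ ≠ 1 := by
    have h1 := h.re_lg_ratio i
    rw [← hη'] at h1
    rw [Complex.norm_exp, ne_eq, Real.exp_eq_one_iff]
    intro e
    refine h1 ?_
    rw [show (2 * r * η : ℂ) = ((2 * r : ℝ) : ℂ) * η by push_cast; ring, Complex.re_ofReal_mul, e,
      mul_zero]
  exact ⟨hr1, hx, h.isExplicitUpToFreedom hu (h.isExtendedCartan hu hr1 hβ) hr1 hη' hx hdet (hg 0),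
    hcur⟩

end Params

end DeformedW
end

theorem theorem3p1 (L : ℕ) (hL : 2 ≤ L)
    -- a determination of the logarithm, used for the powers of the ratios `q_{j+1,j} / q_{j,j}`
    (lg : ℂ → ℂ) (hlg : ∀ u : ℂ, u ≠ 0 → Complex.exp (lg u) = u) :
    -- the parameters and the currents are determined by the conditions
    (∀ (P : Params L) (B : Fin L → ℂ → Fock L → Fock L),
      IsHeisenberg P.A →
      (∀ i j, (P.A 0 i j).im = 0) →
      (oddSet P.A0).Nonempty →
      (∀ i, P.g i ≠ 0) →
      (∀ i j, P.p i j ≠ 0 ∧ P.q i j ≠ 0) →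
      (∃ i j, P.p i j ≠ P.q i j) →
      P.MutualLocality →
      P.Commutativity lg B →
      P.Symmetry →
      (∀ j, Function.Injective fun i => P.q i j) →
      (∀ j : Fin L, ‖P.q j.succ j / P.q j.castSucc j‖ ≠ 1) →
      (∀ k l : Fin L, (k : ℕ) + 1 = l → -1 < P.A0 k l ∧ P.A0 k l < 0) →
      ∀ (r : ℝ) (η : ℂ), r = rParam hL P.A0 →
        η = lg (P.q ⟨1, by omega⟩ ⟨0, by omega⟩ / P.q ⟨0, by omega⟩ ⟨0, by omega⟩) / (2 * r) →
        1 < r ∧ ‖Complex.exp η‖ ≠ 1 ∧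
        (∃ g₀ : ℂ, g₀ ≠ 0 ∧ P.IsExplicitUpToFreedom hL r η g₀) ∧
        ∀ j c v, B j c v = P.current lg j c v) ∧
    -- conversely, the explicit parameters and currents satisfy the conditions
    (∀ (P : Params L) (r : ℝ) (η g₀ : ℂ), 1 < r → ‖Complex.exp η‖ ≠ 1 →
      lg (Complex.exp (2 * r * η)) = 2 * r * η →
      (oddSet P.A0).Nonempty →
      (∀ i j, P.q i j ≠ 0) →
      P.IsExplicitUpToFreedom hL r η g₀ →
      P.MutualLocality ∧ P.Commutativity lg (P.current lg) ∧ P.Symmetry) := by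
  exact ⟨fun P B hA hreal _ hg hpq hne hloc hB hsymm hinj hnorm hedge r η hr hη =>
    Params.explicit_of_conditions hlg hA hreal hg hpq hne hloc hB hsymm hinj hnorm hedge hr
      (i := ⟨0, Nat.zero_lt_of_lt hL⟩) hη,
    fun P r η g₀ hr hη hlr _ hq h => h.conditions hlg hη hr hlr hq⟩
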